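/- Let $\mathbb F$ be a field of characteristic $0$. A DGCA is a unital, non-negatively graded, graded commutative differential graded algebra over $\mathbb F$ with differential $d$ of degree $+1$. A *Poincaré DGCA of degree $n$* is a DGCA $\mathcal A^*=\bigoplus_{k=0}^n\mathcal A^k$ with finite dimensional cohomology algebra $H^*=H^*(\mathcal A^*)$, together with a linear functional $\int\colon H^n\to\mathbb F$ such that the pairing on $H^*$ given by $\langle x^k,y^l\rangle=\int x^k y^l$ if $k+l=n$, and $0$ otherwise, is non-degenerate. On $\mathcal A^*$ put $\langle a^k,b^l\rangle=\int[a^kb^l]$ if $k+l=n$, and $0$ otherwise. A *Hodge type decomposition* is a direct sum decomposition into graded subspaces $\mathcal A^*=d\mathcal A^{*-1}\oplus\mathcal H^*\oplus\mathcal B^*$ with $\ker d=d\mathcal A^{*-1}\oplus\mathcal H^*$ and $\langle\mathcal H^*\oplus\mathcal B^*,\mathcal B^*\rangle=0$; $\mathcal A^*$ is *of Hodge type* if one exists. Given one, let $\pi_{\mathcal H}$ be the projection to $\mathcal H^*$, and let $d^-\colon\mathcal A^*\to\mathcal A^{*-1}$ be the inverse of $d\colon\mathcal B^*\to d\mathcal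 A^*$ on $d\mathcal A^*$ and zero on $\mathcal H^*\oplus\mathcal B^*$. $\mathcal A^*$ is *$(r-1)$-connected* if $H^0\cong\mathbb F$ and $H^k=0$ for $1\le k\le r-1$. Put $H^*_+=\bigoplus_{k\ge1}H^k$. A *generating subspace* is a graded subspace $H^*_{gen}\subseteq H^*_+$ with $H^*_+=H^*_{gen}\oplus(H^*_+\cdot H^*_+)$. A (partial) splitting map is a degree preserving linear map $\imath\colon H^*\to\ker d$ (resp. $\imath_0\colon H^*_{gen}\to\ker d$) that sends each class to a cocycle representing it. A choice of *adapted harmonic forms and associated Hodge decomposition* consists of a splitting map $\imath$ which, for some generating subspace $H^*_{gen}$ and some partial splitting map $\imath_0$ on it, restricts to $\imath_0$ on $H^*_{gen}$ and has image in the subalgebra generated by $\imath_0(H^*_{gen})$, and of a Hodge type decomposition with $\mathcal H^*=\imath(H^*)$. For such a choice, the transferred ternary product on $H^*$ is the trilinear map of degree $-1$ $$\mu_3(x,y,z)=\big[\pi_{\mathcal H}\big(d^-(\imath x\cdot\imath y)\cdot\imath z-(-1)^{|x|}\,\imath x\cdot d^-(\imath y\cdot\imath z)\big)\big].$$ $\mathsf{Hoch}^{3,-1}(H^*,H^*)$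 is the space of trilinear maps $f\colon (H^*)^{\otimes3}\to H^*$ of degree $-1$ with $$(-1)^{|a|}a f(b,c,e)-f(ab,c,e)+f(a,bc,e)-f(a,b,ce)+f(a,b,c)e=0,$$ modulo the maps $(a,b,c)\mapsto(-1)^{|a|}a\varphi(b,c)-\varphi(ab,c)+\varphi(a,bc)-\varphi(a,b)c$ with $\varphi\colon (H^*)^{\otimes2}\to H^*$ bilinear of degree $-1$. A DGCA is *formal* if a finite zig-zag of quasi-isomorphisms of DGCAs connects it to its cohomology algebra with zero differential. **Theorem.** Let $r>1$, and let $\mathcal A^*$ be an $(r-1)$-connected Poincaré DGCA of degree $n$ of Hodge type with $n\le 5r-3$. Choices of adapted harmonic forms and associated Hodge decomposition exist. For every such choice $\mu_3$ is a Hochschild cocycle, and its class $[\mu_3]\in\mathsf{Hoch}^{3,-1}(H^*,H^*)$ does not depend on the choice. Moreover, $\mathcal A^*$ is formal if and only if $[\mu_3]=0$. -/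

import Mathlib

set_option maxSynthPendingDepth 5

universe u v

/-- A differential graded commutative algebra over `F`: a unital, associative, non-negatively graded
algebra, commutative in the graded sense, with a differential of degree `+1` which is a graded
derivation. -/
structure DGCA (F : Type u) [Field F] where
  carrier : Type v
  [ring : Ring carrier]
  [algebra : Algebra F carrier]
  grading : ℕ → Submodule F carrier
  [gradedAlgebra : GradedAlgebra grading]
  d : carrier →ₗ[F] carrier
  d_mem : ∀ {k : ℕ} {a : carrier}, a ∈ grading k → d a ∈ grading (k + 1)
  d_d : ∀ a : carrier, d (d a) = 0
  leibniz : ∀ {k : ℕ} {a : carrier}, a ∈ grading k → ∀ b : carrier,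
    d (a * b) = d a * b + (-1 : F) ^ k • (a * d b)
  graded_comm : ∀ {i j : ℕ} {a b : carrier}, a ∈ grading i → b ∈ grading j →
    a * b = (-1 : F) ^ (i * j) • (b * a)

namespace DGCA

attribute [instance] DGCA.ring DGCA.algebra DGCA.gradedAlgebra

variable {F : Type u} [Field F]

section Basic

variable (A : DGCA.{u, v} F)

/-- The homogeneous component of degree `k`. -/
noncomputable def proj (k : ℕ) : A.carrier →ₗ[F] A.carrier :=
  GradedAlgebra.proj A.grading k

/-- The linear operator which multiplies homogeneous elements of degree `k` by `(-1) ^ k`. -/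
noncomputable def signOp : A.carrier →ₗ[F] A.carrier :=
  (DirectSum.toModule F ℕ A.carrier (fun k => (-1 : F) ^ k • (A.grading k).subtype)) ∘ₗ
    (DirectSum.decomposeLinearEquiv A.grading).toLinearMap

theorem signOp_of_mem {k : ℕ} {a : A.carrier} (ha : a ∈ A.grading k) :
    A.signOp a = (-1 : F) ^ k • a := by
  rw [signOp, LinearMap.comp_apply, LinearEquiv.coe_coe, DirectSum.decomposeLinearEquiv_apply,
    DirectSum.decompose_of_mem _ ha, ← DirectSum.lof_eq_of F, DirectSum.toModule_lof]
  rfl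

theorem proj_mem (k : ℕ) (a : A.carrier) : A.proj k a ∈ A.grading k := by
  simp [proj, GradedAlgebra.proj_apply]

theorem proj_of_mem {k : ℕ} {a : A.carrier} (ha : a ∈ A.grading k) : A.proj k a = a := by
  simp [proj, GradedAlgebra.proj_apply, DirectSum.decompose_of_mem_same _ ha]

theorem proj_of_mem_ne {k l : ℕ} {a : A.carrier} (ha : a ∈ A.grading k) (h : k ≠ l) :
    A.proj l a = 0 := by
  simp [proj, GradedAlgebra.proj_apply, DirectSum.decompose_of_mem_ne _ ha h]

@[elab_as_elim]
theorem hom_induction {p : A.carrier → Prop} (h0 : p 0)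
    (hh : ∀ (k : ℕ) (a : A.carrier), a ∈ A.grading k → p a)
    (hadd : ∀ a b, p a → p b → p (a + b)) (a : A.carrier) : p a :=
  DirectSum.Decomposition.inductionOn A.grading h0 (fun m => hh _ _ m.2) hadd a

theorem leibniz_signOp (a b : A.carrier) :
    A.d (a * b) = A.d a * b + A.signOp a * A.d b := by
  induction a using A.hom_induction with
  | h0 => simp
  | hh k a ha => rw [A.leibniz ha, A.signOp_of_mem ha, smul_mul_assoc]
  | hadd a b ha hb => simp only [add_mul, map_add, ha, hb]; abel

theorem d_signOp (a : A.carrier) : A.d (A.signOp a) = - A.signOp (A.d a) := by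
  induction a using A.hom_induction with
  | h0 => simp
  | hh k a ha => simp [A.signOp_of_mem ha, A.signOp_of_mem (A.d_mem ha), pow_succ]
  | hadd a b ha hb => simp only [map_add, ha, hb, neg_add]

theorem signOp_signOp (a : A.carrier) : A.signOp (A.signOp a) = a := by
  induction a using A.hom_induction with
  | h0 => simp
  | hh k a ha => simp [A.signOp_of_mem ha, smul_smul, ← pow_add, ← two_mul]
  | hadd a b ha hb => simp only [map_add, ha, hb]

theorem d_one : A.d 1 = 0 := by
  have h := A.leibniz (SetLike.GradedOne.one_mem (A := A.grading)) 1
  simpa using h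

theorem proj_d (k : ℕ) (a : A.carrier) : A.proj (k + 1) (A.d a) = A.d (A.proj k a) := by
  induction a using A.hom_induction with
  | h0 => simp
  | hh l a ha =>
    by_cases h : l = k
    · subst h
      rw [A.proj_of_mem ha, A.proj_of_mem (A.d_mem ha)]
    · rw [A.proj_of_mem_ne ha h, A.proj_of_mem_ne (A.d_mem ha) (by omega), map_zero]
  | hadd a b ha hb => simp only [map_add, ha, hb]

theorem proj_zero_d (a : A.carrier) : A.proj 0 (A.d a) = 0 := by
  induction a using A.hom_induction with
  | h0 => simp
  | hh l a ha => exact A.proj_of_mem_ne (A.d_mem ha) (by omega)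
  | hadd a b ha hb => simp only [map_add, ha, hb, add_zero]

theorem d_proj_of_d_eq_zero {a : A.carrier} (ha : A.d a = 0) (k : ℕ) : A.d (A.proj k a) = 0 := by
  rw [← proj_d, ha, map_zero]

/-- A linear subspace is graded if it contains the homogeneous components of its elements. -/
def IsGraded (W : Submodule F A.carrier) : Prop :=
  ∀ (k : ℕ) (a : A.carrier), a ∈ W → A.proj k a ∈ W

/-- The algebra of cocycles. -/
def cocycles : Subalgebra F A.carrier where
  carrier := {a | A.d a = 0}
  mul_mem' := by
    intro a b ha hb
    simp only [Set.mem_ofPred_eq] at *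
    rw [leibniz_signOp, ha, hb, zero_mul, mul_zero, add_zero]
  add_mem' := by
    intro a b ha hb
    simp only [Set.mem_ofPred_eq] at *
    rw [map_add, ha, hb, add_zero]
  algebraMap_mem' := by
    intro r
    simp [Algebra.algebraMap_eq_smul_one, d_one]

theorem mem_cocycles {a : A.carrier} : a ∈ A.cocycles ↔ A.d a = 0 := Iff.rfl

/-- The ideal of coboundaries in the algebra of cocycles. -/
def coboundaries : Ideal A.cocycles where
  carrier := {z | ∃ c : A.carrier, A.d c = z}
  add_mem' := by
    rintro a b ⟨x, hx⟩ ⟨y, hy⟩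
    exact ⟨x + y, by simp [hx, hy]⟩
  zero_mem' := ⟨0, by simp⟩
  smul_mem' := by
    rintro z b ⟨x, hx⟩
    refine ⟨A.signOp z * x, ?_⟩
    have hz : A.d (z : A.carrier) = 0 := z.2
    rw [leibniz_signOp, d_signOp, signOp_signOp, hz, hx]
    simp

theorem mem_coboundaries {z : A.cocycles} :
    z ∈ A.coboundaries ↔ ∃ c : A.carrier, A.d c = z := Iff.rfl

instance : A.coboundaries.IsTwoSided where
  mul_mem_of_left := by
    rintro a z ⟨x, hx⟩
    refine ⟨x * z, ?_⟩
    have hz : A.d (z : A.carrier) = 0 := z.2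
    rw [leibniz_signOp, hz, hx]
    simp

/-- The underlying algebra of the cohomology: cocycles modulo coboundaries. -/
abbrev Coh : Type v := A.cocycles ⧸ A.coboundaries

/-- The cohomology class of a cocycle. -/
noncomputable def cls : A.cocycles →ₐ[F] A.Coh := Ideal.Quotient.mkₐ F A.coboundaries

theorem cls_surjective : Function.Surjective A.cls :=
  Ideal.Quotient.mkₐ_surjective F A.coboundaries

theorem cls_eq_zero_iff {z : A.cocycles} : A.cls z = 0 ↔ ∃ c : A.carrier, A.d c = z := by
  rw [← A.mem_coboundaries]
  exact Ideal.Quotient.eq_zero_iff_mem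

/-- The classes of the cocycles of degree `k`. -/
noncomputable def cohGrading (k : ℕ) : Submodule F A.Coh :=
  ((A.grading k).comap A.cocycles.val.toLinearMap).map A.cls.toLinearMap

theorem mem_cohGrading {k : ℕ} {x : A.Coh} :
    x ∈ A.cohGrading k ↔ ∃ z : A.cocycles, (z : A.carrier) ∈ A.grading k ∧ A.cls z = x := by
  simp [cohGrading, Submodule.mem_map]

/-- The homogeneous component of degree `k` of a cocycle. -/
noncomputable def cocyclesProj (k : ℕ) : A.cocycles →ₗ[F] A.cocycles where
  toFun z := ⟨A.proj k z, A.d_proj_of_d_eq_zero z.2 k⟩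
  map_add' a b := by ext; simp
  map_smul' r a := by ext; simp

/-- The homogeneous component of degree `k` of a cohomology class. -/
noncomputable def cohProj (k : ℕ) : A.Coh →ₗ[F] A.Coh where
  toFun := Quotient.lift (fun z => A.cls (A.cocyclesProj k z)) (by
    intro a b hab
    have h : a - b ∈ A.coboundaries := (Submodule.quotientRel_def _).1 hab
    obtain ⟨c, hc⟩ := h
    rw [← sub_eq_zero, ← map_sub, ← map_sub, cls_eq_zero_iff]
    change ∃ c, A.d c = A.proj k ((a - b : A.cocycles) : A.carrier)
    rw [← hc]
    cases k with
    | zero => exact ⟨0, by rw [proj_zero_d, map_zero]⟩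
    | succ k => exact ⟨A.proj k c, by rw [proj_d]⟩)
  map_add' a b := by
    obtain ⟨a, rfl⟩ := A.cls_surjective a
    obtain ⟨b, rfl⟩ := A.cls_surjective b
    change A.cls (A.cocyclesProj k (a + b)) =
      A.cls (A.cocyclesProj k a) + A.cls (A.cocyclesProj k b)
    simp
  map_smul' r a := by
    obtain ⟨a, rfl⟩ := A.cls_surjective a
    change A.cls (A.cocyclesProj k (r • a)) = r • A.cls (A.cocyclesProj k a)
    simp

theorem cohProj_cls (k : ℕ) (z : A.cocycles) :
    A.cohProj k (A.cls z) = A.cls (A.cocyclesProj k z) := rfl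

theorem cohProj_of_mem {k : ℕ} {x : A.Coh} (hx : x ∈ A.cohGrading k) : A.cohProj k x = x := by
  obtain ⟨z, hz, rfl⟩ := A.mem_cohGrading.1 hx
  rw [cohProj_cls]
  congr 1
  exact Subtype.ext (A.proj_of_mem hz)

theorem cohProj_of_mem_ne {k l : ℕ} {x : A.Coh} (hx : x ∈ A.cohGrading k) (h : k ≠ l) :
    A.cohProj l x = 0 := by
  obtain ⟨z, hz, rfl⟩ := A.mem_cohGrading.1 hx
  rw [cohProj_cls]
  have : A.cocyclesProj l z = 0 := Subtype.ext (A.proj_of_mem_ne hz h)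
  rw [this, map_zero]

theorem cohGrading_isInternal : DirectSum.IsInternal A.cohGrading := by
  classical
  rw [DirectSum.isInternal_submodule_iff_iSupIndep_and_iSup_eq_top]
  constructor
  · intro k
    rw [Submodule.disjoint_def]
    intro x hx hx'
    have h : (⨆ j, ⨆ (_ : j ≠ k), A.cohGrading j) ≤ LinearMap.ker (A.cohProj k) := by
      refine iSup₂_le fun j hj y hy => ?_
      exact A.cohProj_of_mem_ne hy hj
    rw [← A.cohProj_of_mem hx]
    exact h hx'
  · rw [eq_top_iff]
    intro x _
    obtain ⟨z, rfl⟩ := A.cls_surjective x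
    have hz : z = ∑ k ∈ (DirectSum.decompose A.grading (z : A.carrier)).support,
        A.cocyclesProj k z := by
      apply Subtype.ext
      rw [AddSubmonoidClass.coe_finsetSum]
      exact (DirectSum.sum_support_decompose A.grading (z : A.carrier)).symm
    rw [hz, map_sum]
    refine Submodule.sum_mem _ fun k _ => ?_
    exact Submodule.mem_iSup_of_mem k (A.mem_cohGrading.2 ⟨_, A.proj_mem k z, rfl⟩)

noncomputable instance : GradedAlgebra A.cohGrading where
  toDecomposition := A.cohGrading_isInternal.chooseDecomposition
  one_mem := A.mem_cohGrading.2 ⟨1, SetLike.GradedOne.one_mem, map_one _⟩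
  mul_mem := by
    intro i j x y hx hy
    obtain ⟨a, ha, rfl⟩ := A.mem_cohGrading.1 hx
    obtain ⟨b, hb, rfl⟩ := A.mem_cohGrading.1 hy
    exact A.mem_cohGrading.2 ⟨a * b, SetLike.GradedMul.mul_mem ha hb, map_mul _ _ _⟩

/-- The cohomology algebra, as a DGCA with zero differential. -/
noncomputable abbrev cohomology : DGCA.{u, v} F where
  carrier := A.Coh
  grading := A.cohGrading
  d := 0
  d_mem _ := by simp
  d_d _ := by simp
  leibniz _ _ := by simp
  graded_comm := by
    intro i j x y hx hy
    obtain ⟨a, ha, rfl⟩ := A.mem_cohGrading.1 hx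
    obtain ⟨b, hb, rfl⟩ := A.mem_cohGrading.1 hy
    rw [← map_mul, ← map_mul, ← map_smul]
    congr 1
    exact Subtype.ext (A.graded_comm ha hb)

/-- `m`-connectedness: `H⁰` is one-dimensional and `Hᵏ = 0` for `1 ≤ k ≤ m`. -/
def IsConnected (m : ℕ) : Prop :=
  Module.finrank F (A.cohomology.grading 0) = 1 ∧
    ∀ k : ℕ, 1 ≤ k → k ≤ m → A.cohomology.grading k = ⊥

/-- The pairing on the cohomology induced by a linear functional `∫` in degree `n`: it is `∫ x y` if
the degrees of `x` and `y` sum up to `n`, and zero for other homogeneous classes. -/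
noncomputable def cohPairing {n : ℕ} (I : A.cohGrading n →ₗ[F] F) (x y : A.Coh) : F :=
  I (DirectSum.decompose A.cohGrading (x * y) n)

end Basic

section Formality

/-- Morphisms of DGCAs: unital algebra maps of degree zero which commute with the differentials. -/
structure Hom (A B : DGCA.{u, v} F) extends A.carrier →ₐ[F] B.carrier where
  map_grading : ∀ {k : ℕ} {a : A.carrier}, a ∈ A.grading k → toFun a ∈ B.grading k
  map_d : ∀ a : A.carrier, toFun (A.d a) = B.d (toFun a)

variable {A B : DGCA.{u, v} F}

/-- The restriction of a morphism to cocycles. -/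
def Hom.mapCocycles (f : Hom A B) : A.cocycles →ₐ[F] B.cocycles :=
  (f.toAlgHom.comp A.cocycles.val).codRestrict B.cocycles (fun z => by
    have h := f.map_d z
    have hz : A.d (z : A.carrier) = 0 := z.2
    rw [hz] at h
    exact h.symm.trans (map_zero f.toAlgHom))

/-- The map induced by a morphism on cohomology. -/
noncomputable def Hom.mapCoh (f : Hom A B) : A.Coh →ₐ[F] B.Coh :=
  Ideal.Quotient.liftₐ A.coboundaries (B.cls.comp f.mapCocycles) (by
    rintro z ⟨c, hc⟩
    exact B.cls_eq_zero_iff.2 ⟨f.toFun c, by rw [← f.map_d, hc]; rfl⟩)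

/-- A quasi-isomorphism induces a bijection on cohomology. -/
def Hom.IsQuasiIso (f : Hom A B) : Prop := Function.Bijective f.mapCoh

/-- Two DGCAs are equivalent if a finite zig-zag of quasi-isomorphisms of DGCAs connects them. -/
def Equivalent (A B : DGCA.{u, v} F) : Prop :=
  Relation.EqvGen (fun X Y : DGCA.{u, v} F => ∃ f : Hom X Y, f.IsQuasiIso) A B

/-- A DGCA is formal if it is equivalent to its cohomology algebra with zero differential. -/
def IsFormal (A : DGCA.{u, v} F) : Prop := Equivalent A A.cohomology

end Formality

section Hochschild

variable (H : DGCA.{u, v} F)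

/-- The part of degree `m`, for an integer `m`; it is zero for negative `m`. -/
def intGrading (m : ℤ) : Submodule F H.carrier :=
  if 0 ≤ m then H.grading m.toNat else ⊥

/-- The bilinear Hochschild cochains of internal degree `q`. -/
def hochCochains₂ (q : ℤ) :
    Submodule F (H.carrier →ₗ[F] H.carrier →ₗ[F] H.carrier) where
  carrier := {f | ∀ (i j : ℕ) (a b : H.carrier), a ∈ H.grading i → b ∈ H.grading j →
    f a b ∈ H.intGrading ((i : ℤ) + j + q)}
  add_mem' := by
    intro f g hf hg i j a b ha hb
    exact add_mem (hf i j a b ha hb) (hg i j a b ha hb)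
  zero_mem' := by
    intro i j a b _ _
    exact zero_mem _
  smul_mem' := by
    intro r f hf i j a b ha hb
    exact Submodule.smul_mem _ r (hf i j a b ha hb)

/-- The trilinear Hochschild cochains of internal degree `q`. -/
def hochCochains₃ (q : ℤ) :
    Submodule F (H.carrier →ₗ[F] H.carrier →ₗ[F] H.carrier →ₗ[F] H.carrier) where
  carrier := {f | ∀ (i j k : ℕ) (a b c : H.carrier),
    a ∈ H.grading i → b ∈ H.grading j → c ∈ H.grading k →
    f a b c ∈ H.intGrading ((i : ℤ) + j + k + q)}
  add_mem' := by
    intro f g hf hg i j k a b c ha hb hc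
    exact add_mem (hf i j k a b c ha hb hc) (hg i j k a b c ha hb hc)
  zero_mem' := by
    intro i j k a b c _ _ _
    exact zero_mem _
  smul_mem' := by
    intro r f hf i j k a b c ha hb hc
    exact Submodule.smul_mem _ r (hf i j k a b c ha hb hc)

/-- The trilinear cochains `f` of degree `q` with vanishing Hochschild differential
`(δf)(a, b, c, e) = (-1)^(q|a|) a f(b, c, e) - f(ab, c, e) + f(a, bc, e) - f(a, b, ce) + f(a, b, c) e`. -/
def hochCocycles₃ (q : ℤ) :
    Submodule F (H.carrier →ₗ[F] H.carrier →ₗ[F] H.carrier →ₗ[F] H.carrier) where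
  carrier := {f | f ∈ H.hochCochains₃ q ∧
    ∀ (i : ℕ) (a b c e : H.carrier), a ∈ H.grading i →
      (-1 : F) ^ (q * (i : ℤ)) • (a * f b c e) - f (a * b) c e + f a (b * c) e
        - f a b (c * e) + f a b c * e = 0}
  add_mem' := by
    rintro f g ⟨hf, hf'⟩ ⟨hg, hg'⟩
    refine ⟨add_mem hf hg, fun i a b c e ha => ?_⟩
    have h := congrArg₂ (· + ·) (hf' i a b c e ha) (hg' i a b c e ha)
    simp only [add_zero] at h
    rw [← h]
    simp only [LinearMap.add_apply, mul_add, add_mul, smul_add]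
    abel
  zero_mem' := ⟨zero_mem _, fun i a b c e _ => by simp⟩
  smul_mem' := by
    rintro r f ⟨hf, hf'⟩
    refine ⟨Submodule.smul_mem _ r hf, fun i a b c e ha => ?_⟩
    have h := congrArg (r • ·) (hf' i a b c e ha)
    simp only [smul_zero] at h
    rw [← h]
    simp only [LinearMap.smul_apply, mul_smul_comm, smul_mul_assoc, smul_add, smul_sub]
    rw [smul_comm r]

/-- The Hochschild differentials
`(δφ)(a, b, c) = (-1)^(q|a|) a φ(b, c) - φ(ab, c) + φ(a, bc) - φ(a, b) c`
of the bilinear cochains `φ` of degree `q`. -/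
def hochCoboundaries₃ (q : ℤ) :
    Submodule F (H.carrier →ₗ[F] H.carrier →ₗ[F] H.carrier →ₗ[F] H.carrier) where
  carrier := {f | ∃ φ ∈ H.hochCochains₂ q,
    ∀ (i : ℕ) (a b c : H.carrier), a ∈ H.grading i →
      f a b c = (-1 : F) ^ (q * (i : ℤ)) • (a * φ b c) - φ (a * b) c + φ a (b * c) - φ a b * c}
  add_mem' := by
    rintro f g ⟨φ, hφ, hf⟩ ⟨ψ, hψ, hg⟩
    refine ⟨φ + ψ, add_mem hφ hψ, fun i a b c ha => ?_⟩
    simp only [LinearMap.add_apply, hf i a b c ha, hg i a b c ha, mul_add, add_mul, smul_add]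
    abel
  zero_mem' := ⟨0, zero_mem _, fun i a b c _ => by simp⟩
  smul_mem' := by
    rintro r f ⟨φ, hφ, hf⟩
    refine ⟨r • φ, Submodule.smul_mem _ r hφ, fun i a b c ha => ?_⟩
    simp only [LinearMap.smul_apply, hf i a b c ha, mul_smul_comm, smul_mul_assoc, smul_add,
      smul_sub]
    rw [smul_comm r]

theorem mul_mem_intGrading {i : ℕ} {m : ℤ} {a b : H.carrier} (ha : a ∈ H.grading i)
    (hb : b ∈ H.intGrading m) : a * b ∈ H.intGrading (i + m) := by
  by_cases hm : 0 ≤ m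
  · obtain ⟨m, rfl⟩ := Int.eq_ofNat_of_zero_le hm
    have h : (0 : ℤ) ≤ (i : ℤ) + m := by positivity
    have h' : ((i : ℤ) + m).toNat = i + m := by omega
    simp only [intGrading, Int.natCast_nonneg, if_true, Int.toNat_natCast, h, h'] at hb ⊢
    exact SetLike.GradedMul.mul_mem ha hb
  · simp only [intGrading, hm, if_false, Submodule.mem_bot] at hb
    simp [hb]

theorem intGrading_mul_mem {i : ℕ} {m : ℤ} {a b : H.carrier} (ha : a ∈ H.intGrading m)
    (hb : b ∈ H.grading i) : a * b ∈ H.intGrading (m + i) := by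
  by_cases hm : 0 ≤ m
  · obtain ⟨m, rfl⟩ := Int.eq_ofNat_of_zero_le hm
    have h : (0 : ℤ) ≤ (m : ℤ) + i := by positivity
    have h' : ((m : ℤ) + i).toNat = m + i := by omega
    simp only [intGrading, Int.natCast_nonneg, if_true, Int.toNat_natCast, h, h'] at ha ⊢
    exact SetLike.GradedMul.mul_mem ha hb
  · simp only [intGrading, hm, if_false, Submodule.mem_bot] at ha
    simp [ha]

theorem hochCoboundaries₃_le (q : ℤ) : H.hochCoboundaries₃ q ≤ H.hochCocycles₃ q := by
  rintro f ⟨φ, hφ, hf⟩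
  refine ⟨fun i j k a b c ha hb hc => ?_, fun i a b c e ha => ?_⟩
  · rw [hf i a b c ha]
    have hab : a * b ∈ H.grading (i + j) := SetLike.GradedMul.mul_mem ha hb
    have hbc : b * c ∈ H.grading (j + k) := SetLike.GradedMul.mul_mem hb hc
    have h1 := H.mul_mem_intGrading ha (hφ j k b c hb hc)
    have h2 := hφ (i + j) k _ c hab hc
    have h3 := hφ i (j + k) a _ ha hbc
    have h4 := H.intGrading_mul_mem (hφ i j a b ha hb) hc
    push_cast at h2 h3
    have e1 : (i : ℤ) + (j + k + q) = i + j + k + q := by ring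
    have e3 : (i : ℤ) + (j + k) + q = i + j + k + q := by ring
    have e4 : (i : ℤ) + j + q + k = i + j + k + q := by ring
    rw [e1] at h1
    rw [e3] at h3
    rw [e4] at h4
    exact sub_mem (add_mem (sub_mem (Submodule.smul_mem _ _ h1) h2) h3) h4
  · induction b using H.hom_induction with
    | h0 => simp
    | hh j b hb =>
      have hab : a * b ∈ H.grading (i + j) := SetLike.GradedMul.mul_mem ha hb
      rw [hf j b c e hb, hf (i + j) (a * b) c e hab, hf i a (b * c) e ha, hf i a b (c * e) ha,
        hf i a b c ha]
      have hs : (-1 : F) ^ (q * ((i + j : ℕ) : ℤ)) =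
          (-1 : F) ^ (q * (i : ℤ)) * (-1 : F) ^ (q * (j : ℤ)) := by
        rw [← zpow_add₀ (by simp)]
        push_cast
        ring_nf
      rw [hs]
      simp only [mul_add, mul_sub, add_mul, sub_mul, smul_add, smul_sub, mul_smul_comm,
        smul_mul_assoc, smul_smul, mul_assoc]
      abel
    | hadd b b' hb hb' =>
      have h := congrArg₂ (· + ·) hb hb'
      simp only [add_zero] at h
      rw [← h]
      simp only [map_add, LinearMap.add_apply, mul_add, add_mul, smul_add]
      abel

/-- The Hochschild cohomology `Hoch^{3,q}(H, H)`: trilinear cocycles of internal degree `q`, modulo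
the differentials of bilinear cochains of the same internal degree. -/
abbrev Hoch₃ (q : ℤ) : Type v :=
  H.hochCocycles₃ q ⧸ (H.hochCoboundaries₃ q).comap (H.hochCocycles₃ q).subtype

/-- The class of a trilinear Hochschild cocycle. -/
def hochClass₃ (q : ℤ) : H.hochCocycles₃ q →ₗ[F] H.Hoch₃ q := Submodule.mkQ _

end Hochschild

end DGCA

/-- Trilinear maps from functions which are linear in each argument. -/
def trilinearMk {F : Type u} [Field F] {M N : Type v} [AddCommGroup M] [Module F M]
    [AddCommGroup N] [Module F N] (f : M → M → M → N)
    (add₁ : ∀ a a' b c, f (a + a') b c = f a b c + f a' b c)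
    (smul₁ : ∀ (r : F) a b c, f (r • a) b c = r • f a b c)
    (add₂ : ∀ a b b' c, f a (b + b') c = f a b c + f a b' c)
    (smul₂ : ∀ (r : F) a b c, f a (r • b) c = r • f a b c)
    (add₃ : ∀ a b c c', f a b (c + c') = f a b c + f a b c')
    (smul₃ : ∀ (r : F) a b c, f a b (r • c) = r • f a b c) : M →ₗ[F] M →ₗ[F] M →ₗ[F] N :=
  LinearMap.mk₂ F
    (fun a b => { toFun := f a b, map_add' := add₃ a b, map_smul' := fun r c => smul₃ r a b c })
    (fun a a' b => LinearMap.ext fun c => add₁ a a' b c)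
    (fun r a b => LinearMap.ext fun c => smul₁ r a b c)
    (fun a b b' => LinearMap.ext fun c => add₂ a b b' c)
    (fun r a b => LinearMap.ext fun c => smul₂ r a b c)

/-- A Poincaré DGCA of degree `n`: a DGCA concentrated in degrees `0, …, n` with finite dimensional
cohomology `H`, together with a linear functional `∫` on `Hⁿ` such that the induced pairing on `H`
is non-degenerate. -/
structure PoincareDGCA (F : Type u) [Field F] (n : ℕ) extends DGCA.{u, v} F where
  grading_eq_bot : ∀ k : ℕ, n < k → grading k = ⊥
  finite_coh : Module.Finite F toDGCA.Coh
  integral : toDGCA.cohGrading n →ₗ[F] F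
  nondegenerate : ∀ x : toDGCA.Coh, (∀ y : toDGCA.Coh, toDGCA.cohPairing integral x y = 0) → x = 0

namespace PoincareDGCA

variable {F : Type u} [Field F] {n : ℕ} (A : PoincareDGCA.{u, v} F n)

theorem d_proj_top (a : A.carrier) : A.d (A.proj n a) = 0 := by
  have h := A.d_mem (A.proj_mem n a)
  rwa [A.grading_eq_bot (n + 1) (Nat.lt_succ_self n), Submodule.mem_bot] at h

/-- The cohomology class of the component of degree `n`, all of whose elements are closed. -/
noncomputable def topClass : A.carrier →ₗ[F] A.cohGrading n where
  toFun a := ⟨A.cls ⟨A.proj n a, A.d_proj_top a⟩, A.mem_cohGrading.2 ⟨_, A.proj_mem n a, rfl⟩⟩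
  map_add' a b := by
    ext
    simp only [Submodule.coe_add, ← map_add]
    congr 1
    exact Subtype.ext (map_add _ _ _)
  map_smul' r a := by
    ext
    simp only [SetLike.val_smul, RingHom.id_apply, ← map_smul]
    congr 1
    exact Subtype.ext (map_smul _ _ _)

/-- The pairing on `A`: `⟨a, b⟩ = ∫ [a b]` if the degrees of `a` and `b` sum up to `n`, and zero for
other homogeneous elements. -/
noncomputable def pairing (a b : A.carrier) : F := A.integral (A.topClass (a * b))

/-- A harmonic subspace: a graded complement of the coboundaries in the cocycles. -/
structure IsHarmonic (W : Submodule F A.carrier) : Prop where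
  isGraded : A.IsGraded W
  disjoint : Disjoint (LinearMap.range A.d) W
  sup_eq : LinearMap.range A.d ⊔ W = LinearMap.ker A.d

/-- A Hodge type decomposition `A = dA ⊕ harm ⊕ coex` into graded subspaces. -/
structure HodgeDecomposition where
  harm : Submodule F A.carrier
  coex : Submodule F A.carrier
  isHarmonic : A.IsHarmonic harm
  coex_isGraded : A.IsGraded coex
  isCompl : IsCompl (LinearMap.range A.d ⊔ harm) coex
  orthogonal : ∀ x ∈ harm ⊔ coex, ∀ y ∈ coex, A.pairing x y = 0

/-- A Poincaré DGCA is of Hodge type if it admits a Hodge type decomposition. -/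
def IsHodgeType : Prop := Nonempty A.HodgeDecomposition

namespace HodgeDecomposition

variable {A} (h : A.HodgeDecomposition)

theorem harm_le_ker : h.harm ≤ LinearMap.ker A.d := by
  rw [← h.isHarmonic.sup_eq]
  exact le_sup_right

theorem isCompl_range : IsCompl (LinearMap.range A.d) (h.harm ⊔ h.coex) :=
  ⟨h.isHarmonic.disjoint.disjoint_sup_right_of_disjoint_sup_left h.isCompl.disjoint, by
    rw [codisjoint_iff, ← sup_assoc]
    exact h.isCompl.sup_eq_top⟩

theorem isCompl_harm : IsCompl h.harm (LinearMap.range A.d ⊔ h.coex) :=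
  ⟨h.isHarmonic.disjoint.symm.disjoint_sup_right_of_disjoint_sup_left (by
      rw [sup_comm]
      exact h.isCompl.disjoint), by
    rw [codisjoint_iff, ← sup_assoc, sup_comm h.harm]
    exact h.isCompl.sup_eq_top⟩

/-- The differential as a map from the summand `coex` to the coboundaries. -/
def dCoex : h.coex →ₗ[F] LinearMap.range A.d := A.d.rangeRestrict.domRestrict h.coex

theorem dCoex_bijective : Function.Bijective h.dCoex := by
  constructor
  · rw [injective_iff_map_eq_zero]
    intro x hx
    have hx' : A.d (x : A.carrier) = 0 := congrArg Subtype.val hx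
    have hk : (x : A.carrier) ∈ LinearMap.range A.d ⊔ h.harm := by
      rw [h.isHarmonic.sup_eq]
      exact hx'
    exact Subtype.ext (Submodule.disjoint_def.1 h.isCompl.disjoint _ hk x.2)
  · rintro ⟨_, c, rfl⟩
    have hc : c ∈ (LinearMap.range A.d ⊔ h.harm) ⊔ h.coex := by
      rw [h.isCompl.sup_eq_top]
      trivial
    obtain ⟨y, hy, z, hz, rfl⟩ := Submodule.mem_sup.1 hc
    rw [h.isHarmonic.sup_eq] at hy
    refine ⟨⟨z, hz⟩, Subtype.ext ?_⟩
    have hy' : A.d y = 0 := hy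
    change A.d z = A.d (y + z)
    rw [map_add, hy', zero_add]

/-- The operator `d⁻`: the inverse of `d : coex → dA`, extended by zero to `harm ⊕ coex`. -/
noncomputable def dMinus : A.carrier →ₗ[F] A.carrier :=
  h.coex.subtype ∘ₗ (LinearEquiv.ofBijective h.dCoex h.dCoex_bijective).symm.toLinearMap ∘ₗ
    Submodule.projectionOnto _ _ h.isCompl_range

theorem dMinus_d_of_mem_coex {x : A.carrier} (hx : x ∈ h.coex) : h.dMinus (A.d x) = x := by
  have e : A.d x = ((h.dCoex ⟨x, hx⟩ : LinearMap.range A.d) : A.carrier) := rfl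
  rw [dMinus, LinearMap.comp_apply, LinearMap.comp_apply, e,
    Submodule.projectionOnto_apply_left]
  exact congrArg Subtype.val
    ((LinearEquiv.ofBijective h.dCoex h.dCoex_bijective).symm_apply_apply ⟨x, hx⟩)

theorem dMinus_of_mem_sup {x : A.carrier} (hx : x ∈ h.harm ⊔ h.coex) : h.dMinus x = 0 := by
  rw [dMinus, LinearMap.comp_apply, LinearMap.comp_apply,
    (Submodule.projectionOnto_apply_eq_zero_iff _).2 hx, map_zero, map_zero]

/-- The projection to `harm` along `dA ⊕ coex`. -/
noncomputable def harmProj : A.carrier →ₗ[F] h.harm :=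
  Submodule.projectionOnto _ _ h.isCompl_harm

/-- The cohomology class of the harmonic part. -/
noncomputable def harmClass : A.carrier →ₗ[F] A.Coh :=
  A.cls.toLinearMap ∘ₗ LinearMap.codRestrict (Subalgebra.toSubmodule A.cocycles)
    (h.harm.subtype ∘ₗ h.harmProj) (fun a => h.harm_le_ker (h.harmProj a).2)

end HodgeDecomposition

/-- A linear map `ι`, defined on a subspace `W` of the cohomology, which sends every class in `W` to
a cocycle representing it, and preserves degrees. -/
structure IsPartialSplitting (W : Submodule F A.Coh) (ι : W →ₗ[F] A.carrier) : Prop where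
  map_grading : ∀ (k : ℕ) (x : W), (x : A.Coh) ∈ A.cohGrading k → ι x ∈ A.grading k
  represents : ∀ x : W, ∃ z : A.cocycles, (z : A.carrier) = ι x ∧ A.cls z = x

/-- A splitting map: a degree preserving linear choice of representing cocycles for all classes. -/
structure IsSplitting (ι : A.Coh →ₗ[F] A.carrier) : Prop where
  map_grading : ∀ (k : ℕ) (x : A.Coh), x ∈ A.cohGrading k → ι x ∈ A.grading k
  represents : ∀ x : A.Coh, ∃ z : A.cocycles, (z : A.carrier) = ι x ∧ A.cls z = x

/-- The cohomology in positive degrees. -/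
noncomputable def cohPos : Submodule F A.Coh := ⨆ (k : ℕ) (_ : 1 ≤ k), A.cohGrading k

/-- A generating subspace: a graded complement of `H₊ · H₊` in `H₊`. -/
structure IsGenerating (W : Submodule F A.Coh) : Prop where
  isGraded : A.cohomology.IsGraded W
  disjoint : Disjoint W (A.cohPos * A.cohPos)
  sup_eq : W ⊔ A.cohPos * A.cohPos = A.cohPos

/-- A splitting map `ι` is adapted if it extends a partial splitting map `ι₀` of a generating
subspace and takes values in the image of the free graded commutative algebra on that subspace under
`ι₀`, which is the subalgebra generated by the image of `ι₀`. -/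
def IsAdapted (ι : A.Coh →ₗ[F] A.carrier) : Prop :=
  ∃ (W : Submodule F A.Coh) (ι₀ : W →ₗ[F] A.carrier),
    A.IsGenerating W ∧ A.IsPartialSplitting W ι₀ ∧ (∀ x : W, ι x = ι₀ x) ∧
      ∀ x : A.Coh, ι x ∈ Algebra.adjoin F (Set.range ι₀)

/-- A choice of adapted harmonic forms, given by an adapted splitting map `ι`, and of a Hodge type
decomposition with harmonic subspace `ι(H)`. -/
structure AdaptedChoice where
  ι : A.Coh →ₗ[F] A.carrier
  isSplitting : A.IsSplitting ι
  isAdapted : A.IsAdapted ι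
  hodge : A.HodgeDecomposition
  harm_eq : hodge.harm = LinearMap.range ι

namespace AdaptedChoice

variable {A} (h : A.AdaptedChoice)

/-- The transferred ternary product on cohomology: `μ₃(x, y, z)` is the class of the harmonic part of
`d⁻(ιx · ιy) · ιz - (-1)^|x| ιx · d⁻(ιy · ιz)`. -/
noncomputable def mu₃ : A.Coh →ₗ[F] A.Coh →ₗ[F] A.Coh →ₗ[F] A.Coh :=
  trilinearMk (fun x y z => h.hodge.harmClass
      (h.hodge.dMinus (h.ι x * h.ι y) * h.ι z
        - A.signOp (h.ι x) * h.hodge.dMinus (h.ι y * h.ι z)))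
    (by intros; rw [← map_add]; congr 1; simp only [map_add, add_mul]; abel)
    (by intros; rw [← map_smul]; congr 1; simp only [map_smul, smul_mul_assoc, smul_sub])
    (by intros; rw [← map_add]; congr 1; simp only [map_add, add_mul, mul_add]; abel)
    (by
      intros
      rw [← map_smul]
      congr 1
      simp only [map_smul, smul_mul_assoc, mul_smul_comm, smul_sub])
    (by intros; rw [← map_add]; congr 1; simp only [map_add, mul_add]; abel)
    (by intros; rw [← map_smul]; congr 1; simp only [map_smul, mul_smul_comm, smul_sub])

end AdaptedChoice

end PoincareDGCA

/-!
Let `ι`, `d⁻` be an adapted choice on `A`. The elements `d⁻(ιx ιy)` are primitives of the defect of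
`ι` from being multiplicative, and `μ₃` is the class of the cocycle which glues the two resulting
primitives of `ιx ιy ιz - ι(xyz)`. This makes sense for every linear choice of representatives and
primitives (`DGCA.IsTransfer`, `DGCA.massey`), and explicit primitives show that the operation is a
Hochschild cocycle (`IsTransfer.massey_cocycle`) and changes by a coboundary if the choices change
(`IsTransfer.exists_massey_sub_massey`). Hence the class of `μ₃` does not depend on the adapted
choice, and its vanishing is invariant under quasi-isomorphisms, which gives its vanishing for
formal algebras (`IsFormal.isMasseyTrivial`). These steps do not use the bound on the dimension.

Adapted choices exist because the cohomology of a connected algebra is generated by a generating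
subspace (`IsGenerating.adjoin_eq_top`), and because every splitting is the harmonic part of a Hodge
type decomposition if there is a decomposition at all (`HodgeDecomposition.exists_of_isSplitting`).

For the converse, let `δφ = μ₃`. In characteristic zero `φ` can be chosen to be symmetric in the
graded sense and to satisfy `∫ φ(x, y) = 0` (`exists_isNormalizedPrimitive`). Let `p` be the
projection to the harmonic elements, `η` the part of `d⁻` with values in the degrees from `2r - 1` to
`n - 2r`, and `ρ` the projection to the sum of the harmonic elements of positive degree, the image of
`η` and its boundaries. The image of `ρ` is a complex `M`. The bound `n ≤ 5r - 3` enters through two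
facts: the map `ρ` depends on the integral only in degrees larger than `n - r`
(`ρ_eq_zero_of_int`), and it is harmonic in degrees not less than `3r - 1` (`ρ_eq_projHarm`). They
have the following consequences, since nonzero elements of `M` have degree at least `r`.

* The product of `A` induces the product `ρ(ab)` on `M`, and `A` is quasi-isomorphic to the algebra
  which results by adjoining a unit to `M`, by way of the subalgebra of tame elements
  (`tameHom_isQuasiIso`, `modelHom_isQuasiIso`).
* The product `ρ(pa pb)` of the harmonic parts is associative on `M` as well, and the resulting
  algebra is quasi-isomorphic to the cohomology (`cohomologyHom_isQuasiIso`).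
* The difference `m` of the two products is the boundary of
  `κ(a, b) = ρ(ιφ([pa], [pb]) + ηa b + (-1)^|a| pa ηb)`, which is graded symmetric and a Hochschild
  cocycle for both products (`d_kappa`, `kappa_comm`, `harmMul_kappa`, `mulDefect_kappa`). The
  equation `δφ = μ₃` is what the cocycle condition for harmonic arguments says, and `∫ φ = 0` removes
  the terms in which `φ` meets a value of `m`.

Therefore the family of products `ρ(pa pb) + s m(a, b)`, together with `κ` as its component in the
direction `ds`, is a product on the complex of polynomial forms `M[s] ⊕ M[s] ds`
(`BoundedComplex.Deformation.total`). In characteristic zero its evaluations at `s = 0` and `s = 1`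
are quasi-isomorphisms (`evalHom_isQuasiIso`), so that the two algebras on `M` are connected by a
zig-zag, and `A` is formal.
-/

/-! ### Representatives of cohomology classes and transferred ternary operations -/

namespace DGCA

variable {F : Type u} [Field F]

section Graded

variable (X : DGCA.{u, v} F)

theorem mul_mem {i j : ℕ} {a b : X.carrier} (ha : a ∈ X.grading i) (hb : b ∈ X.grading j) :
    a * b ∈ X.grading (i + j) := SetLike.GradedMul.mul_mem ha hb

theorem one_mem : (1 : X.carrier) ∈ X.grading 0 := SetLike.GradedOne.one_mem

theorem intGrading_natCast (k : ℕ) : X.intGrading (k : ℤ) = X.grading k := by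
  simp [intGrading]

theorem intGrading_of_neg {m : ℤ} (hm : m < 0) : X.intGrading m = ⊥ := by
  simp [intGrading, not_le.2 hm]

theorem signOp_mem {k : ℕ} {a : X.carrier} (ha : a ∈ X.grading k) :
    X.signOp a ∈ X.grading k := by
  rw [X.signOp_of_mem ha]
  exact Submodule.smul_mem _ _ ha

theorem signOp_mul (a b : X.carrier) : X.signOp (a * b) = X.signOp a * X.signOp b := by
  induction a using X.hom_induction with
  | h0 => simp
  | hh i a ha =>
    induction b using X.hom_induction with
    | h0 => simp
    | hh j b hb =>
      rw [X.signOp_of_mem ha, X.signOp_of_mem hb, X.signOp_of_mem (X.mul_mem ha hb)]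
      simp [pow_add, smul_smul, mul_comm]
    | hadd a b ha hb => simp only [mul_add, map_add, ha, hb]
  | hadd a b ha hb => simp only [add_mul, map_add, ha, hb]

theorem eq_sum_proj (a : X.carrier) :
    ∃ s : Finset ℕ, a = ∑ k ∈ s, X.proj k a := by
  classical
  exact ⟨_, (DirectSum.sum_support_decompose X.grading a).symm⟩

variable {X}

/-- The linear map which is given by `T k` on the homogeneous elements of degree `k`. -/
noncomputable def gradedMap {V : Type*} [AddCommGroup V] [Module F V]
    (T : ℕ → X.carrier →ₗ[F] V) : X.carrier →ₗ[F] V :=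
  (DirectSum.toModule F ℕ V (fun k => T k ∘ₗ (X.grading k).subtype)) ∘ₗ
    (DirectSum.decomposeLinearEquiv X.grading).toLinearMap

theorem gradedMap_of_mem {V : Type*} [AddCommGroup V] [Module F V]
    (T : ℕ → X.carrier →ₗ[F] V) {k : ℕ} {a : X.carrier} (ha : a ∈ X.grading k) :
    gradedMap T a = T k a := by
  rw [gradedMap, LinearMap.comp_apply, LinearEquiv.coe_coe, DirectSum.decomposeLinearEquiv_apply,
    DirectSum.decompose_of_mem _ ha, ← DirectSum.lof_eq_of F, DirectSum.toModule_lof]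
  rfl

end Graded

section Represents

variable (X : DGCA.{u, v} F)

/-- The element `a` is a cocycle in the cohomology class `x`. -/
def Represents (a : X.carrier) (x : X.Coh) : Prop :=
  ∃ z : X.cocycles, (z : X.carrier) = a ∧ X.cls z = x

variable {X}

theorem Represents.d_eq_zero {a : X.carrier} {x : X.Coh} (h : X.Represents a x) : X.d a = 0 := by
  obtain ⟨z, rfl, -⟩ := h
  exact z.2

theorem represents_cls (z : X.cocycles) : X.Represents z (X.cls z) := ⟨z, rfl, rfl⟩

theorem exists_represents {a : X.carrier} (h : X.d a = 0) : ∃ x, X.Represents a x :=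
  ⟨X.cls ⟨a, h⟩, ⟨a, h⟩, rfl, rfl⟩

theorem Represents.add {a b : X.carrier} {x y : X.Coh} (ha : X.Represents a x)
    (hb : X.Represents b y) : X.Represents (a + b) (x + y) := by
  obtain ⟨z, rfl, rfl⟩ := ha
  obtain ⟨w, rfl, rfl⟩ := hb
  exact ⟨z + w, rfl, map_add _ _ _⟩

theorem Represents.sub {a b : X.carrier} {x y : X.Coh} (ha : X.Represents a x)
    (hb : X.Represents b y) : X.Represents (a - b) (x - y) := by
  obtain ⟨z, rfl, rfl⟩ := ha
  obtain ⟨w, rfl, rfl⟩ := hb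
  exact ⟨z - w, rfl, map_sub _ _ _⟩

theorem Represents.smul {a : X.carrier} {x : X.Coh} (c : F) (ha : X.Represents a x) :
    X.Represents (c • a) (c • x) := by
  obtain ⟨z, rfl, rfl⟩ := ha
  exact ⟨c • z, rfl, map_smul _ _ _⟩

theorem Represents.mul {a b : X.carrier} {x y : X.Coh} (ha : X.Represents a x)
    (hb : X.Represents b y) : X.Represents (a * b) (x * y) := by
  obtain ⟨z, rfl, rfl⟩ := ha
  obtain ⟨w, rfl, rfl⟩ := hb
  exact ⟨z * w, rfl, map_mul _ _ _⟩

theorem represents_d (c : X.carrier) : X.Represents (X.d c) 0 :=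
  ⟨⟨X.d c, X.d_d c⟩, rfl, X.cls_eq_zero_iff.2 ⟨c, rfl⟩⟩

theorem represents_zero : X.Represents 0 0 := ⟨0, rfl, map_zero _⟩

theorem represents_one : X.Represents 1 1 := ⟨1, rfl, map_one _⟩

theorem Represents.eq {a : X.carrier} {x y : X.Coh} (hx : X.Represents a x)
    (hy : X.Represents a y) : x = y := by
  obtain ⟨z, rfl, rfl⟩ := hx
  obtain ⟨w, hw, rfl⟩ := hy
  rw [Subtype.ext hw]

theorem represents_zero_iff {a : X.carrier} : X.Represents a 0 ↔ ∃ c, X.d c = a := by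
  constructor
  · rintro ⟨z, rfl, hz⟩
    exact X.cls_eq_zero_iff.1 hz
  · rintro ⟨c, rfl⟩
    exact represents_d c

theorem Represents.exists_d_eq_sub {a b : X.carrier} {x : X.Coh} (ha : X.Represents a x)
    (hb : X.Represents b x) : ∃ c, X.d c = a - b := by
  rw [← represents_zero_iff]
  simpa using ha.sub hb

theorem Represents.proj {a : X.carrier} {x : X.Coh} (ha : X.Represents a x) (k : ℕ) :
    X.Represents (X.proj k a) (X.cohProj k x) := by
  obtain ⟨z, rfl, rfl⟩ := ha
  exact ⟨X.cocyclesProj k z, rfl, rfl⟩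

theorem Represents.mem_cohGrading {a : X.carrier} {x : X.Coh} (h : X.Represents a x) {k : ℕ}
    (ha : a ∈ X.grading k) : x ∈ X.cohGrading k := by
  obtain ⟨z, rfl, rfl⟩ := h
  exact X.mem_cohGrading.2 ⟨z, ha, rfl⟩

theorem Represents.mem_intGrading {a : X.carrier} {x : X.Coh} (h : X.Represents a x) {m : ℤ}
    (ha : a ∈ X.intGrading m) : x ∈ X.cohomology.intGrading m := by
  rcases lt_or_ge m 0 with hm | hm
  · rw [X.intGrading_of_neg hm, Submodule.mem_bot] at ha
    subst ha
    rw [h.eq represents_zero]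
    exact Submodule.zero_mem _
  · lift m to ℕ using hm
    rw [intGrading_natCast] at ha ⊢
    exact h.mem_cohGrading ha

theorem represents_signOp {a : X.carrier} {x : X.Coh} (h : X.Represents a x) :
    X.Represents (X.signOp a) (X.cohomology.signOp x) := by
  induction x using X.cohomology.hom_induction generalizing a with
  | h0 =>
    obtain ⟨c, rfl⟩ := represents_zero_iff.1 h
    rw [map_zero, represents_zero_iff]
    exact ⟨-X.signOp c, by rw [map_neg, X.d_signOp, neg_neg]⟩
  | hh k x hx =>
    obtain ⟨z, hz, hzx⟩ := X.mem_cohGrading.1 hx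
    obtain ⟨c, hc⟩ := h.exists_d_eq_sub ⟨z, rfl, hzx⟩
    have e : a = z + X.d c := by rw [hc]; abel
    rw [X.cohomology.signOp_of_mem hx, e, map_add, X.signOp_of_mem hz, ← neg_neg (X.signOp (X.d c)),
      ← X.d_signOp, ← map_neg]
    have h1 : X.Represents ((z : X.carrier)) x := ⟨z, rfl, hzx⟩
    simpa using (h1.smul ((-1 : F) ^ k)).add (represents_d (-X.signOp c))
  | hadd x y hx hy =>
    obtain ⟨z, rfl⟩ := X.cls_surjective x
    have h1 : X.Represents (a - z) y := by
      simpa using h.sub (represents_cls z)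
    have := (hx (represents_cls z)).add (hy h1)
    simpa using this

end Represents

section Homotopy

theorem exists_section {V W : Type*} [AddCommGroup V] [Module F V] [AddCommGroup W] [Module F W]
    (f : V →ₗ[F] W) (hf : Function.Surjective f) : ∃ g : W →ₗ[F] V, ∀ w, f (g w) = w := by
  obtain ⟨g, hg⟩ := f.exists_rightInverse_of_surjective (LinearMap.range_eq_top.2 hf)
  exact ⟨g, LinearMap.congr_fun hg⟩

variable (X : DGCA.{u, v} F)

/-- A generalized inverse of the differential can be chosen of degree `-1`. -/
theorem exists_homotopy : ∃ h : X.carrier →ₗ[F] X.carrier,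
    (∀ (k : ℕ) (a : X.carrier), a ∈ X.grading k → h a ∈ X.intGrading ((k : ℤ) - 1)) ∧
      ∀ a, X.d (h (X.d a)) = X.d a := by
  obtain ⟨g, hg⟩ := X.d.rangeRestrict.exists_rightInverse_of_surjective X.d.range_rangeRestrict
  obtain ⟨r, hr⟩ := g.exists_extend
  have hr' : ∀ a, X.d (r (X.d a)) = X.d a := by
    intro a
    have h1 : r (X.d a) = g ⟨X.d a, a, rfl⟩ := LinearMap.congr_fun hr ⟨X.d a, a, rfl⟩
    rw [h1]
    exact congrArg Subtype.val (LinearMap.congr_fun hg ⟨X.d a, a, rfl⟩)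
  refine ⟨gradedMap fun k => match k with
    | 0 => 0
    | k + 1 => X.proj k ∘ₗ r, ?_, ?_⟩
  · intro k a ha
    rw [gradedMap_of_mem _ ha]
    match k with
    | 0 => simp
    | k + 1 =>
      have e : ((k + 1 : ℕ) : ℤ) - 1 = (k : ℕ) := by push_cast; ring
      rw [e, intGrading_natCast]
      exact X.proj_mem k _
  · intro a
    induction a using X.hom_induction with
    | h0 => simp
    | hh k a ha =>
      rw [gradedMap_of_mem _ (X.d_mem ha)]
      change X.d (X.proj k (r (X.d a))) = X.d a
      rw [← X.proj_d, hr', X.proj_of_mem (X.d_mem ha)]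
    | hadd a b ha hb => simp only [map_add, ha, hb]

/-- A degree preserving linear choice of representatives of all classes. -/
theorem exists_splitting : ∃ ι : X.Coh →ₗ[F] X.carrier,
    (∀ (k : ℕ) (x : X.Coh), x ∈ X.cohGrading k → ι x ∈ X.grading k) ∧
      ∀ x, X.Represents (ι x) x := by
  obtain ⟨g, hg⟩ := exists_section X.cls.toLinearMap X.cls_surjective
  have hg' : ∀ x, X.Represents (g x) x := fun x => ⟨g x, rfl, hg x⟩
  refine ⟨gradedMap (X := X.cohomology) fun k => X.proj k ∘ₗ X.cocycles.val.toLinearMap ∘ₗ g, ?_, ?_⟩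
  · intro k x hx
    rw [gradedMap_of_mem (X := X.cohomology) _ hx]
    exact X.proj_mem k _
  · intro x
    induction x using X.cohomology.hom_induction with
    | h0 => rw [map_zero]; exact represents_zero
    | hh k x hx =>
      rw [gradedMap_of_mem (X := X.cohomology) _ hx]
      have := (hg' x).proj k
      rwa [X.cohProj_of_mem hx] at this
    | hadd x y hx hy => rw [map_add]; exact hx.add hy

end Homotopy

section Transfer

/-- Data for the transfer of the multiplication of `X` along a map `ρ` from a graded algebra `K` to
the cohomology of `X`: a linear choice `ι` of representatives for `ρ`, and a linear choice `t` of
primitives for its defect `ι x ι y - ι (x y)` from being multiplicative. -/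
structure IsTransfer {K X : DGCA.{u, v} F} (ρ : K.carrier →ₐ[F] X.Coh)
    (ι : K.carrier →ₗ[F] X.carrier) (t : K.carrier →ₗ[F] K.carrier →ₗ[F] X.carrier) : Prop where
  map_grading : ∀ {k : ℕ} {x : K.carrier}, x ∈ K.grading k → ι x ∈ X.grading k
  represents : ∀ x, X.Represents (ι x) (ρ x)
  degree : ∀ {i j : ℕ} {x y : K.carrier}, x ∈ K.grading i → y ∈ K.grading j →
    t x y ∈ X.intGrading ((i : ℤ) + j + -1)
  d_eq : ∀ x y, X.d (t x y) = ι x * ι y - ι (x * y)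

variable {K X : DGCA.{u, v} F}

/-- The cocycle `t(x, y) ιz ∓ ιx t(y, z) + t(xy, z) - t(x, yz)` which glues the two primitives of
`ιx ιy ιz - ι(xyz)`. -/
noncomputable def massey (ι : K.carrier →ₗ[F] X.carrier)
    (t : K.carrier →ₗ[F] K.carrier →ₗ[F] X.carrier) (x y z : K.carrier) : X.carrier :=
  t x y * ι z - X.signOp (ι x) * t y z + t (x * y) z - t x (y * z)

theorem exists_isTransfer (X : DGCA.{u, v} F) : ∃ ι t,
    IsTransfer (K := X.cohomology) (X := X) (AlgHom.id F X.Coh) ι t := by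
  obtain ⟨ι, hι, hι'⟩ := X.exists_splitting
  obtain ⟨h, hh, hh'⟩ := X.exists_homotopy
  let β : X.Coh →ₗ[F] X.Coh →ₗ[F] X.carrier :=
    (LinearMap.mul F X.carrier).compl₁₂ ι ι - (LinearMap.mul F X.Coh).compr₂ ι
  have hβ : ∀ x y, β x y = ι x * ι y - ι (x * y) := fun x y => rfl
  refine ⟨ι, β.compr₂ h, fun hx => hι _ _ hx, hι', ?_, ?_⟩
  · intro i j x y hx hy
    have h1 : ι (x * y) ∈ X.grading (i + j) := hι _ _ (X.cohomology.mul_mem hx hy)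
    have := hh (i + j) (β x y) (by
      rw [hβ]
      exact sub_mem (X.mul_mem (hι _ _ hx) (hι _ _ hy)) h1)
    rw [LinearMap.compr₂_apply]
    rw [← sub_eq_add_neg]
    exact_mod_cast this
  · intro x y
    rw [LinearMap.compr₂_apply, ← hβ]
    obtain ⟨c, hc⟩ := ((hι' x).mul (hι' y)).exists_d_eq_sub (hι' (x * y))
    rw [hβ, ← hc, hh']

namespace IsTransfer

variable {ρ : K.carrier →ₐ[F] X.Coh} {ι : K.carrier →ₗ[F] X.carrier}
  {t : K.carrier →ₗ[F] K.carrier →ₗ[F] X.carrier}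

theorem d_signOp_t (h : IsTransfer ρ ι t) (x y : K.carrier) : X.d (X.signOp (t x y)) =
    X.signOp (ι (x * y)) - X.signOp (ι x) * X.signOp (ι y) := by
  rw [d_signOp, h.d_eq, map_sub, signOp_mul, neg_sub]

theorem d_massey (h : IsTransfer ρ ι t) (x y z : K.carrier) : X.d (massey ι t x y z) = 0 := by
  have hx := (h.represents x).d_eq_zero
  have hz := (h.represents z).d_eq_zero
  simp only [massey, map_add, map_sub, leibniz_signOp, h.d_eq, d_signOp, signOp_signOp, hx, hz,
    map_zero, neg_zero, mul_zero, zero_mul, mul_assoc, sub_mul, mul_sub]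
  abel

theorem massey_degree (h : IsTransfer ρ ι t) {i j k : ℕ} {x y z : K.carrier}
    (hx : x ∈ K.grading i) (hy : y ∈ K.grading j) (hz : z ∈ K.grading k) :
    massey ι t x y z ∈ X.intGrading ((i : ℤ) + j + k + -1) := by
  have h1 := X.intGrading_mul_mem (h.degree hx hy) (h.map_grading hz)
  have h2 := X.mul_mem_intGrading (X.signOp_mem (h.map_grading hx)) (h.degree hy hz)
  have h3 := h.degree (K.mul_mem hx hy) hz
  have h4 := h.degree hx (K.mul_mem hy hz)
  push_cast at h3 h4
  rw [show (i : ℤ) + j + -1 + k = i + j + k + -1 by ring] at h1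
  rw [show (i : ℤ) + (j + k + -1) = i + j + k + -1 by ring] at h2
  rw [show (i : ℤ) + (j + k) + -1 = i + j + k + -1 by ring] at h4
  exact sub_mem (add_mem (sub_mem h1 h2) h3) h4

/-- The Hochschild differential of `massey` is exact, with primitive `± t(x, y) t(z, w)`. -/
theorem massey_cocycle (h : IsTransfer ρ ι t) (x y z w : K.carrier) :
    X.signOp (ι x) * massey ι t y z w - massey ι t (x * y) z w + massey ι t x (y * z) w
      - massey ι t x y (z * w) + massey ι t x y z * ι w = X.d (X.signOp (t x y) * t z w) := by
  rw [leibniz_signOp, h.d_signOp_t, signOp_signOp, h.d_eq]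
  simp only [massey, mul_add, add_mul, mul_sub, sub_mul, mul_assoc]
  abel

/-- Different transfer data for the same map have cohomologous ternary operations. -/
theorem exists_massey_sub_massey {ι' : K.carrier →ₗ[F] X.carrier}
    {t' : K.carrier →ₗ[F] K.carrier →ₗ[F] X.carrier} (h : IsTransfer ρ ι t)
    (h' : IsTransfer ρ ι' t') :
    ∃ φ : K.carrier →ₗ[F] K.carrier →ₗ[F] X.Coh,
      (∀ (i j : ℕ) (x y : K.carrier), x ∈ K.grading i → y ∈ K.grading j →
        φ x y ∈ X.cohomology.intGrading ((i : ℤ) + j + -1)) ∧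
      ∀ x y z, X.Represents (massey ι t x y z - massey ι' t' x y z)
        (X.cohomology.signOp (ρ x) * φ y z - φ (x * y) z + φ x (y * z) - φ x y * ρ z) := by
  obtain ⟨η, hη, hη'⟩ := X.exists_homotopy
  -- `ι'` differs from `ι` by the boundary of `s`.
  let s : K.carrier →ₗ[F] X.carrier := η ∘ₗ (ι' - ι)
  have hs : ∀ x, X.d (s x) = ι' x - ι x := by
    intro x
    obtain ⟨c, hc⟩ := (h'.represents x).exists_d_eq_sub (h.represents x)
    change X.d (η (ι' x - ι x)) = _
    rw [← hc, hη']
  have hsd : ∀ {k : ℕ} {x : K.carrier}, x ∈ K.grading k → s x ∈ X.intGrading ((k : ℤ) + -1) :=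
    fun hx => hη _ _ (sub_mem (h'.map_grading hx) (h.map_grading hx))
  -- `v` compares `t'` with the primitive of `ι' x ι' y - ι' (x y)` which is obtained from `t` and `s`; it
  -- is closed, and its classes are the values of `φ`.
  let v : K.carrier →ₗ[F] K.carrier →ₗ[F] X.carrier :=
    t' - t - (LinearMap.mul F X.carrier).compl₁₂ s ι'
      - (LinearMap.mul F X.carrier).compl₁₂ (X.signOp ∘ₗ ι) s + (LinearMap.mul F K.carrier).compr₂ s
  have hv : ∀ x y, v x y = t' x y - t x y - s x * ι' y - X.signOp (ι x) * s y + s (x * y) :=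
    fun x y => rfl
  have hdv : ∀ x y, X.d (v x y) = 0 := by
    intro x y
    simp only [hv, map_add, map_sub, leibniz_signOp, h.d_eq, h'.d_eq, hs, d_signOp, signOp_signOp,
      (h.represents x).d_eq_zero, (h'.represents y).d_eq_zero, map_zero, neg_zero, mul_zero,
      zero_mul, mul_sub, sub_mul]
    abel
  let v' : K.carrier →ₗ[F] K.carrier →ₗ[F] X.cocycles := LinearMap.mk₂ F
    (fun x y => ⟨v x y, hdv x y⟩) (fun _ _ _ => Subtype.ext (by simp)) (fun _ _ _ => Subtype.ext (by simp))
    (fun _ _ _ => Subtype.ext (by simp)) (fun _ _ _ => Subtype.ext (by simp))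
  have hφ : ∀ x y, X.Represents (v x y) ((v'.compr₂ X.cls.toLinearMap) x y) :=
    fun x y => ⟨v' x y, rfl, rfl⟩
  refine ⟨v'.compr₂ X.cls.toLinearMap, ?_, ?_⟩
  · intro i j x y hx hy
    refine (hφ x y).mem_intGrading ?_
    have h1 := X.intGrading_mul_mem (hsd hx) (h'.map_grading hy)
    have h2 := X.mul_mem_intGrading (X.signOp_mem (h.map_grading hx)) (hsd hy)
    have h3 := hsd (K.mul_mem hx hy)
    push_cast at h3
    rw [show (i : ℤ) + -1 + j = i + j + -1 by ring] at h1
    rw [show (i : ℤ) + (j + -1) = i + j + -1 by ring] at h2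
    exact add_mem (sub_mem (sub_mem (sub_mem (h'.degree hx hy) (h.degree hx hy)) h1) h2) h3
  · intro x y z
    have key : massey ι t x y z - massey ι' t' x y z =
        (X.signOp (ι x) * v y z - v (x * y) z + v x (y * z) - v x y * ι' z)
          - X.d (X.signOp (t x y) * s z + X.signOp (s x) * t' y z) := by
      simp only [map_add, leibniz_signOp, h.d_signOp_t, signOp_signOp, d_signOp, hs, h'.d_eq]
      simp only [massey, hv, mul_add, add_mul, mul_sub, sub_mul, mul_assoc, map_sub, neg_sub]
      abel
    rw [key, ← sub_zero (_ - _ * ρ z)]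
    refine Represents.sub (Represents.sub (Represents.add (Represents.sub ?_ ?_) ?_) ?_)
      (represents_d _)
    · exact (represents_signOp (h.represents x)).mul (hφ y z)
    · exact hφ _ _
    · exact hφ _ _
    · exact (hφ x y).mul (h'.represents z)

end IsTransfer

end Transfer

end DGCA

/-! ### Invariance of Massey triviality under quasi-isomorphisms -/

namespace DGCA

variable {F : Type u} [Field F]

section Hom

variable {X Y : DGCA.{u, v} F} (f : Hom X Y)

theorem Hom.map_mem {k : ℕ} {a : X.carrier} (ha : a ∈ X.grading k) :
    f.toAlgHom a ∈ Y.grading k := f.map_grading ha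

theorem Hom.d_map (a : X.carrier) : f.toAlgHom (X.d a) = Y.d (f.toAlgHom a) := f.map_d a

theorem Hom.map_intGrading {m : ℤ} {a : X.carrier} (ha : a ∈ X.intGrading m) :
    f.toAlgHom a ∈ Y.intGrading m := by
  rcases lt_or_ge m 0 with hm | hm
  · rw [X.intGrading_of_neg hm, Submodule.mem_bot] at ha
    simp [ha]
  · lift m to ℕ using hm
    rw [intGrading_natCast] at ha ⊢
    exact f.map_mem ha

theorem Hom.map_signOp (a : X.carrier) : f.toAlgHom (X.signOp a) = Y.signOp (f.toAlgHom a) := by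
  induction a using X.hom_induction with
  | h0 => simp
  | hh k a ha => rw [X.signOp_of_mem ha, Y.signOp_of_mem (f.map_mem ha), map_smul]
  | hadd a b ha hb => simp only [map_add, ha, hb]

theorem Hom.map_proj (k : ℕ) (a : X.carrier) :
    f.toAlgHom (X.proj k a) = Y.proj k (f.toAlgHom a) := by
  induction a using X.hom_induction with
  | h0 => simp
  | hh l a ha =>
    by_cases h : l = k
    · subst h
      rw [X.proj_of_mem ha, Y.proj_of_mem (f.map_mem ha)]
    · rw [X.proj_of_mem_ne ha h, Y.proj_of_mem_ne (f.map_mem ha) h, map_zero]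
  | hadd a b ha hb => simp only [map_add, ha, hb]

theorem Represents.map {a : X.carrier} {x : X.Coh} (h : X.Represents a x) :
    Y.Represents (f.toAlgHom a) (f.mapCoh x) := by
  obtain ⟨z, rfl, rfl⟩ := h
  exact ⟨f.mapCocycles z, rfl, rfl⟩

theorem Hom.mapCoh_mem {k : ℕ} {x : X.Coh} (hx : x ∈ X.cohGrading k) :
    f.mapCoh x ∈ Y.cohGrading k := by
  obtain ⟨z, hz, rfl⟩ := X.mem_cohGrading.1 hx
  exact ((represents_cls z).map f).mem_cohGrading (f.map_mem hz)

theorem cohProj_mem (k : ℕ) (x : X.Coh) : X.cohProj k x ∈ X.cohGrading k := by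
  obtain ⟨z, rfl⟩ := X.cls_surjective x
  exact ((represents_cls z).proj k).mem_cohGrading (X.proj_mem k _)

theorem Hom.mapCoh_cohProj (k : ℕ) (x : X.Coh) :
    f.mapCoh (X.cohProj k x) = Y.cohProj k (f.mapCoh x) := by
  obtain ⟨z, rfl⟩ := X.cls_surjective x
  have h := ((represents_cls z).proj k).map f
  rw [f.map_proj] at h
  exact h.eq (((represents_cls z).map f).proj k)

theorem Hom.mapCoh_signOp (x : X.Coh) :
    f.mapCoh (X.cohomology.signOp x) = Y.cohomology.signOp (f.mapCoh x) := by
  obtain ⟨z, rfl⟩ := X.cls_surjective x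
  have := (represents_signOp (represents_cls z)).map f
  rw [f.map_signOp] at this
  exact this.eq (represents_signOp ((represents_cls z).map f))

/-- A morphism is a quasi-isomorphism if it reflects exactness of cocycles and if every cocycle of
the target is cohomologous to the image of a cocycle. -/
theorem Hom.isQuasiIso_of (h1 : ∀ a, X.d a = 0 → (∃ c, Y.d c = f.toAlgHom a) → ∃ c, X.d c = a)
    (h2 : ∀ b, Y.d b = 0 → ∃ a, X.d a = 0 ∧ ∃ c, Y.d c = b - f.toAlgHom a) : f.IsQuasiIso := by
  constructor
  · refine (injective_iff_map_eq_zero f.mapCoh).2 fun x hx => ?_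
    obtain ⟨z, rfl⟩ := X.cls_surjective x
    have h := (represents_cls z).map f
    rw [hx, represents_zero_iff] at h
    exact (represents_cls z).eq (represents_zero_iff.2 (h1 z z.2 h))
  · intro y
    obtain ⟨w, rfl⟩ := Y.cls_surjective y
    obtain ⟨a, ha, c, hc⟩ := h2 w w.2
    obtain ⟨x, hx⟩ := exists_represents ha
    refine ⟨x, (hx.map f).eq ?_⟩
    have := (represents_cls w).sub (represents_d c)
    rwa [hc, sub_sub_cancel, sub_zero] at this

end Hom

section MasseyTrivial

variable {X Y : DGCA.{u, v} F}

theorem massey_map (f : Hom X Y) {K K' : DGCA.{u, v} F} {ι : K.carrier →ₗ[F] X.carrier}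
    {t : K.carrier →ₗ[F] K.carrier →ₗ[F] X.carrier} (g : K'.carrier →ₐ[F] K.carrier)
    (x y z : K'.carrier) :
    massey (f.toAlgHom.toLinearMap ∘ₗ ι ∘ₗ g.toLinearMap)
      ((t.compl₁₂ g.toLinearMap g.toLinearMap).compr₂ f.toAlgHom.toLinearMap) x y z =
    f.toAlgHom (massey ι t (g x) (g y) (g z)) := by
  simp [massey, f.map_signOp]

theorem IsTransfer.map (f : Hom X Y) {K K' : DGCA.{u, v} F} {ρ : K.carrier →ₐ[F] X.Coh}
    {ι : K.carrier →ₗ[F] X.carrier}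
    {t : K.carrier →ₗ[F] K.carrier →ₗ[F] X.carrier} (h : IsTransfer ρ ι t)
    (g : K'.carrier →ₐ[F] K.carrier)
    (hg : ∀ {k : ℕ} {x : K'.carrier}, x ∈ K'.grading k → g x ∈ K.grading k) :
    IsTransfer (f.mapCoh.comp (ρ.comp g)) (f.toAlgHom.toLinearMap ∘ₗ ι ∘ₗ g.toLinearMap)
      ((t.compl₁₂ g.toLinearMap g.toLinearMap).compr₂ f.toAlgHom.toLinearMap) where
  map_grading hx := f.map_mem (h.map_grading (hg hx))
  represents x := (h.represents (g x)).map f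
  degree hx hy := f.map_intGrading (h.degree (hg hx) (hg hy))
  d_eq x y := by
    simp [← f.d_map, h.d_eq]

/-- The transfer data of a DGCA on its own cohomology can be chosen such that all the cocycles
`massey` are exact, that is, the universal ternary Massey product vanishes. -/
def IsMasseyTrivial (X : DGCA.{u, v} F) : Prop :=
  ∃ ι t, IsTransfer (K := X.cohomology) (X := X) (AlgHom.id F X.Coh) ι t ∧
    ∀ x y z, X.Represents (massey (K := X.cohomology) ι t x y z) 0

/-- A Hochschild primitive of the ternary operation can be absorbed into the transfer data. -/
theorem isMasseyTrivial_of {ι : X.Coh →ₗ[F] X.carrier} {t : X.Coh →ₗ[F] X.Coh →ₗ[F] X.carrier}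
    (h : IsTransfer (K := X.cohomology) (X := X) (AlgHom.id F X.Coh) ι t)
    {φ : X.Coh →ₗ[F] X.Coh →ₗ[F] X.Coh} (hφ : φ ∈ X.cohomology.hochCochains₂ (-1))
    (hm : ∀ x y z, X.Represents (massey (K := X.cohomology) ι t x y z)
      (X.cohomology.signOp x * φ y z - φ (x * y) z + φ x (y * z) - φ x y * z)) :
    X.IsMasseyTrivial := by
  have hι : ∀ x, X.Represents (ι x) x := h.represents
  refine ⟨ι, t + φ.compr₂ ι, ⟨h.map_grading, h.represents, ?_, ?_⟩, ?_⟩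
  · intro i j x y hx hy
    refine add_mem (h.degree hx hy) ?_
    have h1 := hφ i j x y hx hy
    rcases lt_or_ge ((i : ℤ) + j + -1) 0 with hm | hm
    · rw [X.cohomology.intGrading_of_neg hm, Submodule.mem_bot] at h1
      rw [LinearMap.compr₂_apply, h1, map_zero]
      exact zero_mem _
    · lift (i : ℤ) + j + -1 to ℕ using hm with m
      rw [intGrading_natCast] at h1 ⊢
      exact h.map_grading h1
  · intro x y
    simp only [LinearMap.add_apply, LinearMap.compr₂_apply, map_add, h.d_eq,
      (hι (φ x y)).d_eq_zero, add_zero]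
  · intro x y z
    have e : massey (K := X.cohomology) ι (t + φ.compr₂ ι) x y z = massey (K := X.cohomology) ι t x y z
        - (X.signOp (ι x) * ι (φ y z) - ι (φ (x * y) z) + ι (φ x (y * z)) - ι (φ x y) * ι z) := by
      simp only [massey, LinearMap.add_apply, LinearMap.compr₂_apply, add_mul, mul_add]
      abel
    have h1 := (hm x y z).sub ((((represents_signOp (hι x)).mul (hι (φ y z))).sub
      (hι (φ (x * y) z))).add (hι (φ x (y * z))) |>.sub ((hι (φ x y)).mul (hι z)))
    rw [sub_self] at h1
    rw [e]
    exact h1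

theorem algEquiv_apply_hochschild {R S : Type*} [Ring R] [Ring S] [Algebra F R] [Algebra F S]
    (e : R ≃ₐ[F] S) (a z : R) (b c d g : S) :
    e (a * e.symm b - e.symm c + e.symm d - e.symm g * z) = e a * b - c + d - g * e z := by
  simp

/-- Transfer data can be pushed forward along `f`. In the other direction, any transfer data on `X` are
pushed forward and compared with trivial data on `Y`; the resulting primitive lives on the common
cohomology and is absorbed into the data on `X`. -/
theorem isMasseyTrivial_iff_of_isQuasiIso {f : Hom X Y} (hf : f.IsQuasiIso) :
    X.IsMasseyTrivial ↔ Y.IsMasseyTrivial := by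
  let e : X.Coh ≃ₐ[F] Y.Coh := AlgEquiv.ofBijective f.mapCoh hf
  have he : ∀ x, e x = f.mapCoh x := fun x => rfl
  have hes : ∀ {k : ℕ} {y : Y.Coh}, y ∈ Y.cohGrading k → e.symm y ∈ X.cohGrading k := by
    intro k y hy
    have : X.cohProj k (e.symm y) = e.symm y := by
      apply e.injective
      rw [he, f.mapCoh_cohProj, ← he, e.apply_symm_apply, Y.cohProj_of_mem hy]
    rw [← this]
    exact cohProj_mem k _
  constructor
  · rintro ⟨ι, t, h, hm⟩
    have h1 := IsTransfer.map (K' := Y.cohomology) f h (e.symm : Y.Coh →ₐ[F] X.Coh) hes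
    have h2 : f.mapCoh.comp ((AlgHom.id F X.Coh).comp (e.symm : Y.Coh →ₐ[F] X.Coh)) =
        AlgHom.id F Y.Coh := by
      ext y
      exact e.apply_symm_apply y
    rw [h2] at h1
    refine ⟨_, _, h1, fun x y z => ?_⟩
    rw [massey_map]
    have := (hm (e.symm x) (e.symm y) (e.symm z)).map f
    rwa [map_zero] at this
  · rintro ⟨ι, t, h, hm⟩
    obtain ⟨ι', t', h'⟩ := exists_isTransfer X
    have h1 := IsTransfer.map (K' := X.cohomology) f h' (AlgHom.id F X.Coh) (fun hx => hx)
    have h2 : IsTransfer (K := X.cohomology) (X := Y) (f.mapCoh.comp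
        ((AlgHom.id F X.Coh).comp (AlgHom.id F X.Coh))) (ι ∘ₗ f.mapCoh.toLinearMap)
        (t.compl₁₂ f.mapCoh.toLinearMap f.mapCoh.toLinearMap) :=
      { map_grading := fun hx => h.map_grading (f.mapCoh_mem hx)
        represents := fun x => h.represents (f.mapCoh x)
        degree := fun hx hy => h.degree (f.mapCoh_mem hx) (f.mapCoh_mem hy)
        d_eq := fun x y => by simp [h.d_eq] }
    obtain ⟨φ, hφ, hφ'⟩ := h1.exists_massey_sub_massey h2
    refine isMasseyTrivial_of h' (φ := φ.compr₂ (e.symm : Y.Coh →ₐ[F] X.Coh).toLinearMap) ?_ ?_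
    · intro i j x y hx hy
      have h3 := hφ i j x y hx hy
      change e.symm (φ x y) ∈ _
      rcases lt_or_ge ((i : ℤ) + j + -1) 0 with hm | hm
      · rw [Y.cohomology.intGrading_of_neg hm, Submodule.mem_bot] at h3
        rw [h3, map_zero]
        exact zero_mem _
      · lift (i : ℤ) + j + -1 to ℕ using hm with m
        rw [intGrading_natCast] at h3 ⊢
        exact hes h3
    · intro x y z
      obtain ⟨w, hw⟩ := exists_represents (h'.d_massey x y z)
      have h4 := hφ' x y z
      have h5 : massey (K := X.cohomology) (ι ∘ₗ f.mapCoh.toLinearMap)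
          (t.compl₁₂ f.mapCoh.toLinearMap f.mapCoh.toLinearMap) x y z =
          massey (K := Y.cohomology) ι t (f.mapCoh x) (f.mapCoh y) (f.mapCoh z) := by
        simp [massey]
      rw [h5, massey_map] at h4
      have h6 := h4.add (hm (f.mapCoh x) (f.mapCoh y) (f.mapCoh z))
      rw [sub_add_cancel, add_zero] at h6
      have h7 := (hw.map f).eq h6
      have h8 := f.mapCoh_signOp x
      have h9 := algEquiv_apply_hochschild e (X.cohomology.signOp x) z (φ y z) (φ (x * y) z)
        (φ x (y * z)) (φ x y)
      rw [he (X.cohomology.signOp x), h8] at h9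
      have h10 := e.injective (Eq.trans h9 h7.symm)
      rw [← h10] at hw
      exact hw

theorem isMasseyTrivial_iff_of_equivalent (h : Equivalent X Y) :
    X.IsMasseyTrivial ↔ Y.IsMasseyTrivial := by
  induction h with
  | rel X Y h =>
    obtain ⟨f, hf⟩ := h
    exact isMasseyTrivial_iff_of_isQuasiIso hf
  | refl X => exact Iff.rfl
  | symm X Y _ ih => exact ih.symm
  | trans X Y Z _ _ ih₁ ih₂ => exact ih₁.trans ih₂

theorem isMasseyTrivial_of_d_eq_zero (h : X.d = 0) : X.IsMasseyTrivial := by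
  obtain ⟨ι, hι, hι'⟩ := X.exists_splitting
  refine ⟨ι, 0, ⟨fun hx => hι _ _ hx, hι', fun _ _ => zero_mem _, fun x y => ?_⟩, fun x y z => ?_⟩
  · obtain ⟨c, hc⟩ := ((hι' x).mul (hι' y)).exists_d_eq_sub (hι' (x * y))
    change X.d 0 = _
    rw [map_zero, ← hc, h]
    rfl
  · simpa [massey] using represents_zero (X := X)

/-- The universal ternary Massey product of a formal DGCA vanishes. -/
theorem IsFormal.isMasseyTrivial (h : X.IsFormal) : X.IsMasseyTrivial :=
  (isMasseyTrivial_iff_of_equivalent h).2 (isMasseyTrivial_of_d_eq_zero rfl)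

end MasseyTrivial

end DGCA

/-! ### The transferred ternary product of an adapted choice -/

namespace DGCA

variable {F : Type u} [Field F]

theorem neg_one_zpow_neg_one_mul (i : ℕ) : (-1 : F) ^ ((-1 : ℤ) * (i : ℤ)) = (-1 : F) ^ i := by
  rw [neg_one_mul, zpow_neg, zpow_natCast, ← inv_pow, inv_neg, inv_one]

theorem mem_hochCoboundaries₃_iff {H : DGCA.{u, v} F}
    {f : H.carrier →ₗ[F] H.carrier →ₗ[F] H.carrier →ₗ[F] H.carrier} :
    f ∈ H.hochCoboundaries₃ (-1) ↔ ∃ φ ∈ H.hochCochains₂ (-1), ∀ x y z,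
      f x y z = H.signOp x * φ y z - φ (x * y) z + φ x (y * z) - φ x y * z := by
  constructor
  · rintro ⟨φ, hφ, h⟩
    refine ⟨φ, hφ, fun x y z => ?_⟩
    induction x using H.hom_induction with
    | h0 => simp
    | hh k x hx =>
      rw [h k x y z hx, neg_one_zpow_neg_one_mul, H.signOp_of_mem hx, smul_mul_assoc]
    | hadd x x' hx hx' =>
      simp only [map_add, LinearMap.add_apply, hx, hx', add_mul]
      abel
  · rintro ⟨φ, hφ, h⟩
    refine ⟨φ, hφ, fun k x y z hx => ?_⟩
    rw [h, neg_one_zpow_neg_one_mul, H.signOp_of_mem hx, smul_mul_assoc]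

end DGCA

namespace PoincareDGCA

variable {F : Type u} [Field F] {n : ℕ} {A : PoincareDGCA.{u, v} F n}

namespace HodgeDecomposition

variable (h : A.HodgeDecomposition)

/-- The projection to the harmonic summand, as an endomorphism. -/
noncomputable def projHarm : A.carrier →ₗ[F] A.carrier := h.harm.subtype ∘ₗ h.harmProj

theorem projHarm_mem (a : A.carrier) : h.projHarm a ∈ h.harm := (h.harmProj a).2

theorem dMinus_mem (a : A.carrier) : h.dMinus a ∈ h.coex := by
  rw [dMinus, LinearMap.comp_apply]
  exact Subtype.property _

theorem d_of_mem_harm {w : A.carrier} (hw : w ∈ h.harm) : A.d w = 0 := h.harm_le_ker hw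

theorem dMinus_of_mem_harm {w : A.carrier} (hw : w ∈ h.harm) : h.dMinus w = 0 :=
  h.dMinus_of_mem_sup (Submodule.mem_sup_left hw)

theorem dMinus_of_mem_coex {w : A.carrier} (hw : w ∈ h.coex) : h.dMinus w = 0 :=
  h.dMinus_of_mem_sup (Submodule.mem_sup_right hw)

theorem projHarm_of_mem_harm {w : A.carrier} (hw : w ∈ h.harm) : h.projHarm w = w := by
  have := Submodule.projectionOnto_apply_left h.isCompl_harm ⟨w, hw⟩
  exact congrArg Subtype.val this

theorem projHarm_of_mem_sup {w : A.carrier} (hw : w ∈ LinearMap.range A.d ⊔ h.coex) :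
    h.projHarm w = 0 := by
  have := (Submodule.projectionOnto_apply_eq_zero_iff h.isCompl_harm).2 hw
  exact congrArg Subtype.val this

theorem projHarm_of_mem_coex {w : A.carrier} (hw : w ∈ h.coex) : h.projHarm w = 0 :=
  h.projHarm_of_mem_sup (Submodule.mem_sup_right hw)

theorem projHarm_d (c : A.carrier) : h.projHarm (A.d c) = 0 :=
  h.projHarm_of_mem_sup (Submodule.mem_sup_left ⟨c, rfl⟩)

theorem exists_decomposition (a : A.carrier) :
    ∃ c ∈ h.coex, ∃ w ∈ h.harm, ∃ z ∈ h.coex, a = A.d c + w + z := by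
  have ha : a ∈ (LinearMap.range A.d ⊔ h.harm) ⊔ h.coex := by
    rw [h.isCompl.sup_eq_top]
    trivial
  obtain ⟨y, hy, z, hz, rfl⟩ := Submodule.mem_sup.1 ha
  obtain ⟨u, hu, w, hw, rfl⟩ := Submodule.mem_sup.1 hy
  obtain ⟨c, hc⟩ := h.dCoex_bijective.2 ⟨u, hu⟩
  refine ⟨c, c.2, w, hw, z, hz, ?_⟩
  rw [← show A.d c = u from congrArg Subtype.val hc]

theorem dMinus_decomposition {c w z : A.carrier} (hc : c ∈ h.coex) (hw : w ∈ h.harm)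
    (hz : z ∈ h.coex) : h.dMinus (A.d c + w + z) = c := by
  rw [map_add, map_add, h.dMinus_d_of_mem_coex hc, h.dMinus_of_mem_harm hw,
    h.dMinus_of_mem_coex hz, add_zero, add_zero]

theorem projHarm_decomposition {w z : A.carrier} (c : A.carrier) (hw : w ∈ h.harm)
    (hz : z ∈ h.coex) : h.projHarm (A.d c + w + z) = w := by
  rw [map_add, map_add, h.projHarm_d, h.projHarm_of_mem_harm hw, h.projHarm_of_mem_coex hz,
    add_zero, zero_add]

theorem dMinus_d_decomposition {c w z : A.carrier} (hw : w ∈ h.harm) (hz : z ∈ h.coex) :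
    h.dMinus (A.d (A.d c + w + z)) = z := by
  rw [map_add A.d, map_add A.d, A.d_d, h.d_of_mem_harm hw, zero_add, zero_add,
    h.dMinus_d_of_mem_coex hz]

/-- The homotopy formula `1 = π + d d⁻ + d⁻ d`. -/
theorem homotopy (a : A.carrier) :
    a = h.projHarm a + A.d (h.dMinus a) + h.dMinus (A.d a) := by
  obtain ⟨c, hc, w, hw, z, hz, rfl⟩ := h.exists_decomposition a
  rw [h.projHarm_decomposition c hw hz, h.dMinus_decomposition hc hw hz,
    h.dMinus_d_decomposition hw hz]
  abel

theorem proj_mem_harm {w : A.carrier} (hw : w ∈ h.harm) (k : ℕ) : A.proj k w ∈ h.harm :=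
  h.isHarmonic.isGraded k w hw

theorem proj_mem_coex {w : A.carrier} (hw : w ∈ h.coex) (k : ℕ) : A.proj k w ∈ h.coex :=
  h.coex_isGraded k w hw

theorem projHarm_proj (k : ℕ) (a : A.carrier) :
    h.projHarm (A.proj k a) = A.proj k (h.projHarm a) := by
  obtain ⟨c, hc, w, hw, z, hz, rfl⟩ := h.exists_decomposition a
  rw [h.projHarm_decomposition c hw hz, map_add, map_add, map_add, map_add,
    h.projHarm_of_mem_harm (h.proj_mem_harm hw k), h.projHarm_of_mem_coex (h.proj_mem_coex hz k)]
  cases k with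
  | zero => rw [A.proj_zero_d]; simp
  | succ k => rw [A.proj_d, h.projHarm_d]; simp

theorem dMinus_proj_zero (a : A.carrier) : h.dMinus (A.proj 0 a) = 0 := by
  obtain ⟨c, hc, w, hw, z, hz, rfl⟩ := h.exists_decomposition a
  rw [map_add, map_add, map_add, map_add, A.proj_zero_d, map_zero,
    h.dMinus_of_mem_harm (h.proj_mem_harm hw 0), h.dMinus_of_mem_coex (h.proj_mem_coex hz 0)]
  simp

theorem dMinus_proj_succ (k : ℕ) (a : A.carrier) :
    h.dMinus (A.proj (k + 1) a) = A.proj k (h.dMinus a) := by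
  obtain ⟨c, hc, w, hw, z, hz, rfl⟩ := h.exists_decomposition a
  rw [h.dMinus_decomposition hc hw hz, map_add (A.proj _), map_add (A.proj _), A.proj_d]
  exact h.dMinus_decomposition (h.proj_mem_coex hc k) (h.proj_mem_harm hw _) (h.proj_mem_coex hz _)

theorem projHarm_mem_grading {k : ℕ} {a : A.carrier} (ha : a ∈ A.grading k) :
    h.projHarm a ∈ A.grading k := by
  rw [← A.proj_of_mem ha, h.projHarm_proj]
  exact A.proj_mem k _

theorem dMinus_mem_grading {k : ℕ} {a : A.carrier} (ha : a ∈ A.grading (k + 1)) :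
    h.dMinus a ∈ A.grading k := by
  rw [← A.proj_of_mem ha, h.dMinus_proj_succ]
  exact A.proj_mem k _

theorem dMinus_of_mem_zero {a : A.carrier} (ha : a ∈ A.grading 0) : h.dMinus a = 0 := by
  rw [← A.proj_of_mem ha, h.dMinus_proj_zero]

theorem dMinus_mem_intGrading {k : ℕ} {a : A.carrier} (ha : a ∈ A.grading k) :
    h.dMinus a ∈ A.intGrading ((k : ℤ) + -1) := by
  cases k with
  | zero => rw [h.dMinus_of_mem_zero ha]; exact zero_mem _
  | succ k =>
    have e : ((k + 1 : ℕ) : ℤ) + -1 = (k : ℕ) := by push_cast; ring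
    rw [e, A.intGrading_natCast]
    exact h.dMinus_mem_grading ha

theorem represents_harmClass (a : A.carrier) : A.Represents (h.projHarm a) (h.harmClass a) :=
  ⟨⟨h.projHarm a, h.d_of_mem_harm (h.projHarm_mem a)⟩, rfl, rfl⟩

theorem represents_of_d_eq_zero {a : A.carrier} (ha : A.d a = 0) :
    A.Represents a (h.harmClass a) := by
  have h1 := (h.represents_harmClass a).add (DGCA.represents_d (h.dMinus a))
  have h2 := h.homotopy a
  rw [ha, map_zero, add_zero] at h2
  rwa [← h2, add_zero] at h1

theorem harmClass_eq {a : A.carrier} {x : A.Coh} (ha : A.Represents a x) : h.harmClass a = x :=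
  (h.represents_of_d_eq_zero ha.d_eq_zero).eq ha

theorem harmClass_of_mem_coex {a : A.carrier} (ha : a ∈ h.coex) : h.harmClass a = 0 := by
  have := h.represents_harmClass a
  rw [h.projHarm_of_mem_coex ha] at this
  exact this.eq DGCA.represents_zero

theorem harmClass_d (a : A.carrier) : h.harmClass (A.d a) = 0 :=
  h.harmClass_eq (DGCA.represents_d a)

end HodgeDecomposition

namespace AdaptedChoice

variable (h : A.AdaptedChoice)

theorem represents_ι (x : A.Coh) : A.Represents (h.ι x) x := h.isSplitting.represents x

theorem ι_mem_harm (x : A.Coh) : h.ι x ∈ h.hodge.harm := by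
  rw [h.harm_eq]
  exact ⟨x, rfl⟩

theorem eq_ι_of_mem_harm {w : A.carrier} (hw : w ∈ h.hodge.harm) {x : A.Coh}
    (hx : A.Represents w x) : w = h.ι x := by
  rw [h.harm_eq] at hw
  obtain ⟨y, rfl⟩ := hw
  rw [(h.represents_ι y).eq hx]

theorem projHarm_eq (a : A.carrier) : h.hodge.projHarm a = h.ι (h.hodge.harmClass a) :=
  h.eq_ι_of_mem_harm (h.hodge.projHarm_mem a) (h.hodge.represents_harmClass a)

theorem harmClass_ι (x : A.Coh) : h.hodge.harmClass (h.ι x) = x :=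
  h.hodge.harmClass_eq (h.represents_ι x)

/-- The primitives `d⁻(ιx ιy)`. -/
noncomputable def primitive : A.Coh →ₗ[F] A.Coh →ₗ[F] A.carrier :=
  ((LinearMap.mul F A.carrier).compl₁₂ h.ι h.ι).compr₂ h.hodge.dMinus

theorem primitive_apply (x y : A.Coh) : h.primitive x y = h.hodge.dMinus (h.ι x * h.ι y) := rfl

theorem isTransfer : DGCA.IsTransfer (K := A.cohomology) (X := A.toDGCA) (AlgHom.id F A.Coh)
    h.ι h.primitive where
  map_grading hx := h.isSplitting.map_grading _ _ hx
  represents := h.represents_ι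
  degree hx hy := by
    have := h.hodge.dMinus_mem_intGrading (A.mul_mem (h.isSplitting.map_grading _ _ hx)
      (h.isSplitting.map_grading _ _ hy))
    push_cast at this
    exact this
  d_eq x y := by
    have h1 := (h.represents_ι x).mul (h.represents_ι y)
    have h2 := h.hodge.homotopy (h.ι x * h.ι y)
    rw [h1.d_eq_zero, map_zero, add_zero, h.projHarm_eq, h.hodge.harmClass_eq h1] at h2
    exact eq_sub_of_add_eq' h2.symm

theorem mu₃_apply (x y z : A.Coh) : h.mu₃ x y z = h.hodge.harmClass
    (h.primitive x y * h.ι z - A.signOp (h.ι x) * h.primitive y z) := rfl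

/-- The terms `t(xy, z)` and `t(x, yz)` of the cocycle `massey` are coexact and have no harmonic part, so
that `μ₃` is the class of this cocycle. -/
theorem represents_mu₃ (x y z : A.Coh) :
    A.Represents (DGCA.massey (K := A.cohomology) h.ι h.primitive x y z) (h.mu₃ x y z) := by
  have h1 := h.hodge.represents_of_d_eq_zero (h.isTransfer.d_massey x y z)
  have h2 : h.hodge.harmClass (DGCA.massey (K := A.cohomology) h.ι h.primitive x y z) =
      h.mu₃ x y z := by
    rw [DGCA.massey, map_sub, map_add, h.mu₃_apply]
    have e1 : h.hodge.harmClass (h.primitive (x * y) z) = 0 :=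
      h.hodge.harmClass_of_mem_coex (h.hodge.dMinus_mem _)
    have e2 : h.hodge.harmClass (h.primitive x (y * z)) = 0 :=
      h.hodge.harmClass_of_mem_coex (h.hodge.dMinus_mem _)
    exact (congrArg₂ (· - ·) (congrArg₂ (· + ·) rfl e1) e2).trans (by simp)
  rw [h2] at h1
  exact h1

theorem mu₃_mem_hochCocycles₃ : h.mu₃ ∈ A.cohomology.hochCocycles₃ (-1) := by
  constructor
  · intro i j k x y z hx hy hz
    exact (h.represents_mu₃ x y z).mem_intGrading (h.isTransfer.massey_degree hx hy hz)
  · intro i x y z w hx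
    have h1 := h.isTransfer.massey_cocycle x y z w
    have h2 := ((((DGCA.represents_signOp (h.represents_ι x)).mul (h.represents_mu₃ y z w)).sub
      (h.represents_mu₃ (x * y) z w)).add (h.represents_mu₃ x (y * z) w)).sub
      (h.represents_mu₃ x y (z * w)) |>.add ((h.represents_mu₃ x y z).mul (h.represents_ι w))
    have h3 := h2.eq (h1 ▸ DGCA.represents_d _)
    rw [A.cohomology.signOp_of_mem hx, smul_mul_assoc] at h3
    rw [DGCA.neg_one_zpow_neg_one_mul]
    exact h3

theorem mu₃_sub_mu₃_mem (h' : A.AdaptedChoice) :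
    h.mu₃ - h'.mu₃ ∈ A.cohomology.hochCoboundaries₃ (-1) := by
  obtain ⟨φ, hφ, hφ'⟩ := h.isTransfer.exists_massey_sub_massey h'.isTransfer
  refine DGCA.mem_hochCoboundaries₃_iff.2 ⟨φ, hφ, fun x y z => ?_⟩
  exact ((h.represents_mu₃ x y z).sub (h'.represents_mu₃ x y z)).eq (hφ' x y z)

theorem mu₃_mem_of_isMasseyTrivial (hA : A.IsMasseyTrivial) :
    h.mu₃ ∈ A.cohomology.hochCoboundaries₃ (-1) := by
  obtain ⟨ι, t, ht, hm⟩ := hA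
  obtain ⟨φ, hφ, hφ'⟩ := h.isTransfer.exists_massey_sub_massey ht
  refine DGCA.mem_hochCoboundaries₃_iff.2 ⟨φ, hφ, fun x y z => ?_⟩
  have := (h.represents_mu₃ x y z).sub (hm x y z)
  rw [sub_zero] at this
  exact this.eq (hφ' x y z)

end AdaptedChoice

end PoincareDGCA

/-! ### Existence of adapted choices -/

namespace DGCA

variable {F : Type u} [Field F]

theorem map_proj_of_map_mem {X Y : DGCA.{u, v} F} (T : X.carrier →ₗ[F] Y.carrier)
    (hT : ∀ {k : ℕ} {a : X.carrier}, a ∈ X.grading k → T a ∈ Y.grading k) (k : ℕ) (a : X.carrier) :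
    Y.proj k (T a) = T (X.proj k a) := by
  induction a using X.hom_induction with
  | h0 => simp
  | hh l a ha =>
    by_cases h : l = k
    · subst h
      rw [X.proj_of_mem ha, Y.proj_of_mem (hT ha)]
    · rw [X.proj_of_mem_ne ha h, Y.proj_of_mem_ne (hT ha) h, map_zero]
  | hadd a b ha hb => simp only [map_add, ha, hb]

theorem proj_mul_mem (X : DGCA.{u, v} F) (P : Submodule F X.carrier) (k : ℕ) (a b : X.carrier)
    (h : ∀ i j, i + j = k → X.proj i a * X.proj j b ∈ P) : X.proj k (a * b) ∈ P := by
  obtain ⟨s, hs⟩ := X.eq_sum_proj a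
  obtain ⟨t, ht⟩ := X.eq_sum_proj b
  have e : a * b = ∑ i ∈ s, ∑ j ∈ t, X.proj i a * X.proj j b := by
    rw [← Finset.sum_mul_sum, ← hs, ← ht]
  rw [e, map_sum]
  refine sum_mem fun i _ => ?_
  rw [map_sum]
  refine sum_mem fun j _ => ?_
  have hij := X.mul_mem (X.proj_mem i a) (X.proj_mem j b)
  by_cases hk : i + j = k
  · rw [← hk, X.proj_of_mem hij]
    exact h i j hk
  · rw [X.proj_of_mem_ne hij hk]
    exact zero_mem _

theorem cohomology_proj (X : DGCA.{u, v} F) (k : ℕ) (x : X.Coh) :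
    X.cohomology.proj k x = X.cohProj k x := by
  induction x using X.cohomology.hom_induction with
  | h0 => simp
  | hh l x hx =>
    by_cases h : l = k
    · subst h
      rw [X.cohomology.proj_of_mem hx, X.cohProj_of_mem hx]
    · rw [X.cohomology.proj_of_mem_ne hx h, X.cohProj_of_mem_ne hx h]
  | hadd a b ha hb => rw [map_add, map_add, ha, hb]

theorem represents_algebraMap (X : DGCA.{u, v} F) (c : F) :
    X.Represents (algebraMap F X.carrier c) (algebraMap F X.Coh c) := by
  rw [Algebra.algebraMap_eq_smul_one, Algebra.algebraMap_eq_smul_one]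
  exact represents_one.smul c

theorem IsConnected.exists_smul_one {X : DGCA.{u, v} F} {m : ℕ} (h : X.IsConnected m) {x : X.Coh}
    (hx : x ∈ X.cohGrading 0) : ∃ c : F, x = c • (1 : X.Coh) := by
  have h1 : (1 : X.Coh) ∈ X.cohGrading 0 := X.cohomology.one_mem
  have hne : (⟨1, h1⟩ : X.cohGrading 0) ≠ 0 := by
    intro h0
    have h10 : (1 : X.Coh) = 0 := congrArg Subtype.val h0
    have : Subsingleton (X.cohGrading 0) := ⟨fun a b => Subtype.ext (by
      rw [← mul_one (a : X.Coh), ← mul_one (b : X.Coh), h10, mul_zero, mul_zero])⟩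
    have h2 := h.1
    rw [show Module.finrank F (X.cohomology.grading 0) = 0 from
      Module.finrank_zero_of_subsingleton (M := X.cohGrading 0)] at h2
    exact zero_ne_one h2
  obtain ⟨c, hc⟩ := (finrank_eq_one_iff_of_nonzero' _ hne).1 h.1 ⟨x, hx⟩
  exact ⟨c, (congrArg Subtype.val hc).symm⟩

end DGCA

namespace PoincareDGCA

variable {F : Type u} [Field F] {n : ℕ} (A : PoincareDGCA.{u, v} F n)

section Integral

/-- The functional `a ↦ ∫ [a]`, which vanishes in degrees other than `n`. -/
noncomputable def int : A.carrier →ₗ[F] F := A.integral ∘ₗ A.topClass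

/-- The functional `∫` on the cohomology, extended by zero to degrees other than `n`. -/
noncomputable def cohInt : A.Coh →ₗ[F] F :=
  A.integral ∘ₗ DirectSum.component F ℕ (fun k => A.cohGrading k) n ∘ₗ
    (DirectSum.decomposeLinearEquiv A.cohGrading).toLinearMap

theorem pairing_eq (a b : A.carrier) : A.pairing a b = A.int (a * b) := rfl

variable {A}

theorem cohInt_eq {x : A.Coh} (hx : x ∈ A.cohGrading n) : A.cohInt x = A.integral ⟨x, hx⟩ := by
  change A.integral (DirectSum.decompose A.cohGrading x n) = _
  congr 1
  exact Subtype.ext (DirectSum.decompose_of_mem_same _ hx)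

theorem cohInt_of_mem_ne {x : A.Coh} {k : ℕ} (hx : x ∈ A.cohGrading k) (hk : k ≠ n) :
    A.cohInt x = 0 := by
  change A.integral (DirectSum.decompose A.cohGrading x n) = _
  rw [show DirectSum.decompose A.cohGrading x n = 0 from
    Subtype.ext (DirectSum.decompose_of_mem_ne _ hx hk), map_zero]

theorem int_of_represents {a : A.carrier} {x : A.Coh} (h : A.Represents a x) :
    A.int a = A.cohInt x := by
  have h1 := h.proj n
  have h2 : A.int a = A.cohInt (A.cohProj n x) := by
    rw [cohInt_eq (DGCA.cohProj_mem n x)]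
    change A.integral (A.topClass a) = _
    congr 1
    refine Subtype.ext ?_
    exact DGCA.Represents.eq ⟨⟨A.proj n a, A.d_proj_top a⟩, rfl, rfl⟩ h1
  rw [h2]
  clear h1 h2 h
  induction x using A.cohomology.hom_induction with
  | h0 => simp
  | hh k x hx =>
    by_cases hk : k = n
    · subst hk
      rw [A.cohProj_of_mem hx]
    · rw [A.cohProj_of_mem_ne hx hk, cohInt_of_mem_ne hx hk, map_zero]
  | hadd x y hx hy => rw [map_add, map_add, map_add, hx, hy]

theorem int_d (c : A.carrier) : A.int (A.d c) = 0 := by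
  rw [int_of_represents (DGCA.represents_d c), map_zero]

theorem int_of_mem_ne {a : A.carrier} {k : ℕ} (ha : a ∈ A.grading k) (hk : k ≠ n) :
    A.int a = 0 := by
  change A.integral (A.topClass a) = 0
  rw [show A.topClass a = 0 from Subtype.ext ?_, map_zero]
  exact DGCA.Represents.eq ⟨⟨A.proj n a, A.d_proj_top a⟩, rfl, rfl⟩
    (by change A.Represents (A.proj n a) 0; rw [A.proj_of_mem_ne ha hk]; exact DGCA.represents_zero)

theorem int_mul_comm {i j : ℕ} {a b : A.carrier} (ha : a ∈ A.grading i) (hb : b ∈ A.grading j) :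
    A.int (a * b) = (-1 : F) ^ (i * j) * A.int (b * a) := by
  rw [A.graded_comm ha hb, map_smul, smul_eq_mul]

theorem eq_zero_of_cohInt {x : A.Coh} (h : ∀ y, A.cohInt (x * y) = 0) : x = 0 :=
  A.nondegenerate x h

/-- Poincaré duality: every family of functionals on the cohomology is represented by classes. -/
theorem exists_cohInt_mul_eq {V : Type*} [AddCommGroup V] [Module F V]
    (ω : V →ₗ[F] A.Coh →ₗ[F] F) : ∃ T : V →ₗ[F] A.Coh, ∀ v y, A.cohInt (T v * y) = ω v y := by
  have := A.finite_coh
  let D : A.Coh →ₗ[F] Module.Dual F A.Coh := (LinearMap.mul F A.Coh).compr₂ A.cohInt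
  have hD : Function.Injective D := by
    refine (injective_iff_map_eq_zero D).2 fun x hx => eq_zero_of_cohInt fun y => ?_
    exact LinearMap.congr_fun hx y
  have hD' : Function.Surjective D :=
    (LinearMap.injective_iff_surjective_of_finrank_eq_finrank
      (Subspace.dual_finrank_eq (K := F) (V := A.Coh)).symm).1 hD
  obtain ⟨g, hg⟩ := DGCA.exists_section D hD'
  refine ⟨g ∘ₗ ω, fun v y => ?_⟩
  exact LinearMap.congr_fun (hg (ω v)) y

/-- A class whose pairings vanish outside of the degree `n - k` is homogeneous of degree `k`. -/
theorem mem_cohGrading_of_cohInt {x : A.Coh} {k : ℕ}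
    (h : ∀ (j : ℕ) (y : A.Coh), y ∈ A.cohGrading j → k + j ≠ n → A.cohInt (x * y) = 0) :
    x ∈ A.cohGrading k := by
  have h1 : ∀ (j : ℕ) (x y : A.Coh), y ∈ A.cohGrading j →
      A.cohInt (A.cohProj k x * y) = if k + j = n then A.cohInt (x * y) else 0 := by
    intro j x y hy
    induction x using A.cohomology.hom_induction with
    | h0 => simp
    | hh i x hx =>
      have hxy : x * y ∈ A.cohGrading (i + j) := A.cohomology.mul_mem hx hy
      by_cases hi : i = k
      · subst hi
        rw [A.cohProj_of_mem hx]
        split_ifs with hn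
        · rfl
        · exact cohInt_of_mem_ne hxy hn
      · rw [A.cohProj_of_mem_ne hx hi, zero_mul, map_zero]
        split_ifs with hn
        · exact (cohInt_of_mem_ne hxy (by omega)).symm
        · rfl
    | hadd x x' hx hx' =>
      rw [map_add, add_mul, add_mul, map_add, map_add, hx, hx']
      split_ifs <;> simp
  have h2 : x - A.cohProj k x = 0 := by
    refine eq_zero_of_cohInt fun y => ?_
    induction y using A.cohomology.hom_induction with
    | h0 => simp
    | hh j y hy =>
      rw [sub_mul, map_sub, h1 j x y hy]
      split_ifs with hn
      · exact sub_self _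
      · rw [h j y hy hn, sub_zero]
    | hadd y y' hy hy' => rw [mul_add, map_add, hy, hy', add_zero]
  rw [sub_eq_zero.1 h2]
  exact DGCA.cohProj_mem k x

end Integral

section HodgeModification

variable {A}

theorem isHarmonic_range {ι : A.Coh →ₗ[F] A.carrier} (hι : A.IsSplitting ι) :
    A.IsHarmonic (LinearMap.range ι) where
  isGraded := by
    rintro k _ ⟨x, rfl⟩
    refine ⟨A.cohProj k x, ?_⟩
    rw [← A.cohomology_proj]
    exact (DGCA.map_proj_of_map_mem (X := A.cohomology) ι (fun h => hι.map_grading _ _ h) k x).symm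
  disjoint := by
    rw [Submodule.disjoint_def]
    rintro _ ⟨c, hc⟩ ⟨x, rfl⟩
    rw [show x = 0 from DGCA.Represents.eq (hι.represents x) (hc ▸ DGCA.represents_d c), map_zero]
  sup_eq := by
    apply le_antisymm
    · refine sup_le ?_ ?_
      · rintro _ ⟨c, rfl⟩
        exact A.d_d c
      · rintro _ ⟨x, rfl⟩
        exact DGCA.Represents.d_eq_zero (hι.represents x)
    · intro a ha
      obtain ⟨x, hx⟩ := DGCA.exists_represents (X := A.toDGCA) ha
      obtain ⟨c, hc⟩ := hx.exists_d_eq_sub (hι.represents x)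
      rw [show a = A.d c + ι x by rw [hc]; abel]
      exact Submodule.add_mem_sup ⟨c, rfl⟩ ⟨x, rfl⟩

theorem int_d_mul {c w : A.carrier} (hw : A.d w = 0) : A.int (A.d c * w) = 0 := by
  have : A.d (c * w) = A.d c * w := by rw [A.leibniz_signOp, hw, mul_zero, add_zero]
  rw [← this, int_d]

theorem int_mul_d {c w : A.carrier} (hw : A.d w = 0) : A.int (w * A.d c) = 0 := by
  have : A.d (A.signOp w * c) = w * A.d c := by
    rw [A.leibniz_signOp, A.d_signOp, hw, A.signOp_signOp, map_zero, neg_zero, zero_mul, zero_add]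
  rw [← this, int_d]

/-- Every splitting map is part of a Hodge type decomposition if there is one at all. If `α b` is the
harmonic form with the same pairings with harmonic forms as `b`, then the new coexact summand
consists of the elements `b - α b + ½ d d⁻ α b`; the last term restores the isotropy. -/
theorem HodgeDecomposition.exists_of_isSplitting [CharZero F] (h : A.HodgeDecomposition)
    {ι : A.Coh →ₗ[F] A.carrier} (hι : A.IsSplitting ι) :
    ∃ h' : A.HodgeDecomposition, h'.harm = LinearMap.range ι := by
  obtain ⟨T, hT⟩ := exists_cohInt_mul_eq (((LinearMap.mul F A.carrier).compl₂ ι).compr₂ A.int)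
  replace hT : ∀ b y, A.cohInt (T b * y) = A.int (b * ι y) := hT
  have hιr : ∀ x, A.Represents (ι x) x := hι.represents
  have hTd : ∀ {k : ℕ} {b : A.carrier}, b ∈ A.grading k → T b ∈ A.cohGrading k := by
    intro k b hb
    refine mem_cohGrading_of_cohInt fun j y hy hj => ?_
    rw [hT]
    exact int_of_mem_ne (A.mul_mem hb (hι.map_grading _ _ hy)) hj
  let α : A.carrier →ₗ[F] A.carrier := ι ∘ₗ T
  have hαd : ∀ {k : ℕ} {b : A.carrier}, b ∈ A.grading k → α b ∈ A.grading k :=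
    fun hb => hι.map_grading _ _ (hTd hb)
  have hα0 : ∀ b, A.d (α b) = 0 := fun b => (hιr (T b)).d_eq_zero
  have hα : ∀ b y, A.int (b * ι y) = A.int (α b * ι y) := fun b y =>
    (hT b y).symm.trans (int_of_represents ((hιr (T b)).mul (hιr y))).symm
  let P : A.carrier →ₗ[F] A.carrier := A.d ∘ₗ h.dMinus ∘ₗ α
  have hPd : ∀ {k : ℕ} {b : A.carrier}, b ∈ A.grading k → P b ∈ A.grading k := by
    intro k b hb
    cases k with
    | zero =>
      change A.d (h.dMinus (α b)) ∈ _
      rw [h.dMinus_of_mem_zero (hαd hb), map_zero]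
      exact zero_mem _
    | succ k => exact A.d_mem (h.dMinus_mem_grading (hαd hb))
  have hP0 : ∀ b, A.d (P b) = 0 := fun b => A.d_d _
  let L : A.carrier →ₗ[F] A.carrier := LinearMap.id - α + (2⁻¹ : F) • P
  have hL : ∀ b, L b = b - α b + (2⁻¹ : F) • P b := fun b => rfl
  have hLd : ∀ {k : ℕ} {b : A.carrier}, b ∈ A.grading k → L b ∈ A.grading k := fun hb =>
    add_mem (sub_mem hb (hαd hb)) (Submodule.smul_mem _ _ (hPd hb))
  -- `L` changes elements by cocycles only, so that the image of `coex` is again a complement of the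
  -- cocycles.
  have hLk : ∀ b, A.d (L b) = A.d b := fun b => by
    rw [hL, map_add, map_sub, map_smul, hα0, hP0, smul_zero, sub_zero, add_zero]
  have hPα : ∀ b, ∀ b' ∈ h.coex, A.int (P b * b') = A.int (α b * b') := by
    intro b b' hb'
    have h1 := h.homotopy (α b)
    rw [hα0, map_zero, add_zero] at h1
    have h2 : A.int (h.projHarm (α b) * b') = 0 :=
      h.orthogonal _ (Submodule.mem_sup_left (h.projHarm_mem _)) _ hb'
    conv_rhs => rw [h1, add_mul, map_add, h2, zero_add]
    rfl
  have hharm : ∀ y b, A.int (ι y * L b) = 0 := by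
    intro y b
    induction b using A.hom_induction with
    | h0 => simp
    | hh j b hb =>
      induction y using A.cohomology.hom_induction with
      | h0 => simp
      | hh i y hy =>
        rw [int_mul_comm (hι.map_grading _ _ hy) (hLd hb), hL, add_mul, sub_mul, map_add, map_sub,
          hα, sub_self, smul_mul_assoc, map_smul, show P b = A.d (h.dMinus (α b)) from rfl,
          int_d_mul (hιr y).d_eq_zero]
        simp
      | hadd y y' hy hy' => rw [map_add, add_mul, map_add, hy, hy', add_zero]
    | hadd b b' hb hb' => rw [map_add, mul_add, map_add, hb, hb', add_zero]
  have hcoex_hom : ∀ (i j : ℕ) (b b' : A.carrier), b ∈ h.coex → b' ∈ h.coex → b ∈ A.grading i →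
      b' ∈ A.grading j → A.int (L b * L b') = 0 := by
    intro i j b b' hb hb' hi hj
    -- All nonzero terms of the expansion are multiples of `∫ αb αb'`, with total coefficient
    -- `-1 - 1 + 1 + 1/2 + 1/2 = 0`.
    have e0 : A.int (b * b') = 0 := h.orthogonal _ (Submodule.mem_sup_right hb) _ hb'
    have e1 : A.int (b * α b') = A.int (α b * α b') := hα _ _
    have e2 : A.int (α b * b') = A.int (α b * α b') := by
      rw [int_mul_comm (hαd hi) hj, show A.int (b' * α b) = A.int (α b' * α b) from hα _ _,
        int_mul_comm (hαd hi) (hαd hj)]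
    have e3 : A.int (P b * b') = A.int (α b * α b') := by rw [hPα _ _ hb', e2]
    have e4 : A.int (b * P b') = A.int (α b * α b') := by
      rw [int_mul_comm hi (hPd hj), hPα _ _ hb, ← int_mul_comm hi (hαd hj), e1]
    have e5 : A.int (α b * P b') = 0 := int_mul_d (hα0 b)
    have e6 : A.int (P b * α b') = 0 := int_d_mul (hα0 b')
    have e7 : A.int (P b * P b') = 0 := int_d_mul (hP0 b')
    simp only [hL, add_mul, mul_add, sub_mul, mul_sub, map_add, map_sub, smul_mul_assoc,
      mul_smul_comm, map_smul, e0, e1, e2, e3, e4, e5, e6, e7, smul_eq_mul]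
    ring
  have hcoex : ∀ b ∈ h.coex, ∀ b' ∈ h.coex, A.int (L b * L b') = 0 := by
    intro b hb b' hb'
    obtain ⟨s, hs⟩ := A.eq_sum_proj b
    obtain ⟨t, ht⟩ := A.eq_sum_proj b'
    rw [hs, ht, map_sum, map_sum, Finset.sum_mul_sum, map_sum]
    refine Finset.sum_eq_zero fun i _ => ?_
    rw [map_sum]
    exact Finset.sum_eq_zero fun j _ => hcoex_hom i j _ _ (h.proj_mem_coex hb i)
      (h.proj_mem_coex hb' j) (A.proj_mem _ _) (A.proj_mem _ _)
  have hker : LinearMap.range A.d ⊔ LinearMap.range ι = LinearMap.ker A.d :=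
    (isHarmonic_range hι).sup_eq
  have hcompl : IsCompl (LinearMap.ker A.d) h.coex := by
    rw [← h.isHarmonic.sup_eq]
    exact h.isCompl
  refine ⟨{ harm := LinearMap.range ι
            coex := h.coex.map L
            isHarmonic := isHarmonic_range hι
            coex_isGraded := ?_
            isCompl := ?_
            orthogonal := ?_ }, rfl⟩
  · rintro k _ ⟨b, hb, rfl⟩
    rw [DGCA.map_proj_of_map_mem L hLd]
    exact ⟨_, h.proj_mem_coex hb k, rfl⟩
  · rw [hker]
    constructor
    · rw [Submodule.disjoint_def]
      rintro _ hx ⟨b, hb, rfl⟩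
      have hb0 : b ∈ LinearMap.ker A.d := (hLk b).symm.trans hx
      rw [Submodule.disjoint_def.1 hcompl.disjoint b hb0 hb, map_zero]
    · rw [codisjoint_iff, eq_top_iff]
      intro a _
      have ha : a ∈ LinearMap.ker A.d ⊔ h.coex := by
        rw [hcompl.sup_eq_top]
        trivial
      obtain ⟨y, hy, b, hb, rfl⟩ := Submodule.mem_sup.1 ha
      have hy' : A.d y = 0 := hy
      rw [show y + b = (y + (b - L b)) + L b by abel]
      refine Submodule.add_mem_sup ?_ ⟨b, hb, rfl⟩
      change A.d _ = 0
      rw [map_add, hy', map_sub, hLk, sub_self, add_zero]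
  · rintro x hx _ ⟨b', hb', rfl⟩
    obtain ⟨_, ⟨y, rfl⟩, _, ⟨b, hb, rfl⟩, rfl⟩ := Submodule.mem_sup.1 hx
    rw [pairing_eq, add_mul, map_add, hharm, hcoex b hb b' hb', add_zero]

end HodgeModification

section Adapted

variable {A}

theorem mem_cohPos_iff {x : A.Coh} : x ∈ A.cohPos ↔ A.cohProj 0 x = 0 := by
  constructor
  · have : A.cohPos ≤ LinearMap.ker (A.cohProj 0) :=
      iSup₂_le fun k hk x hx => A.cohProj_of_mem_ne hx (by omega)
    exact fun hx => this hx
  · intro hx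
    obtain ⟨s, hs⟩ := A.cohomology.eq_sum_proj x
    rw [hs]
    refine sum_mem fun k _ => ?_
    rw [A.cohomology_proj]
    rcases Nat.eq_zero_or_pos k with rfl | hk
    · rw [hx]; exact zero_mem _
    · exact Submodule.mem_iSup_of_mem k (Submodule.mem_iSup_of_mem hk (DGCA.cohProj_mem k x))

theorem mem_cohPos {k : ℕ} (hk : 1 ≤ k) {x : A.Coh} (hx : x ∈ A.cohGrading k) : x ∈ A.cohPos :=
  mem_cohPos_iff.2 (A.cohProj_of_mem_ne hx (by omega))

theorem cohProj_mem_cohPos {x : A.Coh} (hx : x ∈ A.cohPos) (k : ℕ) : A.cohProj k x ∈ A.cohPos := by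
  rcases Nat.eq_zero_or_pos k with rfl | hk
  · rw [mem_cohPos_iff.1 hx]; exact zero_mem _
  · exact mem_cohPos hk (DGCA.cohProj_mem k x)

theorem cohProj_mul_mem (P : Submodule F A.Coh) (k : ℕ) (x y : A.Coh)
    (h : ∀ i j, i + j = k → A.cohProj i x * A.cohProj j y ∈ P) : A.cohProj k (x * y) ∈ P := by
  rw [← A.cohomology_proj]
  refine A.cohomology.proj_mul_mem P k x y fun i j hij => ?_
  rw [A.cohomology_proj, A.cohomology_proj]
  exact h i j hij

theorem cohProj_mem_cohPos_mul {x : A.Coh} (hx : x ∈ A.cohPos * A.cohPos) (k : ℕ) :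
    A.cohProj k x ∈ A.cohPos * A.cohPos := by
  induction hx using Submodule.mul_induction_on' with
  | mem_mul_mem x hx y hy =>
    exact cohProj_mul_mem _ k x y fun i j _ =>
      Submodule.mul_mem_mul (cohProj_mem_cohPos hx i) (cohProj_mem_cohPos hy j)
  | add x _ y _ hx hy => rw [map_add]; exact add_mem hx hy

theorem cohPos_mul_le : A.cohPos * A.cohPos ≤ A.cohPos := by
  refine Submodule.mul_le.2 fun x hx y hy => mem_cohPos_iff.2 ?_
  refine (Submodule.mem_bot F).1 (cohProj_mul_mem ⊥ 0 x y fun i j hij => ?_)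
  obtain rfl : i = 0 := by omega
  rw [mem_cohPos_iff.1 hx, zero_mul]
  exact zero_mem _

/-- The kernel of a degree preserving projection of the positive part to its decomposable elements is a
generating subspace. -/
theorem exists_isGenerating (A : PoincareDGCA.{u, v} F n) : ∃ W, A.IsGenerating W := by
  obtain ⟨q, hq⟩ := (A.cohPos * A.cohPos).subtype.exists_leftInverse_of_injective
    (Submodule.ker_subtype _)
  let π : A.Coh →ₗ[F] A.Coh := DGCA.gradedMap (X := A.cohomology) fun k =>
    A.cohProj k ∘ₗ (A.cohPos * A.cohPos).subtype ∘ₗ q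
  have hπ_mem : ∀ x, π x ∈ A.cohPos * A.cohPos := by
    intro x
    induction x using A.cohomology.hom_induction with
    | h0 => rw [map_zero]; exact zero_mem _
    | hh k x hx =>
      rw [DGCA.gradedMap_of_mem (X := A.cohomology) _ hx]
      exact cohProj_mem_cohPos_mul (q x).2 k
    | hadd x y hx hy => rw [map_add]; exact add_mem hx hy
  have hπ_deg : ∀ {k : ℕ} {x : A.Coh}, x ∈ A.cohGrading k → π x ∈ A.cohGrading k := by
    intro k x hx
    rw [DGCA.gradedMap_of_mem (X := A.cohomology) _ hx]
    exact DGCA.cohProj_mem _ _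
  have hπ_id : ∀ x ∈ A.cohPos * A.cohPos, π x = x := by
    intro x hx
    obtain ⟨s, hs⟩ := A.cohomology.eq_sum_proj x
    have h1 : ∀ k, π (A.cohomology.proj k x) = A.cohomology.proj k x := by
      intro k
      have hk := cohProj_mem_cohPos_mul hx k
      rw [← A.cohomology_proj] at hk
      rw [DGCA.gradedMap_of_mem (X := A.cohomology) _ (A.cohomology.proj_mem k x)]
      have h2 : q (A.cohomology.proj k x) = ⟨_, hk⟩ := LinearMap.congr_fun hq ⟨_, hk⟩
      change A.cohProj k (q (A.cohomology.proj k x) : A.Coh) = _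
      rw [h2]
      exact A.cohProj_of_mem (A.cohomology.proj_mem k x)
    conv_lhs => rw [hs]
    conv_rhs => rw [hs]
    rw [map_sum]
    exact Finset.sum_congr rfl fun k _ => h1 k
  refine ⟨A.cohPos ⊓ LinearMap.ker π, ?_, ?_, ?_⟩
  · rintro k x ⟨hx, hx'⟩
    refine ⟨?_, ?_⟩
    · rw [A.cohomology_proj]
      exact cohProj_mem_cohPos hx k
    · change π _ = 0
      rw [← DGCA.map_proj_of_map_mem (X := A.cohomology) (Y := A.cohomology) π hπ_deg]
      rw [show π x = 0 from hx', map_zero]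
  · rw [Submodule.disjoint_def]
    rintro x ⟨_, hx⟩ hx'
    rw [← hπ_id x hx']
    exact hx
  · apply le_antisymm
    · exact sup_le inf_le_left cohPos_mul_le
    · intro x hx
      rw [← sub_add_cancel x (π x)]
      refine Submodule.add_mem_sup ⟨sub_mem hx (cohPos_mul_le (hπ_mem x)), ?_⟩ (hπ_mem x)
      change π _ = 0
      rw [map_sub, hπ_id _ (hπ_mem x), sub_self]

theorem IsGenerating.adjoin_eq_top {W : Submodule F A.Coh} (hW : A.IsGenerating W) {m : ℕ}
    (hA : A.IsConnected m) : Algebra.adjoin F (W : Set A.Coh) = ⊤ := by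
  set S := Algebra.adjoin F (W : Set A.Coh)
  have hWS : ∀ x ∈ W, x ∈ S := fun x hx => Algebra.subset_adjoin hx
  have key : ∀ (k : ℕ) (x : A.Coh), x ∈ A.cohGrading k → x ∈ S := by
    intro k
    induction k using Nat.strong_induction_on with
    | _ k ih =>
      intro x hx
      rcases Nat.eq_zero_or_pos k with rfl | hk
      · obtain ⟨c, rfl⟩ := hA.exists_smul_one hx
        exact S.smul_mem S.one_mem c
      · have h1 : x ∈ W ⊔ A.cohPos * A.cohPos := by
          rw [hW.sup_eq]
          exact mem_cohPos hk hx
        obtain ⟨w, hw, y, hy, rfl⟩ := Submodule.mem_sup.1 h1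
        rw [← A.cohProj_of_mem hx, map_add]
        refine S.add_mem ?_ ?_
        · rw [← A.cohomology_proj]
          exact hWS _ (hW.isGraded k w hw)
        · clear h1 hx
          induction hy using Submodule.mul_induction_on' with
          | mem_mul_mem u hu v hv =>
            refine cohProj_mul_mem (Subalgebra.toSubmodule S) k u v fun i j hij => ?_
            rcases Nat.eq_zero_or_pos i with rfl | hi
            · rw [mem_cohPos_iff.1 hu, zero_mul]; exact zero_mem _
            rcases Nat.eq_zero_or_pos j with rfl | hj
            · rw [mem_cohPos_iff.1 hv, mul_zero]; exact zero_mem _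
            exact S.mul_mem (ih i (by omega) _ (DGCA.cohProj_mem i u))
              (ih j (by omega) _ (DGCA.cohProj_mem j v))
          | add u _ v _ hu hv => rw [map_add]; exact S.add_mem hu hv
  rw [eq_top_iff]
  intro x _
  obtain ⟨s, hs⟩ := A.cohomology.eq_sum_proj x
  rw [hs]
  exact S.sum_mem fun k _ => key k _ (A.cohomology.proj_mem k x)

/-- A partial splitting on a generating subspace extends to a splitting with values in the generated
subalgebra `C`, since every class has a representative in `C`. -/
theorem exists_isAdapted {m : ℕ} (hA : A.IsConnected m) :
    ∃ ι : A.Coh →ₗ[F] A.carrier, A.IsSplitting ι ∧ A.IsAdapted ι := by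
  obtain ⟨W, hW⟩ := exists_isGenerating A
  obtain ⟨j, hj, hj'⟩ := A.exists_splitting
  let ι₀ : W →ₗ[F] A.carrier := j ∘ₗ W.subtype
  have hι₀ : A.IsPartialSplitting W ι₀ := ⟨fun k x hx => hj k x hx, fun x => hj' x⟩
  set C := Algebra.adjoin F (Set.range ι₀)
  have hιC : ∀ w, ι₀ w ∈ C := fun w => Algebra.subset_adjoin ⟨w, rfl⟩
  have hC_graded : ∀ c ∈ C, ∀ k, A.proj k c ∈ C := by
    intro c hc
    induction hc using Algebra.adjoin_induction with
    | mem _ h =>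
      obtain ⟨w, rfl⟩ := h
      intro k
      have h1 : A.proj k (ι₀ w) = ι₀ ⟨A.cohomology.proj k w, hW.isGraded k w w.2⟩ :=
        DGCA.map_proj_of_map_mem (X := A.cohomology) j (fun h => hj _ _ h) k w
      rw [h1]
      exact hιC _
    | algebraMap r =>
      intro k
      rw [Algebra.algebraMap_eq_smul_one, map_smul]
      refine C.smul_mem ?_ r
      rcases Nat.eq_zero_or_pos k with rfl | hk
      · rw [A.proj_of_mem A.one_mem]; exact C.one_mem
      · rw [A.proj_of_mem_ne A.one_mem (by omega)]; exact C.zero_mem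
    | add a b _ _ ha hb =>
      intro k
      rw [map_add]
      exact C.add_mem (ha k) (hb k)
    | mul a b _ _ ha hb =>
      intro k
      exact A.proj_mul_mem (Subalgebra.toSubmodule C) k a b fun i j _ => C.mul_mem (ha i) (hb j)
  have hC_rep : ∀ x : A.Coh, ∃ c ∈ C, A.Represents c x := by
    intro x
    have hx : x ∈ Algebra.adjoin F (W : Set A.Coh) := by
      rw [hW.adjoin_eq_top hA]; trivial
    induction hx using Algebra.adjoin_induction with
    | mem w hw => exact ⟨ι₀ ⟨w, hw⟩, hιC _, hj' w⟩
    | algebraMap r => exact ⟨_, C.algebraMap_mem r, A.represents_algebraMap r⟩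
    | add x y _ _ hx hy =>
      obtain ⟨a, ha, ha'⟩ := hx
      obtain ⟨b, hb, hb'⟩ := hy
      exact ⟨_, C.add_mem ha hb, ha'.add hb'⟩
    | mul x y _ _ hx hy =>
      obtain ⟨a, ha, ha'⟩ := hx
      obtain ⟨b, hb, hb'⟩ := hy
      exact ⟨_, C.mul_mem ha hb, ha'.mul hb'⟩
  let Z : Submodule F A.cocycles := (Subalgebra.toSubmodule C).comap A.cocycles.val.toLinearMap
  obtain ⟨τ, hτ⟩ := DGCA.exists_section (A.cls.toLinearMap ∘ₗ Z.subtype) (by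
    intro x
    obtain ⟨c, hc, z, rfl, hz⟩ := hC_rep x
    exact ⟨⟨z, hc⟩, hz⟩)
  obtain ⟨q, hq⟩ := W.subtype.exists_leftInverse_of_injective (Submodule.ker_subtype _)
  let τ' : A.Coh →ₗ[F] A.carrier := A.cocycles.val.toLinearMap ∘ₗ Z.subtype ∘ₗ τ
  have hτ_mem : ∀ x, τ' x ∈ C := fun x => (τ x).2
  have hτ_rep : ∀ x, A.Represents (τ' x) x := fun x => ⟨τ x, rfl, hτ x⟩
  -- `ψ` is equal to `ι₀` on the generating subspace, and to a choice of representatives in `C` on a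
  -- complement. It is made degree preserving by `gradedMap` afterwards.
  let ψ : A.Coh →ₗ[F] A.carrier := ι₀ ∘ₗ q + τ' ∘ₗ (LinearMap.id - W.subtype ∘ₗ q)
  have hψ : ∀ x, ψ x = ι₀ (q x) + τ' (x - q x) := fun x => rfl
  have hψ_mem : ∀ x, ψ x ∈ C := fun x => C.add_mem (hιC _) (hτ_mem _)
  have hψ_rep : ∀ x, A.Represents (ψ x) x := by
    intro x
    have := DGCA.Represents.add (hj' (q x)) (hτ_rep (x - q x))
    rwa [add_sub_cancel] at this
  have hψ_W : ∀ w : W, ψ w = ι₀ w := by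
    intro w
    have : q w = w := LinearMap.congr_fun hq w
    rw [hψ, this, sub_self, map_zero, add_zero]
  let ι : A.Coh →ₗ[F] A.carrier := DGCA.gradedMap (X := A.cohomology) fun k => A.proj k ∘ₗ ψ
  have hι : ∀ {k : ℕ} {x : A.Coh}, x ∈ A.cohGrading k → ι x = A.proj k (ψ x) :=
    fun hx => DGCA.gradedMap_of_mem (X := A.cohomology) _ hx
  refine ⟨ι, ⟨fun k x hx => ?_, fun x => ?_⟩, W, ι₀, hW, hι₀, fun w => ?_, fun x => ?_⟩
  · rw [hι hx]
    exact A.proj_mem k _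
  · change A.Represents (ι x) x
    induction x using A.cohomology.hom_induction with
    | h0 => rw [map_zero]; exact DGCA.represents_zero
    | hh k x hx =>
      rw [hι hx]
      have := (hψ_rep x).proj k
      rwa [A.cohProj_of_mem hx] at this
    | hadd x y hx hy => rw [map_add]; exact hx.add hy
  · obtain ⟨s, hs⟩ := A.cohomology.eq_sum_proj (w : A.Coh)
    have h1 : ∀ k, ι (A.cohomology.proj k w) = j (A.cohomology.proj k w) := by
      intro k
      have hk := A.cohomology.proj_mem k (w : A.Coh)
      rw [hι hk, hψ_W ⟨_, hW.isGraded k w w.2⟩]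
      exact A.proj_of_mem (hj k _ hk)
    change ι w = j w
    rw [hs, map_sum, map_sum]
    exact Finset.sum_congr rfl fun k _ => h1 k
  · induction x using A.cohomology.hom_induction with
    | h0 => rw [map_zero]; exact C.zero_mem
    | hh k x hx =>
      rw [hι hx]
      exact hC_graded _ (hψ_mem x) k
    | hadd x y hx hy => rw [map_add]; exact C.add_mem hx hy

theorem nonempty_adaptedChoice [CharZero F] {m : ℕ} (hA : A.IsConnected m) (h : A.IsHodgeType) :
    Nonempty A.AdaptedChoice := by
  obtain ⟨h⟩ := h
  obtain ⟨ι, hι, hι'⟩ := exists_isAdapted hA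
  obtain ⟨h', hh'⟩ := h.exists_of_isSplitting hι
  exact ⟨⟨ι, hι, hι', h', hh'⟩⟩

end Adapted

end PoincareDGCA

/-! ### Non-unital graded commutative algebras on complexes, and adjoining a unit -/

/-- A cochain complex, given by the projections to its homogeneous components, of which there are
only finitely many. -/
structure BoundedComplex (F : Type u) [Field F] where
  carrier : Type v
  [addCommGroup : AddCommGroup carrier]
  [module : Module F carrier]
  proj : ℕ → carrier →ₗ[F] carrier
  bound : ℕ
  proj_proj : ∀ k a, proj k (proj k a) = proj k a
  proj_proj_ne : ∀ {k l : ℕ}, k ≠ l → ∀ a, proj l (proj k a) = 0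
  sum_proj : ∀ a, ∑ k ∈ Finset.range bound, proj k a = a
  d : carrier →ₗ[F] carrier
  proj_succ_d : ∀ k a, proj (k + 1) (d a) = d (proj k a)
  proj_zero_d : ∀ a, proj 0 (d a) = 0
  d_d : ∀ a, d (d a) = 0

namespace BoundedComplex

attribute [instance] BoundedComplex.addCommGroup BoundedComplex.module

variable {F : Type u} [Field F] (E : BoundedComplex.{u, v} F)

/-- The homogeneous component of degree `k`. -/
def gr (k : ℕ) : Submodule F E.carrier := LinearMap.eqLocus (E.proj k) LinearMap.id

variable {E}

theorem mem_gr {k : ℕ} {a : E.carrier} : a ∈ E.gr k ↔ E.proj k a = a := Iff.rfl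

theorem proj_mem (k : ℕ) (a : E.carrier) : E.proj k a ∈ E.gr k := E.proj_proj k a

theorem proj_of_mem_ne {k l : ℕ} {a : E.carrier} (ha : a ∈ E.gr k) (h : k ≠ l) :
    E.proj l a = 0 := by
  rw [← mem_gr.1 ha, E.proj_proj_ne h]

theorem d_mem {k : ℕ} {a : E.carrier} (ha : a ∈ E.gr k) : E.d a ∈ E.gr (k + 1) := by
  rw [mem_gr, E.proj_succ_d, mem_gr.1 ha]

theorem hom_induction {p : E.carrier → Prop} (h0 : p 0)
    (hh : ∀ (k : ℕ) (a : E.carrier), a ∈ E.gr k → p a)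
    (hadd : ∀ a b, p a → p b → p (a + b)) (a : E.carrier) : p a := by
  rw [← E.sum_proj a]
  exact Finset.sum_induction _ p hadd h0 fun k _ => hh k _ (proj_mem k a)

variable (E)

/-- The operator which multiplies elements of degree `k` by `(-1) ^ k`. -/
noncomputable def sign : E.carrier →ₗ[F] E.carrier :=
  ∑ k ∈ Finset.range E.bound, (-1 : F) ^ k • E.proj k

variable {E}

theorem sign_of_mem {k : ℕ} {a : E.carrier} (ha : a ∈ E.gr k) : E.sign a = (-1 : F) ^ k • a := by
  have h1 := E.sum_proj a
  rw [sign, LinearMap.sum_apply]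
  conv_rhs => rw [← h1, Finset.smul_sum]
  refine Finset.sum_congr rfl fun l _ => ?_
  by_cases h : k = l
  · rw [h, LinearMap.smul_apply]
  · rw [LinearMap.smul_apply, proj_of_mem_ne ha h, smul_zero, smul_zero]

theorem sign_sign (a : E.carrier) : E.sign (E.sign a) = a := by
  induction a using hom_induction with
  | h0 => simp
  | hh k a ha => simp [sign_of_mem ha, smul_smul, ← pow_add, ← two_mul]
  | hadd a b ha hb => simp only [map_add, ha, hb]

theorem sign_d (a : E.carrier) : E.sign (E.d a) = -E.d (E.sign a) := by
  induction a using hom_induction with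
  | h0 => simp
  | hh k a ha => simp [sign_of_mem ha, sign_of_mem (d_mem ha), pow_succ]
  | hadd a b ha hb => simp only [map_add, ha, hb, neg_add]

theorem sign_mul {β : E.carrier →ₗ[F] E.carrier →ₗ[F] E.carrier}
    (hβ : ∀ {i j : ℕ} {a b : E.carrier}, a ∈ E.gr i → b ∈ E.gr j → β a b ∈ E.gr (i + j))
    (a b : E.carrier) : E.sign (β a b) = β (E.sign a) (E.sign b) := by
  induction a using hom_induction with
  | h0 => simp
  | hh i a ha =>
    induction b using hom_induction with
    | h0 => simp
    | hh j b hb =>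
      rw [sign_of_mem ha, sign_of_mem hb, sign_of_mem (hβ ha hb)]
      simp [pow_add, smul_smul, mul_comm]
    | hadd b b' hb hb' => simp only [map_add, hb, hb']
  | hadd a a' ha ha' => simp only [map_add, LinearMap.add_apply, ha, ha']

variable (E)

/-- The projections for the grading which is shifted by one. -/
def shiftProj (k : ℕ) : E.carrier →ₗ[F] E.carrier :=
  match k with
  | 0 => 0
  | k + 1 => E.proj k

/-- The homogeneous component of degree `k - 1`, which vanishes for `k = 0`. -/
def shiftGr (k : ℕ) : Submodule F E.carrier := LinearMap.eqLocus (E.shiftProj k) LinearMap.id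

variable {E}

theorem mem_shiftGr {k : ℕ} {a : E.carrier} : a ∈ E.shiftGr k ↔ E.shiftProj k a = a := Iff.rfl

theorem mem_shiftGr_succ {k : ℕ} {a : E.carrier} : a ∈ E.shiftGr (k + 1) ↔ a ∈ E.gr k := Iff.rfl

theorem mem_shiftGr_zero {a : E.carrier} : a ∈ E.shiftGr 0 ↔ a = 0 :=
  ⟨fun h => (mem_shiftGr.1 h).symm, by rintro rfl; exact zero_mem _⟩

theorem sum_shiftProj (a : E.carrier) : ∑ k ∈ Finset.range (E.bound + 1), E.shiftProj k a = a := by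
  rw [Finset.sum_range_succ']
  simp [shiftProj, E.sum_proj]

variable (E)

/-- A graded commutative and associative product on a complex for which the differential is a
derivation. -/
structure CommProduct where
  mul : E.carrier →ₗ[F] E.carrier →ₗ[F] E.carrier
  mul_mem : ∀ {i j : ℕ} {a b : E.carrier}, a ∈ E.gr i → b ∈ E.gr j → mul a b ∈ E.gr (i + j)
  assoc : ∀ a b c, mul (mul a b) c = mul a (mul b c)
  comm : ∀ {i j : ℕ} {a b : E.carrier}, a ∈ E.gr i → b ∈ E.gr j →
    mul a b = (-1 : F) ^ (i * j) • mul b a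
  leibniz : ∀ {k : ℕ} {a : E.carrier}, a ∈ E.gr k → ∀ b,
    E.d (mul a b) = mul (E.d a) b + (-1 : F) ^ k • mul a (E.d b)

variable {E}

/-- The underlying module of the algebra obtained from a non-unital algebra by adjoining a unit. -/
def CommProduct.Unital (_P : CommProduct E) : Type _ := F × E.carrier

namespace CommProduct

variable (P : CommProduct E)

instance : AddCommGroup P.Unital := inferInstanceAs (AddCommGroup (F × E.carrier))
instance : Module F P.Unital := inferInstanceAs (Module F (F × E.carrier))

instance : Ring P.Unital :=
  { (inferInstance : AddCommGroup P.Unital) with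
    mul := fun x y => (x.1 * y.1, x.1 • y.2 + y.1 • x.2 + P.mul x.2 y.2)
    one := ((1 : F), (0 : E.carrier))
    left_distrib := fun x y z => Prod.ext (mul_add x.1 y.1 z.1) (by
      change x.1 • (y.2 + z.2) + (y.1 + z.1) • x.2 + P.mul x.2 (y.2 + z.2) =
        (x.1 • y.2 + y.1 • x.2 + P.mul x.2 y.2) + (x.1 • z.2 + z.1 • x.2 + P.mul x.2 z.2)
      simp only [smul_add, add_smul, map_add]
      abel)
    right_distrib := fun x y z => Prod.ext (add_mul x.1 y.1 z.1) (by
      change (x.1 + y.1) • z.2 + z.1 • (x.2 + y.2) + P.mul (x.2 + y.2) z.2 =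
        (x.1 • z.2 + z.1 • x.2 + P.mul x.2 z.2) + (y.1 • z.2 + z.1 • y.2 + P.mul y.2 z.2)
      simp only [smul_add, add_smul, map_add, LinearMap.add_apply]
      abel)
    zero_mul := fun x => Prod.ext (zero_mul x.1) (by
      change (0 : F) • x.2 + x.1 • (0 : E.carrier) + P.mul 0 x.2 = 0
      simp)
    mul_zero := fun x => Prod.ext (mul_zero x.1) (by
      change x.1 • (0 : E.carrier) + (0 : F) • x.2 + P.mul x.2 0 = 0
      simp)
    mul_assoc := fun x y z => Prod.ext (mul_assoc x.1 y.1 z.1) (by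
      change (x.1 * y.1) • z.2 + z.1 • (x.1 • y.2 + y.1 • x.2 + P.mul x.2 y.2) +
          P.mul (x.1 • y.2 + y.1 • x.2 + P.mul x.2 y.2) z.2 =
        x.1 • (y.1 • z.2 + z.1 • y.2 + P.mul y.2 z.2) + (y.1 * z.1) • x.2 +
          P.mul x.2 (y.1 • z.2 + z.1 • y.2 + P.mul y.2 z.2)
      simp only [smul_add, map_add, LinearMap.add_apply, map_smul, LinearMap.smul_apply, smul_smul,
        P.assoc, mul_comm z.1]
      abel)
    one_mul := fun x => Prod.ext (one_mul x.1) (by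
      change (1 : F) • x.2 + x.1 • (0 : E.carrier) + P.mul 0 x.2 = x.2
      simp)
    mul_one := fun x => Prod.ext (mul_one x.1) (by
      change x.1 • (0 : E.carrier) + (1 : F) • x.2 + P.mul x.2 0 = x.2
      simp) }

instance : Algebra F P.Unital := Algebra.ofModule
  (fun r x y => Prod.ext (mul_assoc r x.1 y.1) (by
    change (r * x.1) • y.2 + y.1 • (r • x.2) + P.mul (r • x.2) y.2 =
      r • (x.1 • y.2 + y.1 • x.2 + P.mul x.2 y.2)
    simp only [smul_add, map_smul, LinearMap.smul_apply, smul_smul, mul_comm r]))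
  (fun r x y => Prod.ext (mul_left_comm x.1 r y.1) (by
    change x.1 • (r • y.2) + (r * y.1) • x.2 + P.mul x.2 (r • y.2) =
      r • (x.1 • y.2 + y.1 • x.2 + P.mul x.2 y.2)
    simp only [smul_add, map_smul, smul_smul, mul_comm r]))

/-- The grading of the algebra with adjoined unit; the unit has degree zero. -/
def unitalGr (k : ℕ) : Submodule F P.Unital where
  carrier := {x | (k ≠ 0 → x.1 = 0) ∧ x.2 ∈ E.gr k}
  add_mem' := by
    rintro x y ⟨h1, h2⟩ ⟨h3, h4⟩
    refine ⟨fun h => ?_, add_mem h2 h4⟩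
    change x.1 + y.1 = 0
    rw [h1 h, h3 h, add_zero]
  zero_mem' := ⟨fun _ => rfl, zero_mem _⟩
  smul_mem' := by
    rintro r x ⟨h1, h2⟩
    refine ⟨fun h => ?_, Submodule.smul_mem _ r h2⟩
    change r * x.1 = 0
    rw [h1 h, mul_zero]

/-- The projections of the algebra with adjoined unit to its homogeneous components. -/
def unitalProj (k : ℕ) : P.Unital →ₗ[F] P.Unital :=
  LinearMap.prodMap (if k = 0 then LinearMap.id else 0) (E.proj k)

theorem unitalProj_of_mem {k : ℕ} {x : P.Unital} (hx : x ∈ P.unitalGr k) :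
    P.unitalProj k x = x := by
  refine Prod.ext ?_ hx.2
  change (if k = 0 then LinearMap.id else 0 : F →ₗ[F] F) x.1 = x.1
  split_ifs with h
  · rfl
  · rw [hx.1 h, map_zero]

theorem unitalProj_of_mem_ne {k l : ℕ} {x : P.Unital} (hx : x ∈ P.unitalGr k) (hkl : k ≠ l) :
    P.unitalProj l x = 0 := by
  refine Prod.ext ?_ (proj_of_mem_ne hx.2 hkl)
  change (if l = 0 then LinearMap.id else 0 : F →ₗ[F] F) x.1 = 0
  split_ifs with h
  · exact hx.1 (by omega)
  · rfl

theorem unitalProj_mem (k : ℕ) (x : P.Unital) : P.unitalProj k x ∈ P.unitalGr k := by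
  refine ⟨fun h => ?_, proj_mem k _⟩
  change (if k = 0 then LinearMap.id else 0 : F →ₗ[F] F) x.1 = 0
  rw [if_neg h]
  rfl

theorem sum_unitalProj (x : P.Unital) :
    ∑ k ∈ Finset.range (E.bound + 1), P.unitalProj k x = x := by
  have h1 : ∀ s : Finset ℕ, (∑ k ∈ s, P.unitalProj k x).1 = ∑ k ∈ s, (P.unitalProj k x).1 :=
    fun s => Prod.fst_sum
  have h2 : ∀ s : Finset ℕ, (∑ k ∈ s, P.unitalProj k x).2 = ∑ k ∈ s, (P.unitalProj k x).2 :=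
    fun s => Prod.snd_sum
  refine Prod.ext ?_ ?_
  · rw [h1, Finset.sum_eq_single_of_mem 0 (by simp)]
    · rfl
    · intro k _ hk
      exact (P.unitalProj_mem k x).1 hk
  · rw [h2, Finset.sum_range_succ]
    change ∑ k ∈ Finset.range E.bound, E.proj k x.2 + E.proj E.bound x.2 = x.2
    have h3 : E.proj E.bound x.2 = 0 := by
      conv_lhs => rw [← E.sum_proj x.2, map_sum]
      exact Finset.sum_eq_zero fun k hk =>
        E.proj_proj_ne (by have := Finset.mem_range.1 hk; omega) _
    rw [E.sum_proj, h3, add_zero]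

theorem unitalGr_isInternal : DirectSum.IsInternal P.unitalGr := by
  classical
  rw [DirectSum.isInternal_submodule_iff_iSupIndep_and_iSup_eq_top]
  constructor
  · intro k
    rw [Submodule.disjoint_def]
    intro x hx hx'
    have h : (⨆ j, ⨆ (_ : j ≠ k), P.unitalGr j) ≤ LinearMap.ker (P.unitalProj k) :=
      iSup₂_le fun j hj y hy => P.unitalProj_of_mem_ne hy hj
    rw [← P.unitalProj_of_mem hx]
    exact h hx'
  · rw [eq_top_iff]
    intro x _
    rw [← P.sum_unitalProj x]
    exact sum_mem fun k _ => Submodule.mem_iSup_of_mem k (P.unitalProj_mem k x)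

noncomputable instance : GradedAlgebra P.unitalGr where
  toDecomposition := P.unitalGr_isInternal.chooseDecomposition
  one_mem := ⟨fun h => absurd rfl h, zero_mem _⟩
  mul_mem := by
    rintro i j x y ⟨h1, h2⟩ ⟨h3, h4⟩
    refine ⟨fun h => ?_, ?_⟩
    · change x.1 * y.1 = 0
      rcases Nat.eq_zero_or_pos i with rfl | hi
      · rw [h3 (by omega), mul_zero]
      · rw [h1 (by omega), zero_mul]
    · change x.1 • y.2 + y.1 • x.2 + P.mul x.2 y.2 ∈ E.gr (i + j)
      refine add_mem (add_mem ?_ ?_) (P.mul_mem h2 h4)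
      · rcases Nat.eq_zero_or_pos i with rfl | hi
        · rw [zero_add]; exact Submodule.smul_mem _ _ h4
        · rw [h1 (by omega), zero_smul]; exact zero_mem _
      · rcases Nat.eq_zero_or_pos j with rfl | hj
        · exact Submodule.smul_mem _ _ h2
        · rw [h3 (by omega), zero_smul]; exact zero_mem _

/-- The DGCA obtained by adjoining a unit. -/
noncomputable def toDGCA : DGCA.{u, max u v} F where
  carrier := P.Unital
  grading := P.unitalGr
  d := LinearMap.inr F F E.carrier ∘ₗ E.d ∘ₗ LinearMap.snd F F E.carrier
  d_mem hx := ⟨fun _ => rfl, d_mem hx.2⟩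
  d_d x := Prod.ext rfl (E.d_d x.2)
  leibniz := by
    rintro k x ⟨h1, h2⟩ y
    refine Prod.ext ?_ ?_
    · change (0 : F) = 0 * y.1 + (-1 : F) ^ k * (x.1 * 0)
      ring
    · change E.d (x.1 • y.2 + y.1 • x.2 + P.mul x.2 y.2) =
        ((0 : F) • y.2 + y.1 • E.d x.2 + P.mul (E.d x.2) y.2) +
          (-1 : F) ^ k • (x.1 • E.d y.2 + (0 : F) • x.2 + P.mul x.2 (E.d y.2))
      have h3 : (-1 : F) ^ k • x.1 • E.d y.2 = x.1 • E.d y.2 := by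
        rcases Nat.eq_zero_or_pos k with rfl | hk
        · simp
        · rw [h1 (by omega)]; simp
      simp only [map_add, map_smul, P.leibniz h2, zero_smul, smul_add, h3, add_zero,
        zero_add]
      abel
  graded_comm := by
    rintro i j x y ⟨h1, h2⟩ ⟨h3, h4⟩
    have e : ∀ c : F, ∀ v : E.carrier, c = 0 ∨ i * j = 0 → (-1 : F) ^ (i * j) • c • v = c • v := by
      rintro c v (rfl | h)
      · simp
      · simp [h]
    have hx : x.1 = 0 ∨ i * j = 0 := by
      rcases Nat.eq_zero_or_pos i with rfl | hi
      · simp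
      · exact Or.inl (h1 (by omega))
    have hy : y.1 = 0 ∨ i * j = 0 := by
      rcases Nat.eq_zero_or_pos j with rfl | hj
      · simp
      · exact Or.inl (h3 (by omega))
    refine Prod.ext ?_ ?_
    · change x.1 * y.1 = (-1 : F) ^ (i * j) * (y.1 * x.1)
      rcases hx with h | h
      · simp [h]
      · simp [h, mul_comm]
    · change x.1 • y.2 + y.1 • x.2 + P.mul x.2 y.2 =
        (-1 : F) ^ (i * j) • (y.1 • x.2 + x.1 • y.2 + P.mul y.2 x.2)
      rw [smul_add, smul_add, e _ _ hx, e _ _ hy, P.comm h2 h4]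
      abel

/-- A multiplicative chain map of degree zero to a DGCA extends to the algebra with adjoined unit. -/
noncomputable def lift {X : DGCA.{u, max u v} F} (f : E.carrier →ₗ[F] X.carrier)
    (hmul : ∀ a b, f (P.mul a b) = f a * f b)
    (hgr : ∀ {k : ℕ} {a : E.carrier}, a ∈ E.gr k → f a ∈ X.grading k)
    (hd : ∀ a, f (E.d a) = X.d (f a)) : DGCA.Hom P.toDGCA X where
  toAlgHom := AlgHom.ofLinearMap
    ((LinearMap.toSpanSingleton F X.carrier 1).coprod f : F × E.carrier →ₗ[F] X.carrier)
    (by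
      change (1 : F) • (1 : X.carrier) + f 0 = 1
      simp)
    (fun x y => by
      change (x.1 * y.1) • (1 : X.carrier) + f (x.1 • y.2 + y.1 • x.2 + P.mul x.2 y.2) =
        (x.1 • (1 : X.carrier) + f x.2) * (y.1 • (1 : X.carrier) + f y.2)
      simp only [map_add, map_smul, hmul, add_mul, mul_add, smul_mul_assoc, mul_smul_comm, one_mul,
        mul_one, smul_add, smul_smul, mul_comm y.1]
      abel)
  map_grading := by
    rintro k x ⟨h1, h2⟩
    change x.1 • (1 : X.carrier) + f x.2 ∈ X.grading k
    refine add_mem ?_ (hgr h2)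
    rcases Nat.eq_zero_or_pos k with rfl | hk
    · exact Submodule.smul_mem _ _ X.one_mem
    · rw [h1 (by omega), zero_smul]; exact zero_mem _
  map_d x := by
    change (0 : F) • (1 : X.carrier) + f (E.d x.2) = X.d (x.1 • (1 : X.carrier) + f x.2)
    rw [zero_smul, zero_add, hd, map_add, map_smul, X.d_one, smul_zero, zero_add]

end CommProduct

end BoundedComplex

/-! ### Polynomials with coefficients in a module and polynomial forms on the line -/

namespace PolyCoeff

variable {F : Type u} [Field F] {N : Type v} [AddCommGroup N] [Module F N]

/-- The coefficientwise application of a linear map to polynomials with coefficients in a module. -/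
noncomputable def map (T : N →ₗ[F] N) : (ℕ →₀ N) →ₗ[F] (ℕ →₀ N) := Finsupp.mapRange.linearMap T

theorem map_single (T : N →ₗ[F] N) (i : ℕ) (a : N) :
    map T (Finsupp.single i a) = Finsupp.single i (T a) := by
  simp [map]

theorem map_apply (T : N →ₗ[F] N) (f : ℕ →₀ N) (i : ℕ) : map T f i = T (f i) := by
  simp [map]

/-- The extension of a bilinear map to polynomials. -/
noncomputable def bilin (β : N →ₗ[F] N →ₗ[F] N) : (ℕ →₀ N) →ₗ[F] (ℕ →₀ N) →ₗ[F] (ℕ →₀ N) :=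
  Finsupp.lsum F fun i => LinearMap.flip (Finsupp.lsum F fun j =>
    LinearMap.flip (β.compr₂ (Finsupp.lsingle (i + j))))

theorem bilin_single (β : N →ₗ[F] N →ₗ[F] N) (i j : ℕ) (a b : N) :
    bilin β (Finsupp.single i a) (Finsupp.single j b) = Finsupp.single (i + j) (β a b) := by
  simp [bilin, LinearMap.flip_apply]

/-- Multiplication by the variable. -/
noncomputable def shift : (ℕ →₀ N) →ₗ[F] (ℕ →₀ N) :=
  Finsupp.lsum F fun i => Finsupp.lsingle (i + 1)

theorem shift_single (i : ℕ) (a : N) :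
    shift (F := F) (Finsupp.single i a) = Finsupp.single (i + 1) a := by
  simp [shift]

/-- The derivative of a polynomial. -/
noncomputable def deriv : (ℕ →₀ N) →ₗ[F] (ℕ →₀ N) :=
  Finsupp.lsum F fun i => (i : F) • Finsupp.lsingle (i - 1)

theorem deriv_single (i : ℕ) (a : N) :
    deriv (F := F) (Finsupp.single i a) = Finsupp.single (i - 1) ((i : F) • a) := by
  simp [deriv]

/-- The primitive of a polynomial with constant coefficient zero. -/
noncomputable def primitive : (ℕ →₀ N) →ₗ[F] (ℕ →₀ N) :=
  Finsupp.lsum F fun i => ((i : F) + 1)⁻¹ • Finsupp.lsingle (i + 1)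

theorem primitive_single (i : ℕ) (a : N) :
    primitive (F := F) (Finsupp.single i a) = Finsupp.single (i + 1) (((i : F) + 1)⁻¹ • a) := by
  simp [primitive]

/-- The value of a polynomial at `c`. -/
noncomputable def eval (c : F) : (ℕ →₀ N) →ₗ[F] N := Finsupp.lsum F fun i => c ^ i • LinearMap.id

theorem eval_single (c : F) (i : ℕ) (a : N) :
    eval c (Finsupp.single i a) = c ^ i • a := by
  simp [eval]

@[elab_as_elim]
theorem induction {p : (ℕ →₀ N) → Prop} (f : ℕ →₀ N) (h0 : p 0)
    (hadd : ∀ f g, p f → p g → p (f + g)) (hs : ∀ i a, p (Finsupp.single i a)) : p f :=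
  Finsupp.induction_linear f h0 hadd hs

theorem linear_ext {M : Type*} [AddCommGroup M] [Module F M] {S T : (ℕ →₀ N) →ₗ[F] M}
    (h : ∀ i a, S (Finsupp.single i a) = T (Finsupp.single i a)) (f : ℕ →₀ N) : S f = T f := by
  induction f using induction with
  | h0 => simp
  | hadd f g hf hg => rw [map_add, map_add, hf, hg]
  | hs i a => exact h i a

theorem bilin_ext {M : Type*} [AddCommGroup M] [Module F M]
    {S T : (ℕ →₀ N) →ₗ[F] (ℕ →₀ N) →ₗ[F] M}
    (h : ∀ i a j b, S (Finsupp.single i a) (Finsupp.single j b) =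
      T (Finsupp.single i a) (Finsupp.single j b)) (f g : ℕ →₀ N) : S f g = T f g := by
  induction f using induction with
  | h0 => simp
  | hadd f g hf hg => rw [map_add, map_add, LinearMap.add_apply, LinearMap.add_apply, hf, hg]
  | hs i a => exact linear_ext (h i a) g

theorem map_bilin (T : N →ₗ[F] N) (β : N →ₗ[F] N →ₗ[F] N) (f g : ℕ →₀ N) :
    map T (bilin β f g) = bilin (β.compr₂ T) f g :=
  bilin_ext (S := (bilin β).compr₂ (map T)) (T := bilin (β.compr₂ T)) (by
    intro i a j b
    simp [bilin_single, map_single]) f g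

theorem bilin_map (S T : N →ₗ[F] N) (β : N →ₗ[F] N →ₗ[F] N) (f g : ℕ →₀ N) :
    bilin β (map S f) (map T g) = bilin (β.compl₁₂ S T) f g :=
  bilin_ext (S := (bilin β).compl₁₂ (map S) (map T)) (T := bilin (β.compl₁₂ S T)) (by
    intro i a j b
    simp [bilin_single, map_single]) f g

theorem bilin_add (β γ : N →ₗ[F] N →ₗ[F] N) (f g : ℕ →₀ N) :
    bilin (β + γ) f g = bilin β f g + bilin γ f g :=
  bilin_ext (S := bilin (β + γ)) (T := bilin β + bilin γ) (by
    intro i a j b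
    simp [bilin_single]) f g

theorem bilin_smul (c : F) (β : N →ₗ[F] N →ₗ[F] N) (f g : ℕ →₀ N) :
    bilin (c • β) f g = c • bilin β f g :=
  bilin_ext (S := bilin (c • β)) (T := c • bilin β) (by
    intro i a j b
    simp [bilin_single]) f g

theorem bilin_flip (β : N →ₗ[F] N →ₗ[F] N) (f g : ℕ →₀ N) :
    bilin β.flip f g = bilin β g f :=
  bilin_ext (S := bilin β.flip) (T := (bilin β).flip) (by
    intro i a j b
    simp [bilin_single, add_comm]) f g

theorem map_id (f : ℕ →₀ N) : map (LinearMap.id : N →ₗ[F] N) f = f := by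
  ext i
  simp [map_apply]

/-- A trilinear identity between compositions of bilinear maps extends to polynomials. -/
theorem bilin_identity {β₁ γ₁ β₂ γ₂ β₃ γ₃ β₄ γ₄ : N →ₗ[F] N →ₗ[F] N}
    (h : ∀ a b c, β₁ (γ₁ a b) c + β₂ (γ₂ a b) c = β₃ a (γ₃ b c) + β₄ a (γ₄ b c))
    (f g k : ℕ →₀ N) : bilin β₁ (bilin γ₁ f g) k + bilin β₂ (bilin γ₂ f g) k =
      bilin β₃ f (bilin γ₃ g k) + bilin β₄ f (bilin γ₄ g k) := by
  induction f using induction with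
  | h0 => simp
  | hadd f f' hf hf' =>
    simp only [map_add, LinearMap.add_apply]
    rw [add_add_add_comm, hf, hf']
    abel
  | hs i a =>
    induction g using induction with
    | h0 => simp
    | hadd f f' hf hf' =>
      simp only [map_add, LinearMap.add_apply]
      rw [add_add_add_comm, hf, hf']
      abel
    | hs j b =>
      induction k using induction with
      | h0 => simp
      | hadd f f' hf hf' =>
        simp only [map_add]
        rw [add_add_add_comm, hf, hf']
        abel
      | hs l c =>
        simp only [bilin_single, ← add_assoc, ← Finsupp.single_add]
        rw [h]

theorem bilin_assoc {β : N →ₗ[F] N →ₗ[F] N} (h : ∀ a b c, β (β a b) c = β a (β b c))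
    (f g k : ℕ →₀ N) : bilin β (bilin β f g) k = bilin β f (bilin β g k) := by
  have := bilin_identity (β₁ := β) (γ₁ := β) (β₂ := 0) (γ₂ := 0) (β₃ := β) (γ₃ := β) (β₄ := 0)
    (γ₄ := 0) (by simpa using h) f g k
  have h0 : ∀ f g : ℕ →₀ N, bilin (0 : N →ₗ[F] N →ₗ[F] N) f g = 0 := fun f g => by
    simpa using bilin_smul (0 : F) 0 f g
  simpa [h0] using this

theorem bilin_shift_left (β : N →ₗ[F] N →ₗ[F] N) (f g : ℕ →₀ N) :
    bilin β (shift (F := F) f) g = shift (F := F) (bilin β f g) :=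
  bilin_ext (S := (bilin β) ∘ₗ shift (F := F))
    (T := (bilin β).compr₂ (shift (F := F))) (by
    intro i a j b
    simp [bilin_single, shift_single, add_right_comm]) f g

theorem bilin_shift_right (β : N →ₗ[F] N →ₗ[F] N) (f g : ℕ →₀ N) :
    bilin β f (shift (F := F) g) = shift (F := F) (bilin β f g) :=
  bilin_ext (S := (bilin β).compl₂ (shift (F := F)))
    (T := (bilin β).compr₂ (shift (F := F))) (by
    intro i a j b
    simp [bilin_single, shift_single, add_assoc]) f g

theorem map_shift (T : N →ₗ[F] N) (f : ℕ →₀ N) :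
    map T (shift (F := F) f) = shift (F := F) (map T f) :=
  linear_ext (S := map T ∘ₗ shift (F := F)) (T := shift (F := F) ∘ₗ map T) (by
    intro i a
    simp [map_single, shift_single]) f

theorem map_deriv (T : N →ₗ[F] N) (f : ℕ →₀ N) :
    map T (deriv (F := F) f) = deriv (F := F) (map T f) :=
  linear_ext (S := map T ∘ₗ deriv (F := F)) (T := deriv (F := F) ∘ₗ map T) (by
    intro i a
    simp [map_single, deriv_single]) f

theorem map_primitive (T : N →ₗ[F] N) (f : ℕ →₀ N) :
    map T (primitive (F := F) f) = primitive (F := F) (map T f) :=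
  linear_ext (S := map T ∘ₗ primitive (F := F)) (T := primitive (F := F) ∘ₗ map T) (by
    intro i a
    simp [map_single, primitive_single]) f

theorem eval_map (c : F) (T : N →ₗ[F] N) (f : ℕ →₀ N) : eval c (map T f) = T (eval c f) :=
  linear_ext (S := eval c ∘ₗ map T) (T := T ∘ₗ eval c) (by
    intro i a
    simp [map_single, eval_single]) f

theorem eval_shift (c : F) (f : ℕ →₀ N) : eval c (shift (F := F) f) = c • eval c f :=
  linear_ext (S := eval c ∘ₗ shift (F := F)) (T := c • eval c) (by
    intro i a
    simp [shift_single, eval_single, pow_succ', smul_smul]) f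

theorem eval_bilin (c : F) (β : N →ₗ[F] N →ₗ[F] N) (f g : ℕ →₀ N) :
    eval c (bilin β f g) = β (eval c f) (eval c g) :=
  bilin_ext (S := (bilin β).compr₂ (eval c)) (T := β.compl₁₂ (eval c) (eval c)) (by
    intro i a j b
    simp [bilin_single, eval_single, pow_add, smul_smul, mul_comm]) f g

theorem deriv_shift (f : ℕ →₀ N) :
    deriv (F := F) (shift (F := F) f) = f + shift (F := F) (deriv (F := F) f) :=
  linear_ext (S := deriv (F := F) ∘ₗ shift (F := F))
    (T := LinearMap.id + shift (F := F) ∘ₗ deriv (F := F)) (by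
    intro i a
    cases i with
    | zero => simp [shift_single, deriv_single]
    | succ i =>
      simp only [LinearMap.comp_apply, LinearMap.add_apply, LinearMap.id_apply, shift_single,
        deriv_single, Nat.add_sub_cancel]
      rw [← Finsupp.single_add]
      congr 1
      push_cast
      module) f

theorem deriv_bilin (β : N →ₗ[F] N →ₗ[F] N) (f g : ℕ →₀ N) : deriv (F := F) (bilin β f g) =
    bilin β (deriv (F := F) f) g + bilin β f (deriv (F := F) g) :=
  bilin_ext (S := (bilin β).compr₂ (deriv (F := F)))
    (T := bilin β ∘ₗ deriv (F := F) + (bilin β).compl₂ (deriv (F := F))) (by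
    intro i a j b
    simp only [LinearMap.compr₂_apply, LinearMap.add_apply, LinearMap.comp_apply,
      LinearMap.compl₂_apply, deriv_single, bilin_single, map_smul, LinearMap.smul_apply]
    rcases Nat.eq_zero_or_pos i with rfl | hi
    · simp
    rcases Nat.eq_zero_or_pos j with rfl | hj
    · simp
    rw [show i - 1 + j = i + j - 1 by omega, show i + (j - 1) = i + j - 1 by omega,
      ← Finsupp.single_add]
    congr 1
    push_cast
    module) f g

theorem deriv_primitive [CharZero F] (f : ℕ →₀ N) :
    deriv (F := F) (primitive (F := F) f) = f :=
  linear_ext (S := deriv (F := F) ∘ₗ primitive (F := F)) (T := LinearMap.id) (by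
    intro i a
    have : (i : F) + 1 ≠ 0 := by exact_mod_cast Nat.succ_ne_zero i
    simp [primitive_single, deriv_single, smul_smul, this]) f

theorem primitive_deriv [CharZero F] (f : ℕ →₀ N) :
    primitive (F := F) (deriv (F := F) f) = f - Finsupp.single 0 (eval (0 : F) f) :=
  linear_ext (S := primitive (F := F) ∘ₗ deriv (F := F))
    (T := LinearMap.id - Finsupp.lsingle 0 ∘ₗ eval (0 : F)) (by
    intro i a
    cases i with
    | zero => simp [deriv_single, eval_single]
    | succ i =>
      have : (i : F) + 1 ≠ 0 := by exact_mod_cast Nat.succ_ne_zero i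
      simp [primitive_single, deriv_single, eval_single, smul_smul, this]) f

theorem deriv_single_zero (a : N) : deriv (F := F) (Finsupp.single 0 a) = 0 := by
  simp [deriv_single]

end PolyCoeff

namespace BoundedComplex

variable {F : Type u} [Field F] (E : BoundedComplex.{u, v} F)

open PolyCoeff

/-- The complex `E[s] ⊕ E[s] ds` of polynomial forms on the line with values in `E`. The element
`(f, g)` stands for `f + ds g`. -/
noncomputable def path : BoundedComplex.{u, v} F where
  carrier := (ℕ →₀ E.carrier) × (ℕ →₀ E.carrier)
  proj k := LinearMap.prodMap (map (E.proj k)) (map (E.shiftProj k))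
  bound := E.bound + 1
  proj_proj k x := by
    refine Prod.ext ?_ ?_
    · ext i
      simp [map_apply, E.proj_proj]
    · ext i
      cases k <;> simp [map_apply, shiftProj, E.proj_proj]
  proj_proj_ne {k l} h x := by
    refine Prod.ext ?_ ?_
    · ext i
      simp [map_apply, E.proj_proj_ne h]
    · ext i
      cases k <;> cases l <;> simp [map_apply, shiftProj]
      rw [E.proj_proj_ne (by omega)]
  sum_proj x := by
    refine Prod.ext ?_ ?_
    · ext i
      rw [Prod.fst_sum, Finsupp.finsetSum_apply]
      simp only [LinearMap.prodMap_apply, map_apply]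
      rw [Finset.sum_range_succ, E.sum_proj]
      have h3 : E.proj E.bound (x.1 i) = 0 := by
        conv_lhs => rw [← E.sum_proj (x.1 i), map_sum]
        exact Finset.sum_eq_zero fun k hk =>
          E.proj_proj_ne (by have := Finset.mem_range.1 hk; omega) _
      rw [h3, add_zero]
    · ext i
      rw [Prod.snd_sum, Finsupp.finsetSum_apply]
      simp only [LinearMap.prodMap_apply, map_apply]
      exact sum_shiftProj _
  d := LinearMap.prod (map E.d ∘ₗ LinearMap.fst F _ _)
    (deriv ∘ₗ LinearMap.fst F _ _ - map E.d ∘ₗ LinearMap.snd F _ _)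
  proj_succ_d k x := by
    refine Prod.ext ?_ ?_
    · ext i
      simp [map_apply, E.proj_succ_d]
    · change map (E.shiftProj (k + 1)) (deriv (F := F) x.1 - map E.d x.2) =
        deriv (F := F) (map (E.proj k) x.1) - map E.d (map (E.shiftProj k) x.2)
      rw [map_sub, map_deriv]
      congr 1
      ext i
      cases k <;> simp [map_apply, shiftProj, E.proj_zero_d, E.proj_succ_d]
  proj_zero_d x := by
    refine Prod.ext ?_ ?_
    · ext i
      simp [map_apply, E.proj_zero_d]
    · ext i
      simp [map_apply, shiftProj]
  d_d x := by
    refine Prod.ext ?_ ?_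
    · ext i
      simp [map_apply, E.d_d]
    · change deriv (F := F) (map E.d x.1) - map E.d (deriv (F := F) x.1 - map E.d x.2) = 0
      rw [map_sub, map_deriv, sub_sub_cancel]
      ext i
      simp [map_apply, E.d_d]

end BoundedComplex

/-! ### Algebras of polynomial forms which interpolate between two products -/

namespace BoundedComplex

variable {F : Type u} [Field F] (E : BoundedComplex.{u, v} F)

open PolyCoeff

/-- An affine family of products `μ + s m` on a complex, parametrized by `s`, together with a
bilinear map `κ` of degree `-1` which is a Hochschild cocycle for all of these products and whose
boundary is the derivative `m` of the family. -/
structure Deformation where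
  μ : E.carrier →ₗ[F] E.carrier →ₗ[F] E.carrier
  m : E.carrier →ₗ[F] E.carrier →ₗ[F] E.carrier
  κ : E.carrier →ₗ[F] E.carrier →ₗ[F] E.carrier
  μ_mem : ∀ {i j : ℕ} {a b : E.carrier}, a ∈ E.gr i → b ∈ E.gr j → μ a b ∈ E.gr (i + j)
  m_mem : ∀ {i j : ℕ} {a b : E.carrier}, a ∈ E.gr i → b ∈ E.gr j → m a b ∈ E.gr (i + j)
  κ_mem : ∀ {i j : ℕ} {a b : E.carrier}, a ∈ E.gr i → b ∈ E.gr j → κ a b ∈ E.shiftGr (i + j)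
  μ_assoc : ∀ a b c, μ (μ a b) c = μ a (μ b c)
  mixed_assoc : ∀ a b c, m (μ a b) c + μ (m a b) c = m a (μ b c) + μ a (m b c)
  m_assoc : ∀ a b c, m (m a b) c = m a (m b c)
  μ_comm : ∀ {i j : ℕ} {a b : E.carrier}, a ∈ E.gr i → b ∈ E.gr j →
    μ a b = (-1 : F) ^ (i * j) • μ b a
  m_comm : ∀ {i j : ℕ} {a b : E.carrier}, a ∈ E.gr i → b ∈ E.gr j →
    m a b = (-1 : F) ^ (i * j) • m b a
  κ_comm : ∀ {i j : ℕ} {a b : E.carrier}, a ∈ E.gr i → b ∈ E.gr j →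
    κ a b = (-1 : F) ^ (i * j) • κ b a
  μ_leibniz : ∀ a b, E.d (μ a b) = μ (E.d a) b + μ (E.sign a) (E.d b)
  m_leibniz : ∀ a b, E.d (m a b) = m (E.d a) b + m (E.sign a) (E.d b)
  μ_κ : ∀ a b c, μ (κ a b) c + κ (μ a b) c = κ a (μ b c) + μ (E.sign a) (κ b c)
  m_κ : ∀ a b c, m (κ a b) c + κ (m a b) c = κ a (m b c) + m (E.sign a) (κ b c)
  d_κ : ∀ a b, E.d (κ a b) + κ (E.d a) b + κ (E.sign a) (E.d b) = m a b

namespace Deformation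

variable {E} (D : E.Deformation)

/-- The member of the family of products at the parameter `s`. -/
def fibre (s : F) : CommProduct E where
  mul := D.μ + s • D.m
  mul_mem ha hb := add_mem (D.μ_mem ha hb) (Submodule.smul_mem _ _ (D.m_mem ha hb))
  assoc a b c := by
    have h := D.mixed_assoc a b c
    simp only [LinearMap.add_apply, LinearMap.smul_apply, map_add, map_smul, D.μ_assoc, D.m_assoc,
      smul_add]
    have h' := congrArg (s • ·) h
    simp only [smul_add] at h'
    calc _ = D.μ a (D.μ b c) + (s • D.m (D.μ a b) c + s • D.μ (D.m a b) c)
          + s • s • D.m a (D.m b c) := by abel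
      _ = _ := by rw [h']; abel
  comm ha hb := by
    simp only [LinearMap.add_apply, LinearMap.smul_apply, D.μ_comm ha hb, D.m_comm ha hb, smul_add]
    rw [smul_comm s]
  leibniz {k a} ha b := by
    simp only [LinearMap.add_apply, LinearMap.smul_apply, map_add, map_smul, D.μ_leibniz,
      D.m_leibniz, sign_of_mem ha, smul_add]
    rw [smul_comm s]
    abel

/-- The product `μ + s m` on polynomials in `s`. -/
noncomputable def polyMul :
    (ℕ →₀ E.carrier) →ₗ[F] (ℕ →₀ E.carrier) →ₗ[F] (ℕ →₀ E.carrier) :=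
  bilin D.μ + (bilin D.m).compr₂ shift

theorem polyMul_apply (f g : ℕ →₀ E.carrier) :
    D.polyMul f g = bilin D.μ f g + shift (F := F) (bilin D.m f g) := rfl

theorem polyMul_assoc (f g k : ℕ →₀ E.carrier) :
    D.polyMul (D.polyMul f g) k = D.polyMul f (D.polyMul g k) := by
  simp only [polyMul_apply, map_add, LinearMap.add_apply, bilin_shift_left, bilin_shift_right,
    bilin_assoc D.μ_assoc, bilin_assoc D.m_assoc]
  have h := congrArg (shift (F := F)) (bilin_identity D.mixed_assoc f g k)
  simp only [map_add] at h
  calc _ = bilin D.μ f (bilin D.μ g k) + (shift (F := F) (bilin D.m (bilin D.μ f g) k) +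
        shift (F := F) (bilin D.μ (bilin D.m f g) k)) +
        shift (F := F) (shift (F := F) (bilin D.m f (bilin D.m g k))) := by abel
    _ = _ := by rw [h]; abel

theorem bilin_sign_left {β : E.carrier →ₗ[F] E.carrier →ₗ[F] E.carrier} (f g : ℕ →₀ E.carrier) :
    bilin (β ∘ₗ E.sign) f g = bilin β (map E.sign f) g := by
  have := bilin_map E.sign LinearMap.id β f g
  rw [map_id] at this
  exact this.symm

theorem polyMul_κ (f g k : ℕ →₀ E.carrier) :
    D.polyMul (bilin D.κ f g) k + bilin D.κ (D.polyMul f g) k =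
      bilin D.κ f (D.polyMul g k) + D.polyMul (map E.sign f) (bilin D.κ g k) := by
  have h1 := bilin_identity (β₁ := D.μ) (γ₁ := D.κ) (β₂ := D.κ) (γ₂ := D.μ) (β₃ := D.κ)
    (γ₃ := D.μ) (β₄ := D.μ ∘ₗ E.sign) (γ₄ := D.κ) D.μ_κ f g k
  have h2 := congrArg (shift (F := F)) (bilin_identity (β₁ := D.m) (γ₁ := D.κ) (β₂ := D.κ)
    (γ₂ := D.m) (β₃ := D.κ) (γ₃ := D.m) (β₄ := D.m ∘ₗ E.sign) (γ₄ := D.κ) D.m_κ f g k)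
  simp only [bilin_sign_left, map_add] at h1 h2
  simp only [polyMul_apply, map_add, LinearMap.add_apply, bilin_shift_left, bilin_shift_right]
  calc _ = (bilin D.μ (bilin D.κ f g) k + bilin D.κ (bilin D.μ f g) k) +
        (shift (F := F) (bilin D.m (bilin D.κ f g) k) +
          shift (F := F) (bilin D.κ (bilin D.m f g) k)) := by abel
    _ = _ := by rw [h1, h2]; abel

theorem map_sign_bilin {β : E.carrier →ₗ[F] E.carrier →ₗ[F] E.carrier}
    (hβ : ∀ {i j : ℕ} {a b : E.carrier}, a ∈ E.gr i → b ∈ E.gr j → β a b ∈ E.gr (i + j))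
    (f g : ℕ →₀ E.carrier) :
    map E.sign (bilin β f g) = bilin β (map E.sign f) (map E.sign g) := by
  rw [map_bilin, bilin_map]
  congr 3
  ext a b
  exact sign_mul hβ a b

theorem map_sign_polyMul (f g : ℕ →₀ E.carrier) :
    map E.sign (D.polyMul f g) = D.polyMul (map E.sign f) (map E.sign g) := by
  simp only [polyMul_apply, map_add, map_shift, map_sign_bilin D.μ_mem, map_sign_bilin D.m_mem]

theorem bilin_d_right {β : E.carrier →ₗ[F] E.carrier →ₗ[F] E.carrier} (f g : ℕ →₀ E.carrier) :
    bilin (β.compl₁₂ E.sign E.d) f g = bilin β (map E.sign f) (map E.d g) :=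
  (bilin_map _ _ _ _ _).symm

theorem bilin_d_left {β : E.carrier →ₗ[F] E.carrier →ₗ[F] E.carrier} (f g : ℕ →₀ E.carrier) :
    bilin (β ∘ₗ E.d) f g = bilin β (map E.d f) g := by
  have := bilin_map E.d LinearMap.id β f g
  rw [map_id] at this
  exact this.symm

theorem map_d_bilin {β : E.carrier →ₗ[F] E.carrier →ₗ[F] E.carrier}
    (hβ : ∀ a b, E.d (β a b) = β (E.d a) b + β (E.sign a) (E.d b)) (f g : ℕ →₀ E.carrier) :
    map E.d (bilin β f g) = bilin β (map E.d f) g + bilin β (map E.sign f) (map E.d g) := by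
  rw [map_bilin, ← bilin_d_left, ← bilin_d_right, ← bilin_add]
  congr 3
  ext a b
  exact hβ a b

theorem map_d_polyMul (f g : ℕ →₀ E.carrier) : map E.d (D.polyMul f g) =
    D.polyMul (map E.d f) g + D.polyMul (map E.sign f) (map E.d g) := by
  simp only [polyMul_apply, map_add, map_shift, map_d_bilin D.μ_leibniz, map_d_bilin D.m_leibniz]
  abel

theorem map_d_κ (f g : ℕ →₀ E.carrier) : map E.d (bilin D.κ f g) + bilin D.κ (map E.d f) g +
    bilin D.κ (map E.sign f) (map E.d g) = bilin D.m f g := by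
  rw [map_bilin, ← bilin_d_left, ← bilin_d_right, ← bilin_add, ← bilin_add]
  congr 3
  ext a b
  exact D.d_κ a b

theorem deriv_polyMul (f g : ℕ →₀ E.carrier) : deriv (F := F) (D.polyMul f g) =
    D.polyMul (deriv (F := F) f) g + D.polyMul f (deriv (F := F) g) + bilin D.m f g := by
  simp only [polyMul_apply, map_add, deriv_shift, deriv_bilin]
  abel

theorem eval_polyMul (c : F) (f g : ℕ →₀ E.carrier) :
    eval c (D.polyMul f g) = (D.fibre c).mul (eval c f) (eval c g) := by
  simp only [polyMul_apply, map_add, eval_shift, eval_bilin]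
  rfl

theorem map_sign_map_sign (f : ℕ →₀ E.carrier) : map E.sign (map E.sign f) = f := by
  ext i
  simp [map_apply, sign_sign]

theorem map_sign_map_d (f : ℕ →₀ E.carrier) :
    map E.sign (map E.d f) = -map E.d (map E.sign f) := by
  ext i
  simp [map_apply, sign_d]

theorem map_sign_of_map_proj {k : ℕ} {f : ℕ →₀ E.carrier} (hf : map (E.proj k) f = f) :
    map E.sign f = (-1 : F) ^ k • f := by
  ext i
  rw [map_apply, Finsupp.smul_apply]
  refine sign_of_mem (mem_gr.2 ?_)
  rw [← map_apply, hf]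

theorem map_sign_of_map_shiftProj {k : ℕ} {f : ℕ →₀ E.carrier} (hf : map (E.shiftProj k) f = f) :
    map E.sign f = -((-1 : F) ^ k • f) := by
  cases k with
  | zero =>
    have : f = 0 := by
      rw [← hf]
      ext i
      simp [map_apply, shiftProj]
    simp [this]
  | succ k =>
    rw [map_sign_of_map_proj hf, pow_succ]
    simp

/-- A commutation rule on the images of the projections `S` and `T` extends to polynomials. -/
theorem bilin_comm {β : E.carrier →ₗ[F] E.carrier →ₗ[F] E.carrier} {S T : E.carrier →ₗ[F] E.carrier}
    {c : F} (h : ∀ a b, S a = a → T b = b → β a b = c • β b a) (hS : ∀ a, S (S a) = S a)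
    (hT : ∀ a, T (T a) = T a) {f g : ℕ →₀ E.carrier} (hf : map S f = f) (hg : map T g = g) :
    bilin β f g = c • bilin β g f := by
  rw [← hf, ← hg, bilin_map, bilin_map, ← bilin_flip (β.compl₁₂ T S), ← bilin_smul]
  congr 3
  ext a b
  exact h _ _ (hS a) (hT b)

/-- If `β` maps the images of the projections `S` and `T` to elements fixed by `U`, then its extension to
polynomials does. -/
theorem bilin_mem {β : E.carrier →ₗ[F] E.carrier →ₗ[F] E.carrier}
    {S T U : E.carrier →ₗ[F] E.carrier}
    (h : ∀ a b, S a = a → T b = b → U (β a b) = β a b) (hS : ∀ a, S (S a) = S a)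
    (hT : ∀ a, T (T a) = T a) {f g : ℕ →₀ E.carrier} (hf : map S f = f) (hg : map T g = g) :
    map U (bilin β f g) = bilin β f g := by
  rw [← hf, ← hg, bilin_map, map_bilin]
  congr 3
  ext a b
  exact h _ _ (hS a) (hT b)

theorem shiftProj_shiftProj (k : ℕ) (a : E.carrier) :
    E.shiftProj k (E.shiftProj k a) = E.shiftProj k a := by
  cases k with
  | zero => rfl
  | succ k => exact E.proj_proj k a

theorem shiftGr_mul {β : E.carrier →ₗ[F] E.carrier →ₗ[F] E.carrier}
    (hβ : ∀ {i j : ℕ} {a b : E.carrier}, a ∈ E.gr i → b ∈ E.gr j → β a b ∈ E.gr (i + j))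
    {i j : ℕ} {a b : E.carrier} (ha : a ∈ E.shiftGr i) (hb : b ∈ E.gr j) :
    β a b ∈ E.shiftGr (i + j) := by
  cases i with
  | zero => rw [mem_shiftGr_zero.1 ha]; simp
  | succ i =>
    rw [add_right_comm]
    exact hβ ha hb

theorem mul_shiftGr {β : E.carrier →ₗ[F] E.carrier →ₗ[F] E.carrier}
    (hβ : ∀ {i j : ℕ} {a b : E.carrier}, a ∈ E.gr i → b ∈ E.gr j → β a b ∈ E.gr (i + j))
    {i j : ℕ} {a b : E.carrier} (ha : a ∈ E.gr i) (hb : b ∈ E.shiftGr j) :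
    β a b ∈ E.shiftGr (i + j) := by
  cases j with
  | zero => rw [mem_shiftGr_zero.1 hb]; simp
  | succ j => exact hβ ha hb

theorem shiftGr_mul_comm {β : E.carrier →ₗ[F] E.carrier →ₗ[F] E.carrier}
    (hβ : ∀ {i j : ℕ} {a b : E.carrier}, a ∈ E.gr i → b ∈ E.gr j →
      β a b = (-1 : F) ^ (i * j) • β b a)
    {i j : ℕ} {a b : E.carrier} (ha : a ∈ E.shiftGr i) (hb : b ∈ E.gr j) :
    β a b = ((-1 : F) ^ (i * j) * (-1 : F) ^ j) • β b a := by
  cases i with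
  | zero => rw [mem_shiftGr_zero.1 ha]; simp
  | succ i =>
    rw [hβ (mem_shiftGr_succ.1 ha) hb]
    congr 1
    rw [← pow_add, show (i + 1) * j + j = i * j + 2 * j by ring, pow_add, pow_mul (-1 : F) 2]
    simp

theorem polyMul_mem {S T U : E.carrier →ₗ[F] E.carrier}
    (h : ∀ β : E.carrier →ₗ[F] E.carrier →ₗ[F] E.carrier,
      (∀ {i j : ℕ} {a b : E.carrier}, a ∈ E.gr i → b ∈ E.gr j → β a b ∈ E.gr (i + j)) →
      ∀ a b, S a = a → T b = b → U (β a b) = β a b) (hS : ∀ a, S (S a) = S a)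
    (hT : ∀ a, T (T a) = T a) {f g : ℕ →₀ E.carrier} (hf : map S f = f) (hg : map T g = g) :
    map U (D.polyMul f g) = D.polyMul f g := by
  rw [polyMul_apply, map_add, map_shift, bilin_mem (h _ D.μ_mem) hS hT hf hg,
    bilin_mem (h _ D.m_mem) hS hT hf hg]

theorem polyMul_comm {S T : E.carrier →ₗ[F] E.carrier} {c : F}
    (h : ∀ β : E.carrier →ₗ[F] E.carrier →ₗ[F] E.carrier,
      (∀ {i j : ℕ} {a b : E.carrier}, a ∈ E.gr i → b ∈ E.gr j →
        β a b = (-1 : F) ^ (i * j) • β b a) →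
      ∀ a b, S a = a → T b = b → β a b = c • β b a) (hS : ∀ a, S (S a) = S a)
    (hT : ∀ a, T (T a) = T a) {f g : ℕ →₀ E.carrier} (hf : map S f = f) (hg : map T g = g) :
    D.polyMul f g = c • D.polyMul g f := by
  rw [polyMul_apply, polyMul_apply, bilin_comm (h _ D.μ_comm) hS hT hf hg,
    bilin_comm (h _ D.m_comm) hS hT hf hg, map_smul, smul_add]

/-- The product of the polynomial forms `f + ds g` which is given by the family `μ + s m` in the
direction of the fibres and has the additional term `ds κ(f, f')`. -/
noncomputable def pathMul : ((ℕ →₀ E.carrier) × (ℕ →₀ E.carrier)) →ₗ[F]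
    ((ℕ →₀ E.carrier) × (ℕ →₀ E.carrier)) →ₗ[F] ((ℕ →₀ E.carrier) × (ℕ →₀ E.carrier)) :=
  LinearMap.mk₂ F (fun x y => (D.polyMul x.1 y.1,
      bilin D.κ x.1 y.1 + D.polyMul x.2 y.1 + D.polyMul (map E.sign x.1) y.2))
    (fun x x' y => Prod.ext (by simp) (by simp; abel))
    (fun c x y => Prod.ext (by simp) (by simp))
    (fun x y y' => Prod.ext (by simp) (by simp; abel))
    (fun c x y => Prod.ext (by simp) (by simp))

theorem smul_pathMul (c : F) (x y : (ℕ →₀ E.carrier) × (ℕ →₀ E.carrier)) :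
    c • D.pathMul x y = D.pathMul (c • x.1, c • x.2) y := by
  rw [← LinearMap.smul_apply, ← map_smul]
  rfl

theorem mem_path_gr {k : ℕ} {x : E.path.carrier} :
    x ∈ E.path.gr k ↔ map (E.proj k) x.1 = x.1 ∧ map (E.shiftProj k) x.2 = x.2 :=
  ⟨fun h => ⟨congrArg Prod.fst h, congrArg Prod.snd h⟩, fun h => Prod.ext h.1 h.2⟩

/-- The algebra of polynomial forms which interpolates between the members of the family. -/
noncomputable def total : CommProduct E.path where
  mul := D.pathMul
  mul_mem {i j x y} hx hy := by
    obtain ⟨h1, h2⟩ := mem_path_gr.1 hx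
    obtain ⟨h3, h4⟩ := mem_path_gr.1 hy
    refine mem_path_gr.2 ⟨?_, ?_⟩
    · exact D.polyMul_mem (fun β hβ a b ha hb => hβ (i := i) (j := j) ha hb)
        (E.proj_proj i) (E.proj_proj j) h1 h3
    · change map (E.shiftProj (i + j)) (bilin D.κ x.1 y.1 + D.polyMul x.2 y.1 +
          D.polyMul (map E.sign x.1) y.2) =
        bilin D.κ x.1 y.1 + D.polyMul x.2 y.1 + D.polyMul (map E.sign x.1) y.2
      rw [map_add, map_add]
      congr 1
      · congr 1
        · exact bilin_mem (S := E.proj i) (T := E.proj j) (fun a b ha hb => D.κ_mem ha hb)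
            (E.proj_proj i) (E.proj_proj j) h1 h3
        · exact D.polyMul_mem (S := E.shiftProj i) (T := E.proj j)
            (fun β hβ a b ha hb => shiftGr_mul hβ ha hb)
            (shiftProj_shiftProj i) (E.proj_proj j) h2 h3
      · rw [map_sign_of_map_proj h1]
        simp only [map_smul, LinearMap.smul_apply]
        congr 1
        exact D.polyMul_mem (S := E.proj i) (T := E.shiftProj j)
            (fun β hβ a b ha hb => mul_shiftGr hβ ha hb)
            (E.proj_proj i) (shiftProj_shiftProj j) h1 h4
  assoc x y z := by
    refine Prod.ext (D.polyMul_assoc _ _ _) ?_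
    change bilin D.κ (D.polyMul x.1 y.1) z.1 + D.polyMul (bilin D.κ x.1 y.1 +
        D.polyMul x.2 y.1 + D.polyMul (map E.sign x.1) y.2) z.1 +
        D.polyMul (map E.sign (D.polyMul x.1 y.1)) z.2 =
      bilin D.κ x.1 (D.polyMul y.1 z.1) + D.polyMul x.2 (D.polyMul y.1 z.1) +
        D.polyMul (map E.sign x.1) (bilin D.κ y.1 z.1 + D.polyMul y.2 z.1 +
          D.polyMul (map E.sign y.1) z.2)
    simp only [map_add, LinearMap.add_apply, D.polyMul_assoc, D.map_sign_polyMul]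
    have h := D.polyMul_κ x.1 y.1 z.1
    calc _ = (D.polyMul (bilin D.κ x.1 y.1) z.1 + bilin D.κ (D.polyMul x.1 y.1) z.1) +
          D.polyMul x.2 (D.polyMul y.1 z.1) + D.polyMul (map E.sign x.1) (D.polyMul y.2 z.1) +
          D.polyMul (map E.sign x.1) (D.polyMul (map E.sign y.1) z.2) := by abel
      _ = _ := by rw [h]; abel
  comm {i j x y} hx hy := by
    obtain ⟨h1, h2⟩ := mem_path_gr.1 hx
    obtain ⟨h3, h4⟩ := mem_path_gr.1 hy
    refine Prod.ext ?_ ?_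
    · exact D.polyMul_comm (fun β hβ a b ha hb => hβ (i := i) (j := j) ha hb)
        (E.proj_proj i) (E.proj_proj j) h1 h3
    · have e1 := bilin_comm (S := E.proj i) (T := E.proj j) (fun a b ha hb => D.κ_comm ha hb)
        (E.proj_proj i) (E.proj_proj j) h1 h3
      have e2 := D.polyMul_comm (S := E.shiftProj i) (T := E.proj j)
        (fun β hβ a b ha hb => shiftGr_mul_comm hβ ha hb)
        (shiftProj_shiftProj i) (E.proj_proj j) h2 h3
      have e3 := D.polyMul_comm (S := E.shiftProj j) (T := E.proj i)
        (fun β hβ a b ha hb => shiftGr_mul_comm hβ ha hb)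
        (shiftProj_shiftProj j) (E.proj_proj i) h4 h1
      change bilin D.κ x.1 y.1 + D.polyMul x.2 y.1 + D.polyMul (map E.sign x.1) y.2 =
        (-1 : F) ^ (i * j) •
          (bilin D.κ y.1 x.1 + D.polyMul y.2 x.1 + D.polyMul (map E.sign y.1) x.2)
      rw [e1, e2, e3, map_sign_of_map_proj h1, map_sign_of_map_proj h3]
      have e4 : (-1 : F) ^ (i * j) * ((-1 : F) ^ (j * i) * (-1 : F) ^ i) = (-1 : F) ^ i := by
        rw [mul_comm j i, ← mul_assoc, ← pow_add, ← two_mul, pow_mul]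
        simp
      simp only [map_smul, LinearMap.smul_apply, smul_add, smul_smul, e4]
      abel
  leibniz {k x} hx y := by
    obtain ⟨h1, h2⟩ := mem_path_gr.1 hx
    have e1 : (-1 : F) ^ k • D.pathMul x (E.path.d y) =
        D.pathMul (map E.sign x.1, -map E.sign x.2) (E.path.d y) := by
      rw [map_sign_of_map_proj h1, map_sign_of_map_shiftProj h2, neg_neg]
      exact D.smul_pathMul _ x _
    refine Eq.trans ?_ (congrArg (D.pathMul (E.path.d x) y + ·) e1.symm)
    refine Prod.ext (D.map_d_polyMul _ _) ?_
    change deriv (F := F) (D.polyMul x.1 y.1) - map E.d (bilin D.κ x.1 y.1 + D.polyMul x.2 y.1 +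
        D.polyMul (map E.sign x.1) y.2) =
      (bilin D.κ (map E.d x.1) y.1 + D.polyMul (deriv (F := F) x.1 - map E.d x.2) y.1 +
        D.polyMul (map E.sign (map E.d x.1)) y.2) +
      (bilin D.κ (map E.sign x.1) (map E.d y.1) + D.polyMul (-map E.sign x.2) (map E.d y.1) +
        D.polyMul (map E.sign (map E.sign x.1)) (deriv (F := F) y.1 - map E.d y.2))
    simp only [map_add, map_sub, map_neg, LinearMap.sub_apply,
      LinearMap.neg_apply, D.map_d_polyMul, D.deriv_polyMul, map_sign_map_sign, map_sign_map_d,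
      ← D.map_d_κ]
    abel

/-- The evaluation of polynomial forms at the parameter `c`. -/
noncomputable def evalHom (c : F) : DGCA.Hom D.total.toDGCA (D.fibre c).toDGCA :=
  D.total.lift (X := (D.fibre c).toDGCA)
    (LinearMap.inr F F E.carrier ∘ₗ eval c ∘ₗ LinearMap.fst F _ (ℕ →₀ E.carrier))
    (fun x y => Prod.ext (zero_mul (0 : F)).symm (by
      change eval c (D.polyMul x.1 y.1) = (0 : F) • eval c y.1 + (0 : F) • eval c x.1 +
        (D.fibre c).mul (eval c x.1) (eval c y.1)
      rw [D.eval_polyMul]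
      simp))
    (fun {k x} hx => ⟨fun _ => rfl, by
      have h := (mem_path_gr.1 hx).1
      change E.proj k (eval c x.1) = eval c x.1
      rw [← eval_map, h]⟩)
    (fun x => Prod.ext rfl (by
      change eval c (map E.d x.1) = E.d (eval c x.1)
      rw [eval_map]))

theorem evalHom_apply (c : F) (a : F) (x : E.path.carrier) :
    (D.evalHom c).toAlgHom (a, x) = (a, eval c x.1) := by
  change (a • ((1 : F), (0 : E.carrier)) + ((0 : F), eval c x.1)) = (a, eval c x.1)
  simp

/-- The evaluations are quasi-isomorphisms, by integration along the line. -/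
theorem evalHom_isQuasiIso [CharZero F] (c : F) : (D.evalHom c).IsQuasiIso := by
  apply DGCA.Hom.isQuasiIso_of
  · rintro ⟨a, f, g⟩ hx ⟨⟨b, e⟩, hy⟩
    have hy' := hy.trans (D.evalHom_apply c a (f, g))
    have ha : a = 0 := (congrArg Prod.fst hy').symm
    have he : E.d e = eval c f := congrArg Prod.snd hy'
    have hx' := congrArg Prod.snd hx
    have hf : map E.d f = 0 := congrArg Prod.fst hx'
    have hg : deriv (F := F) f = map E.d g := sub_eq_zero.1 (congrArg Prod.snd hx')
    subst ha
    have h0 : map E.d (primitive (F := F) g) = f - Finsupp.single 0 (eval (0 : F) f) := by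
      rw [map_primitive, ← hg, primitive_deriv]
    have h1 : E.d (eval c (primitive (F := F) g)) = eval c f - eval (0 : F) f := by
      rw [← eval_map, h0, map_sub, eval_single, pow_zero, one_smul]
    -- The primitive of `f + ds g` is the integral of `g` along the line, with the value `e` at `c`.
    refine ⟨((0 : F), (primitive (F := F) g +
      Finsupp.single 0 (e - eval c (primitive (F := F) g)), 0)), ?_⟩
    refine Prod.ext rfl (Prod.ext ?_ ?_)
    · change map E.d (primitive (F := F) g +
        Finsupp.single 0 (e - eval c (primitive (F := F) g))) = f
      rw [map_add, h0, map_single, map_sub, he, h1, sub_sub_cancel, sub_add_cancel]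
    · change deriv (F := F) (primitive (F := F) g +
        Finsupp.single 0 (e - eval c (primitive (F := F) g))) - map E.d 0 = g
      rw [map_zero, sub_zero, map_add, deriv_primitive, deriv_single_zero, add_zero]
  · rintro ⟨a, e⟩ he
    have he' : E.d e = 0 := congrArg Prod.snd he
    refine ⟨(a, (Finsupp.single 0 e, 0)), ?_, 0, ?_⟩
    · refine Prod.ext rfl (Prod.ext ?_ ?_)
      · change map E.d (Finsupp.single 0 e) = 0
        rw [map_single, he', Finsupp.single_zero]
      · change deriv (F := F) (Finsupp.single 0 e) - map E.d 0 = 0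
        rw [deriv_single_zero, map_zero, sub_zero]
    · rw [map_zero]
      refine Eq.trans ?_ (congrArg (fun v : F × E.carrier => (a, e) - v)
        (D.evalHom_apply c a (Finsupp.single 0 e, 0))).symm
      change (0 : F × E.carrier) = (a, e) - (a, eval c (Finsupp.single 0 e))
      rw [eval_single, pow_zero, one_smul, sub_self]

theorem equivalent_fibre [CharZero F] (s t : F) :
    DGCA.Equivalent (D.fibre s).toDGCA (D.fibre t).toDGCA :=
  (Relation.EqvGen.rel _ _ ⟨D.evalHom s, D.evalHom_isQuasiIso s⟩).symm.trans _ _ _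
    (Relation.EqvGen.rel _ _ ⟨D.evalHom t, D.evalHom_isQuasiIso t⟩)

end Deformation

end BoundedComplex

/-! ### Normalization of Hochschild primitives of the ternary product -/

namespace DGCA

variable {F : Type u} [Field F] {H : DGCA.{u, v} F}

theorem mul_comm_intGrading {i m : ℕ} {a u : H.carrier} (ha : a ∈ H.grading i)
    (hu : u ∈ H.intGrading ((m : ℤ) + -1)) :
    a * u = ((-1 : F) ^ (i * m) * (-1 : F) ^ i) • (u * a) := by
  cases m with
  | zero =>
    rw [H.intGrading_of_neg (by simp)] at hu
    rw [(Submodule.mem_bot F).1 hu]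
    simp
  | succ m =>
    have e : ((m + 1 : ℕ) : ℤ) + -1 = (m : ℤ) := by push_cast; ring
    rw [e, intGrading_natCast] at hu
    rw [H.graded_comm ha hu]
    congr 1
    rw [← pow_add, show i * (m + 1) + i = i * m + 2 * i by ring, pow_add, pow_mul (-1 : F) 2]
    simp

theorem hochCochains₂_mem {φ : H.carrier →ₗ[F] H.carrier →ₗ[F] H.carrier}
    (hφ : φ ∈ H.hochCochains₂ (-1)) {i j : ℕ} {a b : H.carrier} (ha : a ∈ H.grading i)
    (hb : b ∈ H.grading j) : φ a b ∈ H.intGrading (((i + j : ℕ) : ℤ) + -1) := by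
  have h := hφ i j a b ha hb
  push_cast
  exact h

variable (H) in
/-- The graded transposition of a bilinear map: it maps homogeneous elements `a`, `b` to
`(-1) ^ (|a| |b|) φ(b, a)`. The sign is realized by the projections `(1 ± signOp) / 2` to the elements
of even and odd degree. -/
noncomputable def gradedFlip (φ : H.carrier →ₗ[F] H.carrier →ₗ[F] H.carrier) :
    H.carrier →ₗ[F] H.carrier →ₗ[F] H.carrier :=
  (2⁻¹ : F) • (φ.flip.compl₁₂ (LinearMap.id + H.signOp) LinearMap.id +
    φ.flip.compl₁₂ (LinearMap.id - H.signOp) H.signOp)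

theorem gradedFlip_apply [CharZero F] (φ : H.carrier →ₗ[F] H.carrier →ₗ[F] H.carrier) {i j : ℕ}
    {a b : H.carrier} (ha : a ∈ H.grading i) (hb : b ∈ H.grading j) :
    H.gradedFlip φ a b = (-1 : F) ^ (i * j) • φ b a := by
  change (2⁻¹ : F) • (φ b (a + H.signOp a) + φ (H.signOp b) (a - H.signOp a)) = _
  rw [H.signOp_of_mem ha, H.signOp_of_mem hb, pow_mul]
  simp only [map_add, map_sub, map_smul, LinearMap.smul_apply]
  rcases Nat.even_or_odd i with hi | hi
  · rw [hi.neg_one_pow]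
    match_scalars
    simp
    ring
  · rw [hi.neg_one_pow]
    match_scalars
    ring

theorem gradedFlip_mem [CharZero F] {φ : H.carrier →ₗ[F] H.carrier →ₗ[F] H.carrier}
    (hφ : φ ∈ H.hochCochains₂ (-1)) : H.gradedFlip φ ∈ H.hochCochains₂ (-1) := by
  intro i j a b ha hb
  rw [gradedFlip_apply φ ha hb, add_comm (i : ℤ)]
  exact Submodule.smul_mem _ _ (hφ j i b a hb ha)

/-- A bilinear map whose Hochschild differential is antisymmetric under the reversal of the
arguments has the same differential as its graded transposition. -/
theorem hochDifferential_gradedFlip [CharZero F]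
    {φ : H.carrier →ₗ[F] H.carrier →ₗ[F] H.carrier} (hφ : φ ∈ H.hochCochains₂ (-1))
    {f : H.carrier →ₗ[F] H.carrier →ₗ[F] H.carrier →ₗ[F] H.carrier}
    (hf : ∀ x y z, f x y z = H.signOp x * φ y z - φ (x * y) z + φ x (y * z) - φ x y * z)
    (hrev : ∀ {i j k : ℕ} {x y z : H.carrier}, x ∈ H.grading i → y ∈ H.grading j →
      z ∈ H.grading k → f x y z = -(-1 : F) ^ (i * j + j * k + k * i) • f z y x)
    (x y z : H.carrier) : f x y z = H.signOp x * H.gradedFlip φ y z - H.gradedFlip φ (x * y) z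
      + H.gradedFlip φ x (y * z) - H.gradedFlip φ x y * z := by
  induction x using H.hom_induction with
  | h0 => simp
  | hadd x x' hx hx' =>
    simp only [map_add, LinearMap.add_apply, add_mul, hx, hx']
    abel
  | hh i x hx =>
  induction y using H.hom_induction with
  | h0 => simp
  | hadd y y' hy hy' =>
    simp only [map_add, LinearMap.add_apply, add_mul, mul_add, hy, hy']
    abel
  | hh j y hy =>
  induction z using H.hom_induction with
  | h0 => simp
  | hadd z z' hz hz' =>
    simp only [map_add, mul_add, hz, hz']
    abel
  | hh k z hz =>
  rw [hrev hx hy hz, hf, gradedFlip_apply φ hy hz, gradedFlip_apply φ (H.mul_mem hx hy) hz,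
    gradedFlip_apply φ hx (H.mul_mem hy hz), gradedFlip_apply φ hx hy, H.signOp_of_mem hx,
    H.signOp_of_mem hz, H.graded_comm hx hy, H.graded_comm hy hz]
  simp only [map_smul, LinearMap.smul_apply, smul_mul_assoc, mul_smul_comm]
  rw [mul_comm_intGrading hx (hochCochains₂_mem hφ hz hy),
    mul_comm_intGrading hz (hochCochains₂_mem hφ hy hx)]
  rcases Nat.even_or_odd i with hi | hi <;> rcases Nat.even_or_odd j with hj | hj <;>
    rcases Nat.even_or_odd k with hk | hk <;>
    simp only [pow_add, pow_mul, hi.neg_one_pow, hj.neg_one_pow, hk.neg_one_pow, one_pow, one_smul,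
      mul_one, neg_smul, mul_neg, neg_neg, smul_neg] <;> abel

/-- In characteristic zero, a Hochschild coboundary which is antisymmetric under the reversal of the
arguments is the differential of a bilinear map which is symmetric in the graded sense. -/
theorem exists_symmetric_of_reverse [CharZero F]
    {f : H.carrier →ₗ[F] H.carrier →ₗ[F] H.carrier →ₗ[F] H.carrier}
    (hf : f ∈ H.hochCoboundaries₃ (-1))
    (hrev : ∀ {i j k : ℕ} {x y z : H.carrier}, x ∈ H.grading i → y ∈ H.grading j →
      z ∈ H.grading k → f x y z = -(-1 : F) ^ (i * j + j * k + k * i) • f z y x) :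
    ∃ φ ∈ H.hochCochains₂ (-1),
      (∀ x y z, f x y z = H.signOp x * φ y z - φ (x * y) z + φ x (y * z) - φ x y * z) ∧
      ∀ {i j : ℕ} {x y : H.carrier}, x ∈ H.grading i → y ∈ H.grading j →
        φ x y = (-1 : F) ^ (i * j) • φ y x := by
  obtain ⟨φ, hφ, hδ⟩ := mem_hochCoboundaries₃_iff.1 hf
  have hδ' := hochDifferential_gradedFlip hφ hδ hrev
  refine ⟨(2⁻¹ : F) • (φ + H.gradedFlip φ),
    Submodule.smul_mem _ _ (add_mem hφ (gradedFlip_mem hφ)), ?_, ?_⟩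
  · intro x y z
    have e : f x y z = (2⁻¹ : F) • (f x y z + f x y z) := by
      rw [← two_smul F, smul_smul, inv_mul_cancel₀ two_ne_zero, one_smul]
    rw [e]
    nth_rewrite 1 [hδ x y z]
    rw [hδ' x y z]
    simp only [LinearMap.smul_apply, LinearMap.add_apply, mul_smul_comm, smul_mul_assoc, mul_add,
      add_mul, smul_add, smul_sub]
    abel
  · intro i j x y hx hy
    have e : (-1 : F) ^ (i * j) * (-1 : F) ^ (i * j) = 1 := by
      rw [← pow_add, ← two_mul, pow_mul]
      simp
    change (2⁻¹ : F) • (φ x y + H.gradedFlip φ x y) =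
      (-1 : F) ^ (i * j) • (2⁻¹ : F) • (φ y x + H.gradedFlip φ y x)
    rw [gradedFlip_apply φ hx hy, gradedFlip_apply φ hy hx, smul_comm _ (2⁻¹ : F),
      smul_add _ (φ y x), smul_smul _ _ (φ x y), mul_comm j i, e, one_smul, add_comm]

theorem signOp_mul_eq_of_hochCochains {θ : H.carrier →ₗ[F] H.carrier}
    (hθ : ∀ {i : ℕ} {x : H.carrier}, x ∈ H.grading i → θ x ∈ H.intGrading ((i : ℤ) + -1))
    {i j : ℕ} {x y : H.carrier} (hx : x ∈ H.grading i) (hy : y ∈ H.grading j) :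
    H.signOp x * θ y = (-1 : F) ^ (i * j) • (θ y * x) := by
  rw [H.signOp_of_mem hx, smul_mul_assoc, mul_comm_intGrading hx (hθ hy), smul_smul, mul_left_comm,
    ← pow_add, ← two_mul, pow_mul]
  simp

variable (H) in
/-- The Hochschild differential of a linear map of degree `-1`. -/
noncomputable def hochDifferential₁ (θ : H.carrier →ₗ[F] H.carrier) : H.carrier →ₗ[F] H.carrier →ₗ[F] H.carrier :=
  (LinearMap.mul F H.carrier).compl₁₂ H.signOp θ - (LinearMap.mul F H.carrier).compr₂ θ +
    LinearMap.mul F H.carrier ∘ₗ θ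

theorem hochDifferential₁_apply (θ : H.carrier →ₗ[F] H.carrier)
    (x y : H.carrier) : H.hochDifferential₁ θ x y = H.signOp x * θ y - θ (x * y) + θ x * y := rfl

theorem hochDifferential₁_mem {θ : H.carrier →ₗ[F] H.carrier}
    (hθ : ∀ {i : ℕ} {x : H.carrier}, x ∈ H.grading i → θ x ∈ H.intGrading ((i : ℤ) + -1)) :
    H.hochDifferential₁ θ ∈ H.hochCochains₂ (-1) := by
  intro i j x y hx hy
  rw [hochDifferential₁_apply]
  have h1 := H.mul_mem_intGrading (H.signOp_mem hx) (hθ hy)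
  have h2 := hθ (H.mul_mem hx hy)
  have h3 := H.intGrading_mul_mem (hθ hx) hy
  rw [← add_assoc] at h1
  push_cast at h2
  rw [add_right_comm] at h3
  exact add_mem (sub_mem h1 h2) h3

theorem hochDifferential₁_comm {θ : H.carrier →ₗ[F] H.carrier}
    (hθ : ∀ {i : ℕ} {x : H.carrier}, x ∈ H.grading i → θ x ∈ H.intGrading ((i : ℤ) + -1))
    {i j : ℕ} {x y : H.carrier} (hx : x ∈ H.grading i) (hy : y ∈ H.grading j) :
    H.hochDifferential₁ θ x y = (-1 : F) ^ (i * j) • H.hochDifferential₁ θ y x := by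
  rw [hochDifferential₁_apply, hochDifferential₁_apply, H.signOp_of_mem hx,
    H.signOp_of_mem hy, H.graded_comm hx hy]
  simp only [map_smul, smul_mul_assoc]
  rw [mul_comm_intGrading hx (hθ hy), mul_comm_intGrading hy (hθ hx)]
  rcases Nat.even_or_odd i with hi | hi <;> rcases Nat.even_or_odd j with hj | hj <;>
    simp only [pow_mul, hi.neg_one_pow, hj.neg_one_pow, one_pow, one_smul,
      mul_one, neg_smul, mul_neg, neg_neg, smul_neg] <;> abel

theorem hochDifferential_hochDifferential₁ {H : DGCA.{u, v} F}
    (θ : H.carrier →ₗ[F] H.carrier) (x y z : H.carrier) :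
    H.signOp x * H.hochDifferential₁ θ y z - H.hochDifferential₁ θ (x * y) z
      + H.hochDifferential₁ θ x (y * z) - H.hochDifferential₁ θ x y * z = 0 := by
  simp only [hochDifferential₁_apply, H.signOp_mul, mul_add, mul_sub, add_mul, sub_mul,
    mul_assoc]
  abel

end DGCA

namespace PoincareDGCA

variable {F : Type u} [Field F] {n : ℕ} {A : PoincareDGCA.{u, v} F n}

namespace AdaptedChoice

variable (h : A.AdaptedChoice)

/-- Graded commutativity makes the ternary product antisymmetric under the reversal of the arguments. -/
theorem mu₃_reverse {i j k : ℕ} {x y z : A.Coh} (hx : x ∈ A.cohGrading i)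
    (hy : y ∈ A.cohGrading j) (hz : z ∈ A.cohGrading k) :
    h.mu₃ x y z = -(-1 : F) ^ (i * j + j * k + k * i) • h.mu₃ z y x := by
  have hx' := h.isSplitting.map_grading i x hx
  have hy' := h.isSplitting.map_grading j y hy
  have hz' := h.isSplitting.map_grading k z hz
  rw [h.mu₃_apply, h.mu₃_apply, ← map_smul]
  congr 1
  have e1 : h.primitive z y = (-1 : F) ^ (k * j) • h.primitive y z := by
    rw [h.primitive_apply, h.primitive_apply, A.graded_comm hz' hy', map_smul]
  have e2 : h.primitive y x = (-1 : F) ^ (j * i) • h.primitive x y := by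
    rw [h.primitive_apply, h.primitive_apply, A.graded_comm hy' hx', map_smul]
  have e3 := DGCA.mul_comm_intGrading (H := A.toDGCA) hx'
    (h.hodge.dMinus_mem_intGrading (A.mul_mem hy' hz'))
  have e4 := DGCA.mul_comm_intGrading (H := A.toDGCA) hz'
    (h.hodge.dMinus_mem_intGrading (A.mul_mem hx' hy'))
  rw [← primitive_apply] at e3 e4
  rw [e1, e2, A.signOp_of_mem hx', A.signOp_of_mem hz']
  simp only [smul_mul_assoc, mul_smul_comm, e3, e4]
  rcases Nat.even_or_odd i with hi | hi <;> rcases Nat.even_or_odd j with hj | hj <;>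
    rcases Nat.even_or_odd k with hk | hk <;>
    simp only [pow_add, pow_mul, hi.neg_one_pow, hj.neg_one_pow, hk.neg_one_pow, one_pow, one_smul,
      mul_one, neg_smul, mul_neg, neg_neg, smul_neg, smul_sub] <;> abel

theorem cohGrading_eq_bot {k : ℕ} (hk : n < k) : A.cohGrading k = ⊥ := by
  rw [eq_bot_iff]
  intro x hx
  obtain ⟨z, hz, rfl⟩ := A.mem_cohGrading.1 hx
  rw [A.grading_eq_bot k hk, Submodule.mem_bot] at hz
  rw [show z = 0 from Subtype.ext hz, map_zero]
  exact zero_mem _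

/-- Bilinear maps of degree `-1` have integrals only in total degree `n + 1`. -/
theorem cohInt_hochCochains₂ {φ : A.Coh →ₗ[F] A.Coh →ₗ[F] A.Coh}
    (hφ : φ ∈ A.cohomology.hochCochains₂ (-1)) {i j : ℕ} {x y : A.Coh} (hx : x ∈ A.cohGrading i)
    (hy : y ∈ A.cohGrading j) (hij : i + j ≠ n + 1) : A.cohInt (φ x y) = 0 := by
  have h := DGCA.hochCochains₂_mem hφ hx hy
  rcases Nat.eq_zero_or_pos (i + j) with h0 | h0
  · rw [h0, DGCA.intGrading_of_neg _ (by simp)] at h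
    rw [(Submodule.mem_bot F).1 h, map_zero]
  · obtain ⟨m, hm⟩ := Nat.exists_eq_succ_of_ne_zero h0.ne'
    have e : ((i + j : ℕ) : ℤ) + -1 = (m : ℤ) := by rw [hm]; push_cast; ring
    rw [e, DGCA.intGrading_natCast] at h
    exact cohInt_of_mem_ne h (by omega)

theorem cohInt_hochCochains₂_eq_zero {φ : A.Coh →ₗ[F] A.Coh →ₗ[F] A.Coh}
    (hφ : φ ∈ A.cohomology.hochCochains₂ (-1))
    (h0 : ∀ {i j : ℕ} {x y : A.Coh}, x ∈ A.cohGrading i → y ∈ A.cohGrading j → i + j = n + 1 →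
      A.cohInt (φ x y) = 0) (x y : A.Coh) : A.cohInt (φ x y) = 0 := by
  induction x using A.cohomology.hom_induction with
  | h0 => rw [map_zero, LinearMap.zero_apply, map_zero]
  | hadd x x' hx hx' => rw [map_add, LinearMap.add_apply, map_add, hx, hx', add_zero]
  | hh i x hx =>
  induction y using A.cohomology.hom_induction with
  | h0 => rw [map_zero, map_zero]
  | hadd y y' hy hy' => rw [map_add, map_add, hy, hy', add_zero]
  | hh j y hy =>
  by_cases hij : i + j = n + 1
  · exact h0 hx hy hij
  · exact cohInt_hochCochains₂ hφ hx hy hij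

/-- Poincaré duality turns `½ ∫ φ(x, y)` into a map `θ` with `∫ θ(x) y = ½ ∫ φ(x, y)`. -/
theorem exists_integral_correction {φ : A.Coh →ₗ[F] A.Coh →ₗ[F] A.Coh}
    (hφ : φ ∈ A.cohomology.hochCochains₂ (-1)) : ∃ θ : A.Coh →ₗ[F] A.Coh,
    (∀ {i : ℕ} {x : A.Coh}, x ∈ A.cohomology.grading i →
      θ x ∈ A.cohomology.intGrading ((i : ℤ) + -1)) ∧
    ∀ x y, A.cohInt (θ x * y) = 2⁻¹ * A.cohInt (φ x y) := by
  obtain ⟨θ, hθ⟩ := A.exists_cohInt_mul_eq ((2⁻¹ : F) • φ.compr₂ A.cohInt)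
  replace hθ : ∀ x y, A.cohInt (θ x * y) = 2⁻¹ * A.cohInt (φ x y) := hθ
  refine ⟨θ, ?_, hθ⟩
  intro i x hx
  rcases Nat.eq_zero_or_pos i with rfl | hi
  · have : θ x = 0 := by
      refine A.eq_zero_of_cohInt fun y => ?_
      induction y using A.cohomology.hom_induction with
      | h0 => rw [mul_zero, map_zero]
      | hadd y y' hy hy' => rw [mul_add, map_add, hy, hy', add_zero]
      | hh j y hy =>
        by_cases hj : j = n + 1
        · rw [hj] at hy
          change y ∈ A.cohGrading (n + 1) at hy
          rw [cohGrading_eq_bot (by omega), Submodule.mem_bot] at hy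
          rw [hy, mul_zero, map_zero]
        · rw [hθ, cohInt_hochCochains₂ hφ hx hy (by omega), mul_zero]
    rw [this]
    exact zero_mem _
  · obtain ⟨m, rfl⟩ := Nat.exists_eq_succ_of_ne_zero hi.ne'
    have e : ((m + 1 : ℕ) : ℤ) + -1 = (m : ℤ) := by push_cast; ring
    rw [Nat.succ_eq_add_one, e, DGCA.intGrading_natCast]
    refine A.mem_cohGrading_of_cohInt fun j y hy hj => ?_
    rw [hθ, cohInt_hochCochains₂ hφ hx hy (by omega), mul_zero]

/-- A graded symmetric bilinear map `φ` of degree `-1` on the cohomology, with integral zero, whose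
Hochschild differential is `μ₃`. -/
structure IsNormalizedPrimitive (φ : A.Coh →ₗ[F] A.Coh →ₗ[F] A.Coh) : Prop where
  mem : φ ∈ A.cohomology.hochCochains₂ (-1)
  delta : ∀ x y z, h.mu₃ x y z =
    A.cohomology.signOp x * φ y z - φ (x * y) z + φ x (y * z) - φ x y * z
  symm : ∀ {i j : ℕ} {x y : A.Coh}, x ∈ A.cohGrading i → y ∈ A.cohGrading j →
    φ x y = (-1 : F) ^ (i * j) • φ y x
  int : ∀ x y, A.cohInt (φ x y) = 0

/-- After symmetrization, the integral of the primitive is removed by the Hochschild differential of `θ`;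
by symmetry the terms `± x θ(y)` and `θ(x) y` contribute one half of the integral each. -/
theorem exists_isNormalizedPrimitive [CharZero F]
    (hμ : h.mu₃ ∈ A.cohomology.hochCoboundaries₃ (-1)) : ∃ φ, h.IsNormalizedPrimitive φ := by
  obtain ⟨φ, hφ, hδ, hsymm⟩ :=
    DGCA.exists_symmetric_of_reverse hμ (fun hx hy hz => h.mu₃_reverse hx hy hz)
  obtain ⟨θ, hθ, hθI⟩ := exists_integral_correction hφ
  refine ⟨φ - A.cohomology.hochDifferential₁ θ, sub_mem hφ (DGCA.hochDifferential₁_mem hθ), ?_,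
    ?_, ?_⟩
  · intro x y z
    have e := DGCA.hochDifferential_hochDifferential₁ (H := A.cohomology) θ x y z
    rw [← sub_zero (h.mu₃ x y z), ← e, hδ]
    simp only [LinearMap.sub_apply, mul_sub, sub_mul]
    abel
  · intro i j x y hx hy
    rw [LinearMap.sub_apply, LinearMap.sub_apply, LinearMap.sub_apply, LinearMap.sub_apply,
      hsymm hx hy, DGCA.hochDifferential₁_comm (H := A.cohomology) hθ hx hy, smul_sub]
  · refine cohInt_hochCochains₂_eq_zero (sub_mem hφ (DGCA.hochDifferential₁_mem hθ)) ?_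
    intro i j x y hx hy hij
    -- In total degree `n + 1` the term `θ(xy)` vanishes.
    have h0 : x * y = 0 := by
      have := A.cohomology.mul_mem hx hy
      rw [hij] at this
      change x * y ∈ A.cohGrading (n + 1) at this
      rwa [cohGrading_eq_bot (by omega), Submodule.mem_bot] at this
    have e1 : (φ - A.cohomology.hochDifferential₁ θ) x y =
        φ x y - (A.cohomology.signOp x * θ y + θ x * y) := by
      have e2 : A.cohomology.hochDifferential₁ θ x y =
          A.cohomology.signOp x * θ y - θ (x * y) + θ x * y := rfl
      rw [LinearMap.sub_apply, LinearMap.sub_apply, e2, h0, map_zero, sub_zero]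
    rw [e1, map_sub, map_add, hθI,
      DGCA.signOp_mul_eq_of_hochCochains (H := A.cohomology) hθ hx hy, map_smul, hθI,
      hsymm hx hy, map_smul, smul_eq_mul, smul_eq_mul]
    ring

end AdaptedChoice

end PoincareDGCA

/-! ### The projection to a small model of the cohomology -/

namespace PoincareDGCA

variable {F : Type u} [Field F] {n : ℕ} {A : PoincareDGCA.{u, v} F n}

theorem sum_proj (a : A.carrier) : ∑ k ∈ Finset.range (n + 1), A.proj k a = a := by
  induction a using A.hom_induction with
  | h0 => simp
  | hadd a b ha hb => simp only [map_add, Finset.sum_add_distrib, ha, hb]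
  | hh k a ha =>
    by_cases hk : k ≤ n
    · rw [Finset.sum_eq_single_of_mem k (by simp; omega), A.proj_of_mem ha]
      exact fun l _ hl => A.proj_of_mem_ne ha hl.symm
    · rw [A.grading_eq_bot k (by omega), Submodule.mem_bot] at ha
      simp [ha]

variable (A) in
/-- A graded subspace which is closed under the differential, as a complex. -/
noncomputable abbrev subcomplex (W : Submodule F A.carrier) (hW : A.IsGraded W)
    (hd : ∀ a ∈ W, A.d a ∈ W) : BoundedComplex.{u, v} F where
  carrier := W
  proj k := (A.proj k).restrict (hW k)
  bound := n + 1
  proj_proj k a := Subtype.ext (A.proj_of_mem (A.proj_mem k a))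
  proj_proj_ne {k l} h a := Subtype.ext (A.proj_of_mem_ne (A.proj_mem k a) h)
  sum_proj a := Subtype.ext (by
    rw [AddSubmonoidClass.coe_finsetSum]
    exact sum_proj (a : A.carrier))
  d := A.d.restrict hd
  proj_succ_d k a := Subtype.ext (A.proj_d k a)
  proj_zero_d a := Subtype.ext (A.proj_zero_d a)
  d_d a := Subtype.ext (A.d_d a)

section Subcomplex

variable {W : Submodule F A.carrier} {hW : A.IsGraded W} {hd : ∀ a ∈ W, A.d a ∈ W}

theorem mem_subcomplex_gr {k : ℕ} {a : (A.subcomplex W hW hd).carrier} :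
    a ∈ (A.subcomplex W hW hd).gr k ↔ (a : A.carrier) ∈ A.grading k := by
  rw [BoundedComplex.mem_gr]
  refine ⟨fun h => ?_, fun h => Subtype.ext (A.proj_of_mem h)⟩
  have h' := congrArg Subtype.val h
  rw [← h']
  exact A.proj_mem k _

theorem coe_subcomplex_sign (a : (A.subcomplex W hW hd).carrier) :
    W.subtype ((A.subcomplex W hW hd).sign a) = A.signOp (W.subtype a) := by
  induction a using (BoundedComplex.hom_induction (E := A.subcomplex W hW hd)) with
  | h0 => simp only [map_zero]
  | hadd a b ha hb => simp only [map_add, ha, hb]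
  | hh k a ha =>
    have h : W.subtype a ∈ A.grading k := mem_subcomplex_gr.1 ha
    rw [BoundedComplex.sign_of_mem ha, A.signOp_of_mem h, map_smul]

end Subcomplex

namespace HodgeDecomposition

variable (D : A.HodgeDecomposition) (r : ℕ)

theorem int_mul_coex {w z : A.carrier} (hw : w ∈ D.harm ⊔ D.coex) (hz : z ∈ D.coex) :
    A.int (w * z) = 0 := by
  rw [← pairing_eq]
  exact D.orthogonal w hw z hz

theorem int_coex_mul {i j : ℕ} {w z : A.carrier} (hw : w ∈ D.harm ⊔ D.coex) (hz : z ∈ D.coex)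
    (hwi : w ∈ A.grading i) (hzj : z ∈ A.grading j) : A.int (z * w) = 0 := by
  rw [int_mul_comm hzj hwi, D.int_mul_coex hw hz, mul_zero]

theorem int_projHarm {k : ℕ} {a : A.carrier} (ha : a ∈ A.grading k) :
    A.int (D.projHarm a) = A.int a := by
  by_cases hk : k = n
  · subst hk
    have hd : A.d a = 0 := by
      have := A.d_mem ha
      rwa [A.grading_eq_bot (k + 1) (by omega), Submodule.mem_bot] at this
    conv_rhs => rw [D.homotopy a, hd, map_zero, add_zero, map_add, int_d, add_zero]
  · rw [int_of_mem_ne ha hk, int_of_mem_ne (D.projHarm_mem_grading ha) hk]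

theorem eq_zero_of_represents_zero {w : A.carrier} (hw : w ∈ D.harm) (h : A.Represents w 0) :
    w = 0 := by
  obtain ⟨c, hc⟩ := DGCA.represents_zero_iff.1 h
  rw [← D.projHarm_of_mem_harm hw, ← hc, D.projHarm_d]

theorem harm_eq_zero_of_lt (hA : A.IsConnected (r - 1)) {k : ℕ} {w : A.carrier} (hw : w ∈ D.harm)
    (hk : w ∈ A.grading k) (h1 : 1 ≤ k) (hkr : k < r) : w = 0 := by
  obtain ⟨x, hx⟩ := DGCA.exists_represents (D.d_of_mem_harm hw)
  have hx' := hx.mem_cohGrading hk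
  have hb : A.cohGrading k = ⊥ := hA.2 k h1 (by omega)
  rw [hb, Submodule.mem_bot] at hx'
  rw [hx'] at hx
  exact D.eq_zero_of_represents_zero hw hx

/-- By Poincaré duality, a harmonic element of degree larger than `n - r` vanishes if its integral
does. -/
theorem harm_eq_zero_of_int (hA : A.IsConnected (r - 1)) {k : ℕ} {w : A.carrier} (hw : w ∈ D.harm)
    (hk : w ∈ A.grading k) (hkr : n < k + r) (hI : A.int w = 0) : w = 0 := by
  obtain ⟨x, hx⟩ := DGCA.exists_represents (D.d_of_mem_harm hw)
  have hxk := hx.mem_cohGrading hk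
  suffices h : x = 0 by
    rw [h] at hx
    exact D.eq_zero_of_represents_zero hw hx
  refine A.eq_zero_of_cohInt fun y => ?_
  induction y using A.cohomology.hom_induction with
  | h0 => rw [mul_zero, map_zero]
  | hadd y y' hy hy' => rw [mul_add, map_add, hy, hy', add_zero]
  | hh j y hy =>
    by_cases hjn : k + j = n
    · rcases Nat.eq_zero_or_pos j with rfl | hj
      · obtain ⟨c, rfl⟩ := hA.exists_smul_one hy
        rw [mul_smul_comm, mul_one, map_smul, ← int_of_represents hx, hI, smul_zero]
      · have hb : A.cohomology.grading j = ⊥ := hA.2 j hj (by omega)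
        rw [hb, Submodule.mem_bot] at hy
        rw [hy, mul_zero, map_zero]
    · exact cohInt_of_mem_ne (A.cohomology.mul_mem hxk hy) hjn

variable (A) in
/-- The projection to the sum of the components of the degrees `k` with `2r - 1 ≤ k ≤ n - 2r`. -/
noncomputable def _root_.PoincareDGCA.window : A.carrier →ₗ[F] A.carrier :=
  ∑ k ∈ (Finset.range (n + 1)).filter (fun k => 2 * r ≤ k + 1 ∧ k + 2 * r ≤ n), A.proj k

theorem window_of_mem {k : ℕ} {a : A.carrier} (ha : a ∈ A.grading k) (h1 : 2 * r ≤ k + 1)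
    (h2 : k + 2 * r ≤ n) : A.window r a = a := by
  rw [window, LinearMap.sum_apply, Finset.sum_eq_single_of_mem k, A.proj_of_mem ha]
  · simp only [Finset.mem_filter, Finset.mem_range]
    omega
  · exact fun l _ hl => A.proj_of_mem_ne ha hl.symm

theorem window_of_mem_ne {k : ℕ} {a : A.carrier} (ha : a ∈ A.grading k)
    (h : ¬ (2 * r ≤ k + 1 ∧ k + 2 * r ≤ n)) : A.window r a = 0 := by
  rw [window, LinearMap.sum_apply]
  refine Finset.sum_eq_zero fun l hl => A.proj_of_mem_ne ha ?_
  rintro rfl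
  exact h (Finset.mem_filter.1 hl).2

theorem window_mem_grading {k : ℕ} {a : A.carrier} (ha : a ∈ A.grading k) :
    A.window r a ∈ A.grading k := by
  by_cases h : 2 * r ≤ k + 1 ∧ k + 2 * r ≤ n
  · rwa [window_of_mem r ha h.1 h.2]
  · rw [window_of_mem_ne r ha h]
    exact zero_mem _

theorem window_window (a : A.carrier) : A.window r (A.window r a) = A.window r a := by
  induction a using A.hom_induction with
  | h0 => simp
  | hadd a b ha hb => simp only [map_add, ha, hb]
  | hh k a ha =>
    by_cases h : 2 * r ≤ k + 1 ∧ k + 2 * r ≤ n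
    · rw [window_of_mem r ha h.1 h.2, window_of_mem r ha h.1 h.2]
    · rw [window_of_mem_ne r ha h, map_zero]

theorem window_mem_coex {z : A.carrier} (hz : z ∈ D.coex) : A.window r z ∈ D.coex := by
  rw [window, LinearMap.sum_apply]
  exact sum_mem fun k _ => D.proj_mem_coex hz k

/-- The part of `d⁻` with values in the degrees `k` with `2r - 1 ≤ k ≤ n - 2r`. -/
noncomputable def η : A.carrier →ₗ[F] A.carrier := A.window r ∘ₗ D.dMinus

theorem η_apply (a : A.carrier) : D.η r a = A.window r (D.dMinus a) := rfl

theorem η_mem_coex (a : A.carrier) : D.η r a ∈ D.coex := D.window_mem_coex r (D.dMinus_mem a)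

theorem η_mem_grading {k : ℕ} {a : A.carrier} (ha : a ∈ A.grading (k + 1)) :
    D.η r a ∈ A.grading k := window_mem_grading r (D.dMinus_mem_grading ha)

theorem η_of_mem {k : ℕ} {a : A.carrier} (ha : a ∈ A.grading k) (h1 : 2 * r ≤ k)
    (h2 : k + 2 * r ≤ n + 1) : D.η r a = D.dMinus a := by
  rcases Nat.eq_zero_or_pos k with rfl | hk
  · rw [η_apply, D.dMinus_of_mem_zero ha, map_zero]
  · obtain ⟨m, rfl⟩ := Nat.exists_eq_succ_of_ne_zero hk.ne'
    exact window_of_mem r (D.dMinus_mem_grading ha) (by omega) (by omega)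

theorem η_of_mem_ne {k : ℕ} {a : A.carrier} (ha : a ∈ A.grading k)
    (h : ¬ (2 * r ≤ k ∧ k + 2 * r ≤ n + 1)) : D.η r a = 0 := by
  rcases Nat.eq_zero_or_pos k with rfl | hk
  · rw [η_apply, D.dMinus_of_mem_zero ha, map_zero]
  · obtain ⟨m, rfl⟩ := Nat.exists_eq_succ_of_ne_zero hk.ne'
    exact window_of_mem_ne r (D.dMinus_mem_grading ha) (by omega)

theorem η_of_mem_harm {w : A.carrier} (hw : w ∈ D.harm) : D.η r w = 0 := by
  rw [η_apply, D.dMinus_of_mem_harm hw, map_zero]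

theorem η_of_mem_coex {w : A.carrier} (hw : w ∈ D.coex) : D.η r w = 0 := by
  rw [η_apply, D.dMinus_of_mem_coex hw, map_zero]

theorem η_d_η (a : A.carrier) : D.η r (A.d (D.η r a)) = D.η r a := by
  rw [η_apply, D.dMinus_d_of_mem_coex (D.η_mem_coex r a), η_apply, window_window]

theorem signOp_η (a : A.carrier) : A.signOp (D.η r a) = -D.η r (A.signOp a) := by
  induction a using A.hom_induction with
  | h0 => simp
  | hadd a b ha hb => simp only [map_add, ha, hb, neg_add]
  | hh k a ha =>
    rcases Nat.eq_zero_or_pos k with rfl | hk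
    · rw [A.signOp_of_mem ha, map_smul, η_apply, D.dMinus_of_mem_zero ha]
      simp
    · obtain ⟨m, rfl⟩ := Nat.exists_eq_succ_of_ne_zero hk.ne'
      rw [A.signOp_of_mem ha, A.signOp_of_mem (D.η_mem_grading r ha), map_smul,
        Nat.succ_eq_add_one, pow_succ]
      simp

theorem signOp_projHarm (a : A.carrier) : A.signOp (D.projHarm a) = D.projHarm (A.signOp a) := by
  induction a using A.hom_induction with
  | h0 => simp
  | hadd a b ha hb => simp only [map_add, ha, hb]
  | hh k a ha =>
    rw [A.signOp_of_mem ha, A.signOp_of_mem (D.projHarm_mem_grading ha), map_smul]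

/-- The projection to the harmonic elements of positive degree. -/
noncomputable def posHarm : A.carrier →ₗ[F] A.carrier := D.projHarm - A.proj 0 ∘ₗ D.projHarm

theorem posHarm_apply (a : A.carrier) :
    D.posHarm a = D.projHarm a - A.proj 0 (D.projHarm a) := rfl

theorem posHarm_mem (a : A.carrier) : D.posHarm a ∈ D.harm :=
  sub_mem (D.projHarm_mem a) (D.proj_mem_harm (D.projHarm_mem a) 0)

theorem posHarm_of_mem {k : ℕ} {a : A.carrier} (ha : a ∈ A.grading k) (hk : k ≠ 0) :
    D.posHarm a = D.projHarm a := by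
  rw [posHarm_apply, A.proj_of_mem_ne (D.projHarm_mem_grading ha) hk, sub_zero]

theorem posHarm_of_mem_zero {a : A.carrier} (ha : a ∈ A.grading 0) : D.posHarm a = 0 := by
  rw [posHarm_apply, A.proj_of_mem (D.projHarm_mem_grading ha), sub_self]

theorem posHarm_mem_grading {k : ℕ} {a : A.carrier} (ha : a ∈ A.grading k) :
    D.posHarm a ∈ A.grading k := by
  rcases eq_or_ne k 0 with rfl | hk
  · rw [D.posHarm_of_mem_zero ha]
    exact zero_mem _
  · rw [D.posHarm_of_mem ha hk]
    exact D.projHarm_mem_grading ha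

/-- The projection to the sum of the harmonic elements of positive degree, the elements of `coex`
whose degrees `k` satisfy `2r - 1 ≤ k ≤ n - 2r`, and the boundaries of the latter. -/
noncomputable def ρ : A.carrier →ₗ[F] A.carrier := D.posHarm + D.η r ∘ₗ A.d + A.d ∘ₗ D.η r

theorem ρ_apply (a : A.carrier) :
    D.ρ r a = D.posHarm a + D.η r (A.d a) + A.d (D.η r a) := rfl

theorem posHarm_d (a : A.carrier) : D.posHarm (A.d a) = 0 := by
  rw [posHarm_apply, D.projHarm_d, map_zero, sub_zero]

theorem posHarm_of_mem_coex {a : A.carrier} (ha : a ∈ D.coex) : D.posHarm a = 0 := by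
  rw [posHarm_apply, D.projHarm_of_mem_coex ha, map_zero, sub_zero]

theorem ρ_d (a : A.carrier) : D.ρ r (A.d a) = A.d (D.ρ r a) := by
  rw [ρ_apply, ρ_apply, D.posHarm_d, A.d_d, map_zero, map_add, map_add,
    D.d_of_mem_harm (D.posHarm_mem a), A.d_d]
  abel

theorem η_ρ (a : A.carrier) : D.η r (D.ρ r a) = D.η r a := by
  rw [ρ_apply, map_add, map_add, D.η_of_mem_harm r (D.posHarm_mem a),
    D.η_of_mem_coex r (D.η_mem_coex r _), η_d_η, zero_add, zero_add]

theorem ρ_η (a : A.carrier) : D.ρ r (D.η r a) = D.η r a := by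
  rw [ρ_apply, D.posHarm_of_mem_coex (D.η_mem_coex r _), η_d_η,
    D.η_of_mem_coex r (D.η_mem_coex r _), map_zero, zero_add, add_zero]

theorem projHarm_ρ (a : A.carrier) : D.projHarm (D.ρ r a) = D.posHarm a := by
  rw [ρ_apply, map_add, map_add, D.projHarm_d, D.projHarm_of_mem_coex (D.η_mem_coex r _),
    D.projHarm_of_mem_harm (D.posHarm_mem a), add_zero, add_zero]

theorem proj_zero_posHarm (a : A.carrier) : A.proj 0 (D.posHarm a) = 0 := by
  rw [posHarm_apply, map_sub, A.proj_of_mem (A.proj_mem 0 _), sub_self]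

theorem ρ_ρ (a : A.carrier) : D.ρ r (D.ρ r a) = D.ρ r a := by
  rw [D.ρ_apply r (D.ρ r a), posHarm_apply, projHarm_ρ, proj_zero_posHarm, ← ρ_d, η_ρ, η_ρ,
    sub_zero, ← ρ_apply]

theorem ρ_of_mem_harm {k : ℕ} {w : A.carrier} (hw : w ∈ D.harm) (hk : w ∈ A.grading k)
    (h0 : k ≠ 0) : D.ρ r w = w := by
  rw [ρ_apply, D.d_of_mem_harm hw, D.η_of_mem_harm r hw, D.posHarm_of_mem hk h0,
    D.projHarm_of_mem_harm hw]
  simp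

variable {r}

theorem ρ_of_mem_zero (hr : 1 < r) {a : A.carrier} (ha : a ∈ A.grading 0) : D.ρ r a = 0 := by
  rw [ρ_apply, D.posHarm_of_mem_zero ha, D.η_of_mem_ne r ha (by omega),
    D.η_of_mem_ne r (A.d_mem ha) (by omega)]
  simp

theorem ρ_mem_grading {k : ℕ} {a : A.carrier} (ha : a ∈ A.grading k) :
    D.ρ r a ∈ A.grading k := by
  rw [ρ_apply]
  refine add_mem (add_mem (D.posHarm_mem_grading ha) (D.η_mem_grading r (A.d_mem ha))) ?_
  rcases Nat.eq_zero_or_pos k with rfl | hk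
  · rw [η_apply, D.dMinus_of_mem_zero ha, map_zero, map_zero]
    exact zero_mem _
  · obtain ⟨m, rfl⟩ := Nat.exists_eq_succ_of_ne_zero hk.ne'
    exact A.d_mem (D.η_mem_grading r ha)

theorem proj_ρ (k : ℕ) (a : A.carrier) : A.proj k (D.ρ r a) = D.ρ r (A.proj k a) :=
  DGCA.map_proj_of_map_mem (X := A.toDGCA) (Y := A.toDGCA) (D.ρ r) D.ρ_mem_grading k a

/-- In degrees larger than `n - r`, the projection depends on the integral only. -/
theorem ρ_eq_zero_of_int (hr : 1 < r) (hA : A.IsConnected (r - 1)) {k : ℕ} {a : A.carrier}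
    (ha : a ∈ A.grading k) (hk : n < k + r) (hI : A.int a = 0) : D.ρ r a = 0 := by
  have h0 : D.projHarm a = 0 := D.harm_eq_zero_of_int r hA (D.projHarm_mem a)
    (D.projHarm_mem_grading ha) hk (by rw [D.int_projHarm ha, hI])
  rw [ρ_apply, posHarm_apply, h0, D.η_of_mem_ne r ha (by omega),
    D.η_of_mem_ne r (A.d_mem ha) (by omega)]
  simp

/-- In degrees not less than `3r - 1`, the projection is harmonic: the degrees of `η` end at
`n - 2r ≤ 3r - 3`. -/
theorem ρ_eq_projHarm (hn : n + 3 ≤ 5 * r) {k : ℕ} {a : A.carrier}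
    (ha : a ∈ A.grading k) (hk : 3 * r ≤ k + 1) : D.ρ r a = D.projHarm a := by
  rw [ρ_apply, D.posHarm_of_mem ha (by omega), D.η_of_mem_ne r ha (by omega),
    D.η_of_mem_ne r (A.d_mem ha) (by omega)]
  simp

end HodgeDecomposition

end PoincareDGCA

/-! ### The tame subalgebra -/

namespace PoincareDGCA

variable {F : Type u} [Field F] {n : ℕ}

namespace HodgeDecomposition

variable {A : PoincareDGCA.{u, v} F n} (D : A.HodgeDecomposition) (r : ℕ)

/-- The elements without component in degree zero whose components are harmonic in the degrees up to
`2r - 2` and belong to `harm ⊕ coex` in degree `2r - 1`. -/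
def tame : Submodule F A.carrier where
  carrier := {a | A.proj 0 a = 0 ∧ ∀ k, k < 2 * r →
    D.dMinus (A.proj k a) = 0 ∧ (k + 1 < 2 * r → A.d (A.proj k a) = 0)}
  add_mem' := by
    rintro a b ⟨h1, h2⟩ ⟨h3, h4⟩
    refine ⟨by rw [map_add, h1, h3, add_zero], fun k hk => ⟨?_, fun hk' => ?_⟩⟩
    · rw [map_add, map_add, (h2 k hk).1, (h4 k hk).1, add_zero]
    · rw [map_add, map_add, (h2 k hk).2 hk', (h4 k hk).2 hk', add_zero]
  zero_mem' := by simp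
  smul_mem' := by
    rintro c a ⟨h1, h2⟩
    refine ⟨by rw [map_smul, h1, smul_zero], fun k hk => ⟨?_, fun hk' => ?_⟩⟩
    · rw [map_smul, map_smul, (h2 k hk).1, smul_zero]
    · rw [map_smul, map_smul, (h2 k hk).2 hk', smul_zero]

theorem tame_isGraded : A.IsGraded (D.tame r) := by
  rintro l a ⟨h1, h2⟩
  have e : ∀ k, A.proj k (A.proj l a) = A.proj k a ∨ A.proj k (A.proj l a) = 0 := by
    intro k
    by_cases hk : l = k
    · subst hk
      exact Or.inl (A.proj_of_mem (A.proj_mem l a))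
    · exact Or.inr (A.proj_of_mem_ne (A.proj_mem l a) hk)
  refine ⟨(e 0).elim (fun h => by rw [h, h1]) id, fun k hk => ?_⟩
  rcases e k with h | h
  · rw [h]
    exact h2 k hk
  · rw [h]
    simp

variable {D r}

theorem dMinus_of_mem_tame {a : A.carrier} (ha : a ∈ D.tame r) {k : ℕ} (hk : a ∈ A.grading k)
    (h : k < 2 * r) : D.dMinus a = 0 := by
  have := (ha.2 k h).1
  rwa [A.proj_of_mem hk] at this

theorem d_of_mem_tame {a : A.carrier} (ha : a ∈ D.tame r) {k : ℕ} (hk : a ∈ A.grading k)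
    (h : k + 1 < 2 * r) : A.d a = 0 := by
  have := (ha.2 k (by omega)).2 h
  rwa [A.proj_of_mem hk] at this

theorem mem_tame_of_grading {a : A.carrier} {k : ℕ} (hk : a ∈ A.grading k) (hk0 : k ≠ 0)
    (h1 : k < 2 * r → D.dMinus a = 0) (h2 : k + 1 < 2 * r → A.d a = 0) : a ∈ D.tame r := by
  refine ⟨A.proj_of_mem_ne hk hk0, fun l hl => ?_⟩
  by_cases hkl : k = l
  · subst hkl
    rw [A.proj_of_mem hk]
    exact ⟨h1 hl, h2⟩
  · rw [A.proj_of_mem_ne hk hkl]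
    simp

theorem eq_zero_of_mem_tame (hA : A.IsConnected (r - 1)) {a : A.carrier} (ha : a ∈ D.tame r)
    {k : ℕ} (hk : a ∈ A.grading k) (h : k < r) : a = 0 := by
  rcases eq_or_ne k 0 with rfl | hk0
  · rw [← A.proj_of_mem hk, ha.1]
  · have e := D.homotopy a
    rw [dMinus_of_mem_tame ha hk (by omega), d_of_mem_tame ha hk (by omega), map_zero, map_zero,
      add_zero, add_zero] at e
    rw [e] at hk ⊢
    exact D.harm_eq_zero_of_lt r hA (D.projHarm_mem a) hk (by omega) h

theorem d_mem_tame {a : A.carrier} (ha : a ∈ D.tame r) : A.d a ∈ D.tame r := by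
  refine ⟨A.proj_zero_d a, fun k hk => ?_⟩
  cases k with
  | zero =>
    rw [A.proj_zero_d]
    simp
  | succ k =>
    rw [A.proj_d, (ha.2 k (by omega)).2 (by omega)]
    simp

theorem proj_mul_of_mem_tame (hA : A.IsConnected (r - 1)) {a b : A.carrier} (ha : a ∈ D.tame r)
    (hb : b ∈ D.tame r) {k : ℕ} (hk : k < 2 * r) : A.proj k (a * b) = 0 := by
  rw [← Submodule.mem_bot F]
  refine A.proj_mul_mem ⊥ k a b fun i j hij => ?_
  rw [Submodule.mem_bot]
  by_cases hi : i < r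
  · rw [eq_zero_of_mem_tame hA (D.tame_isGraded r i a ha) (A.proj_mem i a) hi, zero_mul]
  · rw [eq_zero_of_mem_tame hA (D.tame_isGraded r j b hb) (A.proj_mem j b) (by omega), mul_zero]

theorem mul_mem_tame (hr : 1 < r) (hA : A.IsConnected (r - 1)) {a b : A.carrier}
    (ha : a ∈ D.tame r) (hb : b ∈ D.tame r) : a * b ∈ D.tame r := by
  refine ⟨proj_mul_of_mem_tame hA ha hb (by omega), fun k hk => ?_⟩
  rw [proj_mul_of_mem_tame hA ha hb hk]
  simp

theorem ρ_mem_tame (hr : 1 < r) (a : A.carrier) : D.ρ r a ∈ D.tame r := by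
  rw [← sum_proj a, map_sum]
  refine sum_mem fun k _ => ?_
  have ha := A.proj_mem k a
  rcases eq_or_ne k 0 with rfl | hk0
  · rw [D.ρ_of_mem_zero hr ha]
    exact zero_mem _
  · refine mem_tame_of_grading (D.ρ_mem_grading ha) hk0 (fun h => ?_) fun h => ?_
    · rw [ρ_apply, map_add, map_add, D.dMinus_of_mem_harm (D.posHarm_mem _),
        D.dMinus_of_mem_coex (D.η_mem_coex r _), D.η_of_mem_ne r ha (by omega)]
      simp
    · rw [← ρ_d, ρ_apply, D.posHarm_d, D.η_of_mem_ne r (A.d_mem ha) (by omega), A.d_d]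
      simp

/-- The kernel of `ρ` on the tame elements is an ideal: the difference of `t` and `ρ t` involves
only coexact elements of degree larger than `n - 2r` and boundaries of such elements, and their
products with tame elements have degree larger than `n - r` and integral zero. -/
theorem ρ_mul_ρ_of_grading (hr : 1 < r) (hn : n + 3 ≤ 5 * r) (hA : A.IsConnected (r - 1))
    {s t : A.carrier} (hs : s ∈ D.tame r) (ht : t ∈ D.tame r) {j k : ℕ} (hj : s ∈ A.grading j)
    (hk : t ∈ A.grading k) : D.ρ r (s * D.ρ r t) = D.ρ r (s * t) := by
  by_cases hjr : j < r
  · rw [eq_zero_of_mem_tame hA hs hj hjr, zero_mul, zero_mul]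
  by_cases hkr : k < r
  · rw [eq_zero_of_mem_tame hA ht hk hkr, map_zero]
  have e : D.ρ r t = t + A.d (D.η r t - D.dMinus t) + (D.η r (A.d t) - D.dMinus (A.d t)) := by
    have h := D.homotopy t
    rw [ρ_apply, D.posHarm_of_mem hk (by omega), map_sub]
    have aux : ∀ p x y x' y' u : A.carrier, u = p + x + y →
        p + y' + x' = u + (x' - x) + (y' - y) := by
      rintro p x y x' y' _ rfl
      abel
    exact aux _ _ _ _ _ _ h
  have hdk := A.d_mem hk
  have h1 : D.ρ r (s * A.d (D.η r t - D.dMinus t)) = 0 := by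
    by_cases hw : 2 * r ≤ k ∧ k + 2 * r ≤ n + 1
    · rw [D.η_of_mem r hk hw.1 hw.2, sub_self, map_zero, mul_zero, map_zero]
    rw [D.η_of_mem_ne r hk hw]
    by_cases hk2 : k < 2 * r
    · rw [dMinus_of_mem_tame ht hk hk2, sub_zero, map_zero, mul_zero, map_zero]
    obtain ⟨m, rfl⟩ := Nat.exists_eq_succ_of_ne_zero (show k ≠ 0 by omega)
    have hmem : s * A.d (0 - D.dMinus t) ∈ A.grading (j + (m + 1)) :=
      A.mul_mem hj (A.d_mem (sub_mem (zero_mem _) (D.dMinus_mem_grading hk)))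
    refine D.ρ_eq_zero_of_int hr hA hmem (by omega) ?_
    by_cases hjk : j + (m + 1) = n
    · exact int_mul_d (d_of_mem_tame hs hj (by omega))
    · exact int_of_mem_ne hmem hjk
  have h2 : D.ρ r (s * (D.η r (A.d t) - D.dMinus (A.d t))) = 0 := by
    by_cases hw : 2 * r ≤ k + 1 ∧ k + 1 + 2 * r ≤ n + 1
    · rw [D.η_of_mem r hdk hw.1 hw.2, sub_self, mul_zero, map_zero]
    rw [D.η_of_mem_ne r hdk hw]
    by_cases hk2 : k + 1 < 2 * r
    · rw [d_of_mem_tame ht hk hk2, map_zero, sub_zero, mul_zero, map_zero]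
    have hmem : s * (0 - D.dMinus (A.d t)) ∈ A.grading (j + k) :=
      A.mul_mem hj (sub_mem (zero_mem _) (D.dMinus_mem_grading hdk))
    refine D.ρ_eq_zero_of_int hr hA hmem (by omega) ?_
    by_cases hjk : j + k = n
    · refine D.int_mul_coex ?_ (sub_mem (zero_mem _) (D.dMinus_mem _))
      have hs' := D.homotopy s
      rw [dMinus_of_mem_tame hs hj (by omega), map_zero, add_zero] at hs'
      rw [hs']
      exact add_mem (Submodule.mem_sup_left (D.projHarm_mem s))
        (Submodule.mem_sup_right (D.dMinus_mem _))
    · exact int_of_mem_ne hmem hjk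
  rw [e, mul_add, mul_add, map_add, map_add, h1, h2, add_zero, add_zero]

theorem ρ_mul_ρ (hr : 1 < r) (hn : n + 3 ≤ 5 * r) (hA : A.IsConnected (r - 1))
    {s t : A.carrier} (hs : s ∈ D.tame r) (ht : t ∈ D.tame r) :
    D.ρ r (s * D.ρ r t) = D.ρ r (s * t) := by
  have h : ∀ j k, D.ρ r (A.proj j s * D.ρ r (A.proj k t)) = D.ρ r (A.proj j s * A.proj k t) :=
    fun j k => ρ_mul_ρ_of_grading hr hn hA (D.tame_isGraded r j s hs) (D.tame_isGraded r k t ht)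
      (A.proj_mem j s) (A.proj_mem k t)
  rw [← sum_proj s, ← sum_proj t]
  simp only [map_sum, Finset.sum_mul, Finset.mul_sum, h]

theorem ρ_ρ_mul (hr : 1 < r) (hn : n + 3 ≤ 5 * r) (hA : A.IsConnected (r - 1))
    {s t : A.carrier} (hs : s ∈ D.tame r) (ht : t ∈ D.tame r) :
    D.ρ r (D.ρ r s * t) = D.ρ r (s * t) := by
  have h : ∀ j k, D.ρ r (D.ρ r (A.proj j s) * A.proj k t) = D.ρ r (A.proj j s * A.proj k t) := by
    intro j k
    have hj := A.proj_mem j s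
    have hk := A.proj_mem k t
    rw [A.graded_comm (D.ρ_mem_grading hj) hk, A.graded_comm hj hk, map_smul, map_smul,
      ρ_mul_ρ_of_grading hr hn hA (D.tame_isGraded r k t ht) (D.tame_isGraded r j s hs) hk hj]
  rw [← sum_proj s, ← sum_proj t]
  simp only [map_sum, Finset.sum_mul, Finset.mul_sum, h]

variable (D r)

/-- The image of the projection `ρ`, a subcomplex which computes the cohomology in positive
degrees. -/
noncomputable def model : Submodule F A.carrier := LinearMap.range (D.ρ r)

theorem mem_model {a : A.carrier} : a ∈ D.model r ↔ D.ρ r a = a :=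
  ⟨by rintro ⟨b, rfl⟩; exact D.ρ_ρ r b, fun h => ⟨a, h⟩⟩

theorem model_isGraded : A.IsGraded (D.model r) := by
  rintro k _ ⟨a, rfl⟩
  exact ⟨A.proj k a, (D.proj_ρ k a).symm⟩

theorem d_mem_model : ∀ a ∈ D.model r, A.d a ∈ D.model r := by
  rintro _ ⟨a, rfl⟩
  exact ⟨A.d a, D.ρ_d r a⟩

/-- The complex of the tame elements. -/
noncomputable abbrev tameComplex : BoundedComplex.{u, v} F :=
  A.subcomplex (D.tame r) (D.tame_isGraded r) fun _ => d_mem_tame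

/-- The image of `ρ`, as a complex. -/
noncomputable abbrev modelComplex : BoundedComplex.{u, v} F :=
  A.subcomplex (D.model r) (D.model_isGraded r) (D.d_mem_model r)

variable {D r}

/-- The product of the tame elements. -/
noncomputable def tameProduct (hr : 1 < r) (hA : A.IsConnected (r - 1)) :
    BoundedComplex.CommProduct (D.tameComplex r) where
  mul := LinearMap.mk₂ F (fun a b : D.tame r => (⟨a * b, mul_mem_tame hr hA a.2 b.2⟩ : D.tame r))
    (fun _ _ _ => Subtype.ext (add_mul _ _ _)) (fun _ _ _ => Subtype.ext (smul_mul_assoc _ _ _))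
    (fun _ _ _ => Subtype.ext (mul_add _ _ _)) (fun _ _ _ => Subtype.ext (mul_smul_comm _ _ _))
  mul_mem ha hb := mem_subcomplex_gr.2
    (A.mul_mem (mem_subcomplex_gr.1 ha) (mem_subcomplex_gr.1 hb))
  assoc a b c := Subtype.ext (mul_assoc (a : A.carrier) b c)
  comm ha hb := Subtype.ext (A.graded_comm (mem_subcomplex_gr.1 ha) (mem_subcomplex_gr.1 hb))
  leibniz ha b := Subtype.ext (A.leibniz (mem_subcomplex_gr.1 ha) (b : A.carrier))

theorem posHarm_of_mem_tame {a : A.carrier} (ha : a ∈ D.tame r) : D.posHarm a = D.projHarm a := by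
  rw [posHarm_apply, ← projHarm_proj, ha.1, map_zero, sub_zero]

theorem dMinus_mem_tame (hr : 1 < r) {a : A.carrier} (ha : a ∈ D.tame r) :
    D.dMinus a ∈ D.tame r := by
  refine ⟨?_, fun k hk => ⟨?_, fun hk' => ?_⟩⟩
  · rw [← dMinus_proj_succ, (ha.2 1 (by omega)).1]
  · rw [← dMinus_proj_succ, D.dMinus_of_mem_coex (D.dMinus_mem _)]
  · rw [← dMinus_proj_succ, (ha.2 (k + 1) hk').1, map_zero]

/-- An exact tame element is the differential of a tame element. -/
theorem exists_tame_primitive (hr : 1 < r) {a : A.carrier} (ha : a ∈ D.tame r) (hd : A.d a = 0)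
    (hp : D.projHarm a = 0) : ∃ b ∈ D.tame r, A.d b = a := by
  refine ⟨D.dMinus a, dMinus_mem_tame hr ha, ?_⟩
  have h := D.homotopy a
  rw [hd, hp, map_zero, zero_add, add_zero] at h
  exact h.symm

theorem harm_mem_tame {w : A.carrier} (hw : w ∈ D.harm) : w - A.proj 0 w ∈ D.tame r := by
  have h : w - A.proj 0 w ∈ D.harm := sub_mem hw (D.proj_mem_harm hw 0)
  refine ⟨by rw [map_sub, A.proj_of_mem (A.proj_mem 0 w), sub_self], fun k _ => ⟨?_, fun _ => ?_⟩⟩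
  · exact D.dMinus_of_mem_harm (D.proj_mem_harm h k)
  · exact D.d_of_mem_harm (D.proj_mem_harm h k)

end HodgeDecomposition

end PoincareDGCA

/-! ### Quasi-isomorphisms between the tame subalgebra, the model and the cohomology -/

namespace PoincareDGCA

variable {F : Type u} [Field F] {n : ℕ}

theorem eq_zero_of_smul_one {A : PoincareDGCA.{u, v} F n} {m : ℕ} (hA : A.IsConnected m) {c : F}
    (h : c • (1 : A.Coh) = 0) : c = 0 := by
  by_contra hc
  have h1 : (1 : A.Coh) = 0 := by
    rw [← one_smul F (1 : A.Coh), ← inv_mul_cancel₀ hc, mul_smul, h, smul_zero]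
  have hs : ∀ x : A.Coh, x = 0 := fun x => by rw [← mul_one x, h1, mul_zero]
  have h0 : A.cohomology.grading 0 = ⊥ := (Submodule.eq_bot_iff _).2 fun x _ => hs x
  have := hA.1
  rw [h0, finrank_bot] at this
  exact zero_ne_one this

namespace HodgeDecomposition

section Model

variable {A : PoincareDGCA.{u, v} F n} {D : A.HodgeDecomposition} {r : ℕ}

theorem posHarm_of_mem_model {a : A.carrier} (ha : a ∈ D.model r) :
    D.posHarm a = D.projHarm a := by
  have h := (D.mem_model r).1 ha
  have h2 := D.projHarm_ρ r a
  rw [h] at h2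
  exact h2.symm

theorem model_le_tame (hr : 1 < r) : D.model r ≤ D.tame r := by
  rintro _ ⟨a, rfl⟩
  exact ρ_mem_tame hr a

theorem harmClass_congr {a b : A.carrier} (h : D.projHarm a = D.projHarm b) :
    D.harmClass a = D.harmClass b := by
  have h1 := D.represents_harmClass a
  rw [h] at h1
  exact h1.eq (D.represents_harmClass b)

theorem projHarm_mem_tame {a : A.carrier} (ha : a ∈ D.model r) : D.projHarm a ∈ D.tame r := by
  rw [← posHarm_of_mem_model ha]
  exact harm_mem_tame (D.projHarm_mem a)

theorem harmClass_mul_model (hr : 1 < r) (hA : A.IsConnected (r - 1)) {a b : A.carrier}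
    (ha : a ∈ D.model r) (hb : b ∈ D.model r) :
    D.harmClass (D.ρ r (D.projHarm a * D.projHarm b)) = D.harmClass a * D.harmClass b := by
  have h := posHarm_of_mem_tame (mul_mem_tame hr hA (projHarm_mem_tame ha) (projHarm_mem_tame hb))
  rw [← D.projHarm_ρ r] at h
  rw [harmClass_congr h]
  exact D.harmClass_eq ((D.represents_harmClass a).mul (D.represents_harmClass b))

theorem harmClass_mem {k : ℕ} {a : A.carrier} (ha : a ∈ A.grading k) :
    D.harmClass a ∈ A.cohGrading k :=
  (D.represents_harmClass a).mem_cohGrading (D.projHarm_mem_grading ha)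

end Model

variable {A : PoincareDGCA.{u, u} F n} {D : A.HodgeDecomposition} {r : ℕ}

/-- The inclusion of the tame elements. -/
noncomputable def tameHom (hr : 1 < r) (hA : A.IsConnected (r - 1)) :
    DGCA.Hom (tameProduct (D := D) hr hA).toDGCA A.toDGCA :=
  (tameProduct (D := D) hr hA).lift (X := A.toDGCA) (D.tame r).subtype (fun _ _ => rfl)
    (fun ha => mem_subcomplex_gr.1 ha) (fun _ => rfl)

theorem tameHom_isQuasiIso (hr : 1 < r) (hA : A.IsConnected (r - 1)) :
    (tameHom (D := D) hr hA).IsQuasiIso := by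
  apply DGCA.Hom.isQuasiIso_of
  · rintro ⟨c, a⟩ hd ⟨e, he⟩
    have hda : A.d a.1 = 0 := congrArg (fun x => ((Prod.snd x : D.tame r) : A.carrier)) hd
    replace he : A.d e = c • (1 : A.carrier) + a.1 := he
    have h0 := congrArg (A.proj 0) he
    rw [A.proj_zero_d, map_add, a.2.1, add_zero, map_smul, A.proj_of_mem A.one_mem] at h0
    have hc : c = 0 := by
      refine eq_zero_of_smul_one hA ?_
      have h1 := DGCA.Represents.smul c (DGCA.represents_one (X := A.toDGCA))
      rw [← h0] at h1
      exact h1.eq DGCA.represents_zero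
    rw [← h0, zero_add] at he
    obtain ⟨b, hb, hb'⟩ := exists_tame_primitive hr a.2 hda (by rw [← he, D.projHarm_d])
    exact ⟨((0 : F), (⟨b, hb⟩ : D.tame r)), Prod.ext hc.symm (Subtype.ext hb')⟩
  · intro b hb
    have hw : A.d b = 0 := hb
    obtain ⟨x, hx⟩ := DGCA.exists_represents
      (D.d_of_mem_harm (D.proj_mem_harm (D.projHarm_mem b) 0))
    obtain ⟨c, rfl⟩ := hA.exists_smul_one (hx.mem_cohGrading (A.proj_mem 0 _))
    obtain ⟨e, he⟩ := hx.exists_d_eq_sub (DGCA.represents_one.smul c)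
    refine ⟨(c, (⟨_, harm_mem_tame (D.projHarm_mem b)⟩ : D.tame r)),
      Prod.ext rfl (Subtype.ext ?_), D.dMinus b + e, ?_⟩
    · change A.d (D.projHarm b - A.proj 0 (D.projHarm b)) = 0
      rw [map_sub, D.d_of_mem_harm (D.projHarm_mem b),
        D.d_of_mem_harm (D.proj_mem_harm (D.projHarm_mem b) 0), sub_zero]
    · change A.d (D.dMinus b + e) =
        b - (c • (1 : A.carrier) + (D.projHarm b - A.proj 0 (D.projHarm b)))
      have hb' := D.homotopy b
      rw [hw, map_zero, add_zero] at hb'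
      conv_rhs => rw [hb']
      simp only [map_add, D.projHarm_d, D.projHarm_of_mem_harm (D.projHarm_mem b), he, add_zero]
      abel

variable (D r) in
/-- The projection `ρ` as a map to its image. -/
noncomputable def toModel : A.carrier →ₗ[F] D.model r :=
  (D.ρ r).codRestrict (D.model r) fun a => ⟨a, rfl⟩

/-- The projection from the tame elements to the model, for the product induced by `ρ`. -/
noncomputable def modelHom (hr : 1 < r) (hn : n + 3 ≤ 5 * r) (hA : A.IsConnected (r - 1))
    (P : BoundedComplex.CommProduct (D.modelComplex r))
    (hP : ∀ a b : D.model r, (D.model r).subtype (P.mul a b) = D.ρ r (a * b)) :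
    DGCA.Hom (tameProduct (D := D) hr hA).toDGCA P.toDGCA :=
  (tameProduct (D := D) hr hA).lift (X := P.toDGCA)
    (LinearMap.inr F F (D.model r) ∘ₗ D.toModel r ∘ₗ (D.tame r).subtype)
    (fun a b => Prod.ext (zero_mul (0 : F)).symm (Subtype.ext (by
      have h := hP (D.toModel r a) (D.toModel r b)
      have h2 : D.ρ r (D.ρ r a * D.ρ r b) = D.ρ r (a * b) := by
        rw [ρ_ρ_mul hr hn hA a.2 (ρ_mem_tame hr _), ρ_mul_ρ hr hn hA a.2 b.2]
      change D.ρ r (a * b) = ((((0 : F) • D.toModel r b.1 + (0 : F) • D.toModel r a.1 +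
        P.mul (D.toModel r a) (D.toModel r b) : D.model r)) : A.carrier)
      rw [zero_smul, zero_smul, zero_add, zero_add]
      exact (h.trans h2).symm)))
    (fun ha => ⟨fun _ => rfl, mem_subcomplex_gr.2 (D.ρ_mem_grading (mem_subcomplex_gr.1 ha))⟩)
    (fun a => Prod.ext rfl (Subtype.ext (D.ρ_d r a)))

theorem modelHom_apply (hr : 1 < r) (hn : n + 3 ≤ 5 * r) (hA : A.IsConnected (r - 1))
    (P : BoundedComplex.CommProduct (D.modelComplex r))
    (hP : ∀ a b : D.model r, (D.model r).subtype (P.mul a b) = D.ρ r (a * b)) (c : F)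
    (a : D.tame r) :
    (modelHom hr hn hA P hP).toAlgHom (c, a) = (c, D.toModel r a) := by
  change (c • ((1 : F), (0 : D.model r)) + ((0 : F), D.toModel r a)) = _
  simp

theorem modelHom_isQuasiIso (hr : 1 < r) (hn : n + 3 ≤ 5 * r) (hA : A.IsConnected (r - 1))
    (P : BoundedComplex.CommProduct (D.modelComplex r))
    (hP : ∀ a b : D.model r, (D.model r).subtype (P.mul a b) = D.ρ r (a * b)) :
    (modelHom hr hn hA P hP).IsQuasiIso := by
  apply DGCA.Hom.isQuasiIso_of
  · rintro ⟨c, a⟩ hd ⟨⟨c', e⟩, he⟩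
    have hda : A.d a.1 = 0 := congrArg (fun x => ((Prod.snd x : D.tame r) : A.carrier)) hd
    have he' := he.trans (modelHom_apply hr hn hA P hP c a)
    have hc : (0 : F) = c := congrArg Prod.fst he'
    have he2 : A.d e.1 = D.ρ r a.1 :=
      congrArg (fun x => ((Prod.snd x : D.model r) : A.carrier)) he'
    obtain ⟨b, hb, hb'⟩ := exists_tame_primitive hr a.2 hda (by
      rw [← posHarm_of_mem_tame a.2, ← D.projHarm_ρ r, ← he2, D.projHarm_d])
    exact ⟨((0 : F), (⟨b, hb⟩ : D.tame r)), Prod.ext hc (Subtype.ext hb')⟩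
  · rintro ⟨c, b⟩ hd
    have hdb : A.d b.1 = 0 := congrArg (fun x => ((Prod.snd x : D.model r) : A.carrier)) hd
    refine ⟨(c, (⟨b.1, model_le_tame hr b.2⟩ : D.tame r)),
      Prod.ext rfl (Subtype.ext hdb), 0, ?_⟩
    refine (map_zero _).trans (sub_eq_zero.2 (Eq.symm ?_)).symm
    refine (modelHom_apply hr hn hA P hP c _).trans (Prod.ext rfl (Subtype.ext ?_))
    exact (D.mem_model r).1 b.2

/-- The map from the model to the cohomology, for the product induced by the product of harmonic
parts. -/
noncomputable def cohomologyHom (hr : 1 < r) (hA : A.IsConnected (r - 1))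
    (P : BoundedComplex.CommProduct (D.modelComplex r))
    (hP : ∀ a b : D.model r,
      (D.model r).subtype (P.mul a b) = D.ρ r (D.projHarm a * D.projHarm b)) :
    DGCA.Hom P.toDGCA A.cohomology :=
  P.lift (X := A.cohomology) (D.harmClass ∘ₗ (D.model r).subtype)
    (fun a b => (congrArg D.harmClass (hP a b)).trans (harmClass_mul_model hr hA a.2 b.2))
    (fun ha => harmClass_mem (mem_subcomplex_gr.1 ha))
    (fun a => D.harmClass_d a.1)

theorem cohomologyHom_isQuasiIso (hr : 1 < r) (hA : A.IsConnected (r - 1))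
    (P : BoundedComplex.CommProduct (D.modelComplex r))
    (hP : ∀ a b : D.model r,
      (D.model r).subtype (P.mul a b) = D.ρ r (D.projHarm a * D.projHarm b)) :
    (cohomologyHom hr hA P hP).IsQuasiIso := by
  apply DGCA.Hom.isQuasiIso_of
  · rintro ⟨c, a⟩ hd ⟨e, he⟩
    have hda : A.d a.1 = 0 := congrArg (fun x => ((Prod.snd x : D.model r) : A.carrier)) hd
    replace he : (0 : A.Coh) = c • (1 : A.Coh) + D.harmClass a.1 := he
    have h0 := congrArg (A.cohProj 0) he
    have h1 : A.cohProj 0 (D.harmClass a.1) = 0 := by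
      have h2 := (D.represents_harmClass a.1).proj 0
      rw [← posHarm_of_mem_model a.2, D.proj_zero_posHarm] at h2
      exact h2.eq DGCA.represents_zero
    rw [map_zero, map_add, h1, add_zero, map_smul, A.cohProj_of_mem A.cohomology.one_mem] at h0
    have hc : c = 0 := eq_zero_of_smul_one hA h0.symm
    rw [← h0, zero_add] at he
    have hp : D.projHarm a.1 = 0 := by
      refine D.eq_zero_of_represents_zero (D.projHarm_mem _) ?_
      rw [he]
      exact D.represents_harmClass a.1
    refine ⟨((0 : F), (⟨D.η r a.1, (D.mem_model r).2 (D.ρ_η r _)⟩ : D.model r)),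
      Prod.ext hc.symm (Subtype.ext ?_)⟩
    change A.d (D.η r a.1) = a.1
    conv_rhs => rw [← (D.mem_model r).1 a.2]
    rw [ρ_apply, hda, map_zero, posHarm_apply, hp]
    simp
  · intro y _
    obtain ⟨c, hc⟩ := hA.exists_smul_one (A.cohProj_mem 0 y)
    obtain ⟨z, hz⟩ := A.cls_surjective y
    have hw : A.Represents (D.projHarm z) y := by
      have h1 : A.Represents z y := hz ▸ DGCA.represents_cls z
      rw [← D.harmClass_eq h1]
      exact D.represents_harmClass z.1
    set w := D.projHarm z with hwdef
    have hwm : w ∈ D.harm := D.projHarm_mem _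
    have ha : w - A.proj 0 w ∈ D.harm := sub_mem hwm (D.proj_mem_harm hwm 0)
    have hρ : D.ρ r (w - A.proj 0 w) = w - A.proj 0 w := by
      rw [ρ_apply, D.d_of_mem_harm ha, D.η_of_mem_harm r ha,
        posHarm_of_mem_tame (harm_mem_tame (r := r) hwm), D.projHarm_of_mem_harm ha]
      simp
    have hcl : D.harmClass (w - A.proj 0 w) = y - A.cohProj 0 y := D.harmClass_eq (hw.sub (hw.proj 0))
    refine ⟨(c, (⟨_, (D.mem_model r).2 hρ⟩ : D.model r)),
      Prod.ext rfl (Subtype.ext (D.d_of_mem_harm ha)), 0, ?_⟩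
    refine (map_zero _).trans (sub_eq_zero.2 (Eq.symm ?_)).symm
    change c • (1 : A.Coh) + D.harmClass (w - A.proj 0 w) = y
    rw [hcl, ← hc]
    abel

end HodgeDecomposition

end PoincareDGCA

/-! ### The two products on the model -/

namespace PoincareDGCA

variable {F : Type u} [Field F] {n : ℕ}

/-- The hypotheses on the connectivity and the dimension: `A` is `(r - 1)`-connected for some `r > 1`
and `n ≤ 5r - 3`. -/
structure IsHighlyConnected (A : PoincareDGCA.{u, v} F n) (r : ℕ) : Prop where
  one_lt : 1 < r
  le : n + 3 ≤ 5 * r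
  connected : A.IsConnected (r - 1)

namespace HodgeDecomposition

variable {A : PoincareDGCA.{u, v} F n} {D : A.HodgeDecomposition} {r : ℕ}

theorem model_decomposition {a : A.carrier} (ha : a ∈ D.model r) :
    a = D.projHarm a + D.η r (A.d a) + A.d (D.η r a) := by
  conv_lhs => rw [← (D.mem_model r).1 ha, ρ_apply]
  rw [posHarm_of_mem_model ha]

theorem eq_zero_of_mem_model (hA : A.IsHighlyConnected r) {a : A.carrier} (ha : a ∈ D.model r)
    {k : ℕ} (hk : a ∈ A.grading k) (h : k < r) : a = 0 :=
  eq_zero_of_mem_tame hA.connected (model_le_tame hA.one_lt ha) hk h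

theorem projHarm_eq_self {a : A.carrier} (ha : a ∈ D.model r) {k : ℕ} (hk : a ∈ A.grading k)
    (h : k + 1 < 2 * r) : D.projHarm a = a := by
  have e := model_decomposition ha
  rw [D.η_of_mem_ne r hk (by omega), D.η_of_mem_ne r (A.d_mem hk) (by omega), map_zero, add_zero,
    add_zero] at e
  exact e.symm

/-- Such a product has degree at least `4r - 2 > n - r`, and integral zero by the orthogonality of the
coexact elements. -/
theorem ρ_η_mul_η (hA : A.IsHighlyConnected r) {i j : ℕ} {u v : A.carrier} (hu : u ∈ A.grading i)
    (hv : v ∈ A.grading j) : D.ρ r (D.η r u * D.η r v) = 0 := by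
  by_cases hi : 2 * r ≤ i ∧ i + 2 * r ≤ n + 1
  swap
  · rw [D.η_of_mem_ne r hu hi, zero_mul, map_zero]
  by_cases hj : 2 * r ≤ j ∧ j + 2 * r ≤ n + 1
  swap
  · rw [D.η_of_mem_ne r hv hj, mul_zero, map_zero]
  have h1 := hA.one_lt
  have h2 := hA.le
  obtain ⟨i, rfl⟩ := Nat.exists_eq_succ_of_ne_zero (show i ≠ 0 by omega)
  obtain ⟨j, rfl⟩ := Nat.exists_eq_succ_of_ne_zero (show j ≠ 0 by omega)
  exact D.ρ_eq_zero_of_int h1 hA.connected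
    (A.mul_mem (D.η_mem_grading r hu) (D.η_mem_grading r hv)) (by omega)
    (D.int_mul_coex (Submodule.mem_sup_right (D.η_mem_coex r u)) (D.η_mem_coex r v))

theorem ρ_harm_mul_η (hA : A.IsHighlyConnected r) {i j : ℕ} {w u : A.carrier} (hw : w ∈ D.harm)
    (hwi : w ∈ A.grading i) (hu : u ∈ A.grading j) (hi : 2 * r ≤ i + 1) :
    D.ρ r (w * D.η r u) = 0 := by
  by_cases hj : 2 * r ≤ j ∧ j + 2 * r ≤ n + 1
  swap
  · rw [D.η_of_mem_ne r hu hj, mul_zero, map_zero]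
  have h1 := hA.one_lt
  have h2 := hA.le
  obtain ⟨j, rfl⟩ := Nat.exists_eq_succ_of_ne_zero (show j ≠ 0 by omega)
  exact D.ρ_eq_zero_of_int h1 hA.connected (A.mul_mem hwi (D.η_mem_grading r hu)) (by omega)
    (D.int_mul_coex (Submodule.mem_sup_left hw) (D.η_mem_coex r u))

theorem ρ_harm_mul_d_η (hA : A.IsHighlyConnected r) {i j : ℕ} {w u : A.carrier} (hw : w ∈ D.harm)
    (hwi : w ∈ A.grading i) (hu : u ∈ A.grading j) (hi : r ≤ i) :
    D.ρ r (w * A.d (D.η r u)) = 0 := by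
  by_cases hj : 2 * r ≤ j ∧ j + 2 * r ≤ n + 1
  swap
  · rw [D.η_of_mem_ne r hu hj, map_zero, mul_zero, map_zero]
  have h1 := hA.one_lt
  obtain ⟨j, rfl⟩ := Nat.exists_eq_succ_of_ne_zero (show j ≠ 0 by omega)
  have e : w * A.d (D.η r u) = A.d (A.signOp w * D.η r u) := by
    rw [A.leibniz_signOp, A.signOp_signOp, A.d_signOp, D.d_of_mem_harm hw, map_zero, neg_zero,
      zero_mul, zero_add]
  rw [D.ρ_eq_projHarm hA.le (A.mul_mem hwi (A.d_mem (D.η_mem_grading r hu))) (by omega), e,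
    D.projHarm_d]

/-- Integration by parts. -/
theorem ρ_d_η_mul_η (hA : A.IsHighlyConnected r) {i j : ℕ} {u v : A.carrier} (hu : u ∈ A.grading i)
    (hv : v ∈ A.grading j) :
    D.ρ r (A.d (D.η r u) * D.η r v) = -D.ρ r (A.signOp (D.η r u) * A.d (D.η r v)) := by
  rw [eq_neg_iff_add_eq_zero, ← map_add, ← A.leibniz_signOp, D.ρ_d, ρ_η_mul_η hA hu hv, map_zero]

variable (D r)

/-- The product of the harmonic parts, projected to the model. -/
noncomputable def harmMul : A.carrier →ₗ[F] A.carrier →ₗ[F] A.carrier :=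
  ((LinearMap.mul F A.carrier).compl₁₂ D.projHarm D.projHarm).compr₂ (D.ρ r)

theorem harmMul_apply (a b : A.carrier) :
    D.harmMul r a b = D.ρ r (D.projHarm a * D.projHarm b) := rfl

/-- The difference between the product on the model and the product of the harmonic parts. -/
noncomputable def mulDefect : A.carrier →ₗ[F] A.carrier →ₗ[F] A.carrier :=
  (LinearMap.mul F A.carrier).compr₂ (D.ρ r) - D.harmMul r

theorem mulDefect_apply (a b : A.carrier) :
    D.mulDefect r a b = D.ρ r (a * b) - D.ρ r (D.projHarm a * D.projHarm b) := rfl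

variable {D r}

theorem harmMul_mem_grading {i j : ℕ} {a b : A.carrier} (ha : a ∈ A.grading i)
    (hb : b ∈ A.grading j) : D.harmMul r a b ∈ A.grading (i + j) :=
  D.ρ_mem_grading (A.mul_mem (D.projHarm_mem_grading ha) (D.projHarm_mem_grading hb))

theorem mulDefect_mem_grading {i j : ℕ} {a b : A.carrier} (ha : a ∈ A.grading i)
    (hb : b ∈ A.grading j) : D.mulDefect r a b ∈ A.grading (i + j) :=
  sub_mem (D.ρ_mem_grading (A.mul_mem ha hb)) (harmMul_mem_grading ha hb)

theorem harmMul_mem_model (a b : A.carrier) : D.harmMul r a b ∈ D.model r := ⟨_, rfl⟩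

theorem mulDefect_mem_model (a b : A.carrier) : D.mulDefect r a b ∈ D.model r :=
  sub_mem ⟨_, rfl⟩ ⟨_, rfl⟩

theorem harmMul_comm {i j : ℕ} {a b : A.carrier} (ha : a ∈ A.grading i)
    (hb : b ∈ A.grading j) : D.harmMul r a b = (-1 : F) ^ (i * j) • D.harmMul r b a := by
  rw [harmMul_apply, harmMul_apply,
    A.graded_comm (D.projHarm_mem_grading ha) (D.projHarm_mem_grading hb), map_smul]

theorem mulDefect_comm {i j : ℕ} {a b : A.carrier} (ha : a ∈ A.grading i)
    (hb : b ∈ A.grading j) : D.mulDefect r a b = (-1 : F) ^ (i * j) • D.mulDefect r b a := by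
  have h : D.mulDefect r a b = D.ρ r (a * b) - D.harmMul r a b := rfl
  have h' : D.mulDefect r b a = D.ρ r (b * a) - D.harmMul r b a := rfl
  rw [h, h', A.graded_comm ha hb, map_smul, harmMul_comm ha hb, smul_sub]

theorem harmMul_leibniz (a b : A.carrier) : A.d (D.harmMul r a b) =
    D.harmMul r (A.d a) b + D.harmMul r (A.signOp a) (A.d b) := by
  simp only [harmMul_apply, D.projHarm_d, ← D.ρ_d, A.leibniz_signOp,
    D.d_of_mem_harm (D.projHarm_mem _), zero_mul, mul_zero, map_zero, add_zero]

theorem mulDefect_leibniz (a b : A.carrier) : A.d (D.mulDefect r a b) =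
    D.mulDefect r (A.d a) b + D.mulDefect r (A.signOp a) (A.d b) := by
  have h : ∀ a b, D.mulDefect r a b = D.ρ r (a * b) - D.harmMul r a b := fun _ _ => rfl
  rw [h, h, h, map_sub, harmMul_leibniz, ← D.ρ_d, A.leibniz_signOp, map_add]
  abel

/-- The difference between the two products has harmonic values and vanishes in small degrees. -/
theorem mulDefect_cases (hA : A.IsHighlyConnected r) {i j : ℕ} {a b : A.carrier}
    (ha : a ∈ D.model r) (hb : b ∈ D.model r) (hi : a ∈ A.grading i) (hj : b ∈ A.grading j) :
    D.mulDefect r a b = 0 ∨ D.mulDefect r a b ∈ D.harm ∧ 3 * r ≤ i + j + 1 := by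
  by_cases hir : i < r
  · rw [eq_zero_of_mem_model hA ha hi hir]
    simp
  by_cases hjr : j < r
  · rw [eq_zero_of_mem_model hA hb hj hjr]
    simp
  by_cases h : i + 1 < 2 * r ∧ j + 1 < 2 * r
  · left
    rw [mulDefect_apply, projHarm_eq_self ha hi h.1, projHarm_eq_self hb hj h.2, sub_self]
  · right
    refine ⟨?_, by omega⟩
    rw [mulDefect_apply, D.ρ_eq_projHarm hA.le (A.mul_mem hi hj) (by omega),
      D.ρ_eq_projHarm hA.le (A.mul_mem (D.projHarm_mem_grading hi) (D.projHarm_mem_grading hj))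
        (by omega)]
    exact sub_mem (D.projHarm_mem _) (D.projHarm_mem _)

theorem mulDefect_harm_left (hA : A.IsHighlyConnected r) {i j : ℕ} {w b : A.carrier}
    (hw : w ∈ D.harm) (hb : b ∈ D.model r) (hi : w ∈ A.grading i) (hj : b ∈ A.grading j)
    (h : 2 * r ≤ i + 1) : D.mulDefect r w b = 0 := by
  have h1 := hA.one_lt
  rw [mulDefect_apply, D.projHarm_of_mem_harm hw, sub_eq_zero]
  conv_lhs => rw [model_decomposition hb]
  rw [mul_add, mul_add, map_add, map_add, ρ_harm_mul_η hA hw hi (A.d_mem hj) h,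
    ρ_harm_mul_d_η hA hw hi hj (by omega), add_zero, add_zero]

theorem mulDefect_harm_right (hA : A.IsHighlyConnected r) {i j : ℕ} {w b : A.carrier}
    (hw : w ∈ D.harm) (hb : b ∈ D.model r) (hi : w ∈ A.grading i) (hj : b ∈ A.grading j)
    (h : 2 * r ≤ i + 1) : D.mulDefect r b w = 0 := by
  rw [mulDefect_comm hj hi, mulDefect_harm_left hA hw hb hi hj h, smul_zero]

/-- The defect is harmonic of degree at least `3r - 1`, and products with such elements have no defect. -/
theorem mulDefect_mulDefect_left (hA : A.IsHighlyConnected r) {i j k : ℕ} {a b c : A.carrier}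
    (ha : a ∈ D.model r) (hb : b ∈ D.model r) (hc : c ∈ D.model r) (hi : a ∈ A.grading i)
    (hj : b ∈ A.grading j) (hk : c ∈ A.grading k) : D.mulDefect r (D.mulDefect r a b) c = 0 := by
  have h1 := hA.one_lt
  rcases mulDefect_cases hA ha hb hi hj with h | ⟨h, h'⟩
  · rw [h, map_zero, LinearMap.zero_apply]
  · exact mulDefect_harm_left hA h hc (mulDefect_mem_grading hi hj) hk (by omega)

theorem mulDefect_mulDefect_right (hA : A.IsHighlyConnected r) {i j k : ℕ} {a b c : A.carrier}
    (ha : a ∈ D.model r) (hb : b ∈ D.model r) (hc : c ∈ D.model r) (hi : a ∈ A.grading i)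
    (hj : b ∈ A.grading j) (hk : c ∈ A.grading k) : D.mulDefect r a (D.mulDefect r b c) = 0 := by
  have h1 := hA.one_lt
  rcases mulDefect_cases hA hb hc hj hk with h | ⟨h, h'⟩
  · rw [h, map_zero]
  · exact mulDefect_harm_right hA h ha (mulDefect_mem_grading hj hk) hi (by omega)

theorem projHarm_harmMul (hA : A.IsHighlyConnected r) {a b : A.carrier} (ha : a ∈ D.model r)
    (hb : b ∈ D.model r) :
    D.projHarm (D.harmMul r a b) = D.projHarm (D.projHarm a * D.projHarm b) := by
  rw [harmMul_apply, D.projHarm_ρ,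
    posHarm_of_mem_tame (mul_mem_tame hA.one_lt hA.connected (projHarm_mem_tame ha)
      (projHarm_mem_tame hb))]

theorem projHarm_congr {a b : A.carrier} {x : A.Coh} (ha : A.Represents a x)
    (hb : A.Represents b x) : D.projHarm a = D.projHarm b := by
  obtain ⟨c, hc⟩ := ha.exists_d_eq_sub hb
  rw [← sub_eq_zero, ← map_sub, ← hc, D.projHarm_d]

/-- In the degrees in which triple products live, `ρ` is the projection to the harmonic elements, so
that the product of three elements is determined by the product of their classes. -/
theorem harmMul_assoc (hA : A.IsHighlyConnected r) {i j k : ℕ} {a b c : A.carrier}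
    (ha : a ∈ D.model r) (hb : b ∈ D.model r) (hc : c ∈ D.model r) (hi : a ∈ A.grading i)
    (hj : b ∈ A.grading j) (hk : c ∈ A.grading k) :
    D.harmMul r (D.harmMul r a b) c = D.harmMul r a (D.harmMul r b c) := by
  by_cases hir : i < r
  · rw [eq_zero_of_mem_model hA ha hi hir]
    simp
  by_cases hjr : j < r
  · rw [eq_zero_of_mem_model hA hb hj hjr]
    simp
  by_cases hkr : k < r
  · rw [eq_zero_of_mem_model hA hc hk hkr]
    simp
  rw [D.harmMul_apply r (D.harmMul r a b), D.harmMul_apply r a (D.harmMul r b c),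
    projHarm_harmMul hA ha hb, projHarm_harmMul hA hb hc]
  have hpi := D.projHarm_mem_grading hi
  have hpj := D.projHarm_mem_grading hj
  have hpk := D.projHarm_mem_grading hk
  rw [D.ρ_eq_projHarm hA.le (A.mul_mem (D.projHarm_mem_grading (A.mul_mem hpi hpj)) hpk) (by omega),
    D.ρ_eq_projHarm hA.le (A.mul_mem hpi (D.projHarm_mem_grading (A.mul_mem hpj hpk))) (by omega)]
  have ra := D.represents_harmClass a
  have rb := D.represents_harmClass b
  have rc := D.represents_harmClass c
  have rab := D.represents_harmClass (D.projHarm a * D.projHarm b)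
  have rbc := D.represents_harmClass (D.projHarm b * D.projHarm c)
  rw [D.harmClass_eq (ra.mul rb)] at rab
  rw [D.harmClass_eq (rb.mul rc)] at rbc
  refine projHarm_congr (rab.mul rc) ?_
  rw [mul_assoc]
  exact ra.mul rbc

end HodgeDecomposition

end PoincareDGCA

/-! ### The homotopy between the two products -/

namespace PoincareDGCA

variable {F : Type u} [Field F] {n : ℕ}

namespace HodgeDecomposition

variable {A : PoincareDGCA.{u, v} F n} {D : A.HodgeDecomposition} {r : ℕ}

theorem ρ_eq_of_int (hA : A.IsHighlyConnected r) {k : ℕ} {a b : A.carrier} (ha : a ∈ A.grading k)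
    (hb : b ∈ A.grading k) (hk : n < k + r) (hI : k = n → A.int a = A.int b) :
    D.ρ r a = D.ρ r b := by
  rw [← sub_eq_zero, ← map_sub]
  refine D.ρ_eq_zero_of_int hA.one_lt hA.connected (sub_mem ha hb) hk ?_
  by_cases h : k = n
  · rw [map_sub, hI h, sub_self]
  · exact int_of_mem_ne (sub_mem ha hb) h

theorem int_projHarm_mul {k l : ℕ} {u w : A.carrier} (hw : w ∈ D.harm) (hk : w ∈ A.grading k)
    (hl : u ∈ A.grading l) : A.int (D.projHarm u * w) = A.int (u * w) := by
  conv_rhs => rw [D.homotopy u]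
  rw [add_mul, add_mul, map_add, map_add, int_d_mul (D.d_of_mem_harm hw),
    D.int_coex_mul (Submodule.mem_sup_left hw) (D.dMinus_mem _) hk
      (D.dMinus_mem_grading (A.d_mem hl)), add_zero, add_zero]

theorem int_mul_projHarm {u w : A.carrier} (hw : w ∈ D.harm) :
    A.int (w * D.projHarm u) = A.int (w * u) := by
  conv_rhs => rw [D.homotopy u]
  rw [mul_add, mul_add, map_add, map_add, int_mul_d (D.d_of_mem_harm hw),
    D.int_mul_coex (Submodule.mem_sup_left hw) (D.dMinus_mem _), add_zero, add_zero]

theorem signOp_mem_harm {k : ℕ} {w : A.carrier} (hw : w ∈ D.harm) (hk : w ∈ A.grading k) :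
    A.signOp w ∈ D.harm := by
  rw [A.signOp_of_mem hk]
  exact Submodule.smul_mem _ _ hw

/-- The restriction to the window of degrees does not matter here: outside of it the product has degree
larger than `n - r` and integral zero. -/
theorem projHarm_η_mul (hA : A.IsHighlyConnected r) {k l : ℕ} {u w : A.carrier} (hw : w ∈ D.harm)
    (hk : w ∈ A.grading k) (hl : u ∈ A.grading l) (hkr : r ≤ k) (hlr : 2 * r ≤ l) :
    D.projHarm (D.η r u * w) = D.projHarm (D.dMinus u * w) := by
  by_cases h : l + 2 * r ≤ n + 1
  · rw [D.η_of_mem r hl hlr h]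
  have h1 := hA.one_lt
  obtain ⟨l, rfl⟩ := Nat.exists_eq_succ_of_ne_zero (show l ≠ 0 by omega)
  have hm := A.mul_mem (D.dMinus_mem_grading hl) hk
  rw [D.η_of_mem_ne r hl (by omega), zero_mul, map_zero, eq_comm]
  refine D.harm_eq_zero_of_int r hA.connected (D.projHarm_mem _) (D.projHarm_mem_grading hm)
    (by omega) ?_
  rw [D.int_projHarm hm, D.int_coex_mul (Submodule.mem_sup_left hw) (D.dMinus_mem _) hk
    (D.dMinus_mem_grading hl)]

theorem projHarm_mul_η (hA : A.IsHighlyConnected r) {k l : ℕ} {u w : A.carrier} (hw : w ∈ D.harm)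
    (hk : w ∈ A.grading k) (hl : u ∈ A.grading l) (hkr : r ≤ k) (hlr : 2 * r ≤ l) :
    D.projHarm (w * D.η r u) = D.projHarm (w * D.dMinus u) := by
  have h1 := hA.one_lt
  obtain ⟨l, rfl⟩ := Nat.exists_eq_succ_of_ne_zero (show l ≠ 0 by omega)
  rw [A.graded_comm hk (D.η_mem_grading r hl), A.graded_comm hk (D.dMinus_mem_grading hl), map_smul,
    map_smul, projHarm_η_mul hA hw hk hl hkr hlr]

end HodgeDecomposition

namespace AdaptedChoice

variable {A : PoincareDGCA.{u, v} F n} (h : A.AdaptedChoice)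

variable (φ : A.Coh →ₗ[F] A.Coh →ₗ[F] A.Coh) (r : ℕ)

/-- The values of `φ` on the classes of the harmonic parts, as harmonic elements. -/
noncomputable def harmLift : A.carrier →ₗ[F] A.carrier →ₗ[F] A.carrier :=
  (φ.compl₁₂ h.hodge.harmClass h.hodge.harmClass).compr₂ h.ι

theorem harmLift_apply (a b : A.carrier) :
    h.harmLift φ a b = h.ι (φ (h.hodge.harmClass a) (h.hodge.harmClass b)) := rfl

/-- The homotopy `ηa · b + (-1)^|a| pa · ηb` between the product and the product of the harmonic
parts `pa`, `pb`, corrected by `φ`. -/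
noncomputable def kappa : A.carrier →ₗ[F] A.carrier →ₗ[F] A.carrier :=
  (h.harmLift φ + LinearMap.mul F A.carrier ∘ₗ h.hodge.η r +
    (LinearMap.mul F A.carrier).compl₁₂ (A.signOp ∘ₗ h.hodge.projHarm) (h.hodge.η r)).compr₂
      (h.hodge.ρ r)

theorem kappa_apply (a b : A.carrier) : h.kappa φ r a b = h.hodge.ρ r (h.harmLift φ a b +
    h.hodge.η r a * b + A.signOp (h.hodge.projHarm a) * h.hodge.η r b) := rfl

variable {h φ r}

theorem harmLift_mem_harm (a b : A.carrier) : h.harmLift φ a b ∈ h.hodge.harm := h.ι_mem_harm _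

theorem harmLift_mem_grading (hφ : h.IsNormalizedPrimitive φ) {i j m : ℕ} {a b : A.carrier}
    (hi : a ∈ A.grading i) (hj : b ∈ A.grading j) (hm : i + j = m + 1) :
    h.harmLift φ a b ∈ A.grading m := by
  have h1 := DGCA.hochCochains₂_mem hφ.mem (h.hodge.harmClass_mem hi) (h.hodge.harmClass_mem hj)
  have e : ((i + j : ℕ) : ℤ) + -1 = (m : ℤ) := by rw [hm]; push_cast; ring
  rw [e, DGCA.intGrading_natCast] at h1
  exact h.isSplitting.map_grading m _ h1

theorem kappa_arg_mem_grading (hφ : h.IsNormalizedPrimitive φ) {i j m : ℕ} {a b : A.carrier}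
    (hi : a ∈ A.grading i) (hj : b ∈ A.grading j) (hm : i + j = m + 1) (hi0 : i ≠ 0)
    (hj0 : j ≠ 0) : h.harmLift φ a b + h.hodge.η r a * b +
      A.signOp (h.hodge.projHarm a) * h.hodge.η r b ∈ A.grading m := by
  refine add_mem (add_mem (harmLift_mem_grading hφ hi hj hm) ?_) ?_
  · obtain ⟨i, rfl⟩ := Nat.exists_eq_succ_of_ne_zero hi0
    rw [show m = i + j by omega]
    exact A.mul_mem (h.hodge.η_mem_grading r hi) hj
  · obtain ⟨j, rfl⟩ := Nat.exists_eq_succ_of_ne_zero hj0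
    rw [show m = i + j by omega]
    exact A.mul_mem (A.signOp_mem (h.hodge.projHarm_mem_grading hi)) (h.hodge.η_mem_grading r hj)

theorem kappa_mem_grading (hφ : h.IsNormalizedPrimitive φ) {i j m : ℕ} {a b : A.carrier}
    (hi : a ∈ A.grading i) (hj : b ∈ A.grading j) (hm : i + j = m + 1) (hi0 : i ≠ 0)
    (hj0 : j ≠ 0) : h.kappa φ r a b ∈ A.grading m :=
  h.hodge.ρ_mem_grading (kappa_arg_mem_grading hφ hi hj hm hi0 hj0)

theorem kappa_mem_model (a b : A.carrier) : h.kappa φ r a b ∈ h.hodge.model r := ⟨_, rfl⟩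

open HodgeDecomposition

/-- The difference of the two products is the boundary of `κ`, by `b = pb + dηb + ηdb` and the analogous
equation for `a`. -/
theorem d_kappa {a b : A.carrier} (ha : a ∈ h.hodge.model r) (hb : b ∈ h.hodge.model r) :
    A.d (h.kappa φ r a b) + h.kappa φ r (A.d a) b + h.kappa φ r (A.signOp a) (A.d b) =
      h.hodge.mulDefect r a b := by
  have e1 : h.kappa φ r (A.d a) b = h.hodge.ρ r (h.hodge.η r (A.d a) * b) := by
    rw [kappa_apply, harmLift_apply, h.hodge.harmClass_d, h.hodge.projHarm_d]
    simp
  have e2 : h.kappa φ r (A.signOp a) (A.d b) = h.hodge.ρ r (h.hodge.η r (A.signOp a) * A.d b +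
      h.hodge.projHarm a * h.hodge.η r (A.d b)) := by
    rw [kappa_apply, harmLift_apply, h.hodge.harmClass_d, h.hodge.signOp_projHarm, A.signOp_signOp]
    simp
  have e3 : A.d (h.kappa φ r a b) = h.hodge.ρ r (A.d (h.hodge.η r a) * b -
      h.hodge.η r (A.signOp a) * A.d b + h.hodge.projHarm a * A.d (h.hodge.η r b)) := by
    rw [kappa_apply, ← h.hodge.ρ_d, map_add A.d, map_add A.d, h.hodge.d_of_mem_harm (harmLift_mem_harm a b),
      A.leibniz_signOp, A.leibniz_signOp, A.d_signOp, A.signOp_signOp,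
      h.hodge.d_of_mem_harm (h.hodge.projHarm_mem a), h.hodge.signOp_η]
    simp [sub_eq_add_neg]
  rw [e1, e2, e3, mulDefect_apply, ← map_add, ← map_add, ← map_sub]
  congr 1
  have hx : h.hodge.η r (A.d a) = a - h.hodge.projHarm a - A.d (h.hodge.η r a) := by
    nth_rewrite 2 [model_decomposition ha]
    abel
  have hy : h.hodge.η r (A.d b) = b - h.hodge.projHarm b - A.d (h.hodge.η r b) := by
    nth_rewrite 2 [model_decomposition hb]
    abel
  rw [hx, hy]
  simp only [sub_mul, mul_sub]
  abel

theorem kappa_eq (hA : A.IsHighlyConnected r) {i j : ℕ} {a b : A.carrier}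
    (hb : b ∈ h.hodge.model r) (hi : a ∈ A.grading i) (hj : b ∈ A.grading j) :
    h.kappa φ r a b = h.hodge.ρ r (h.harmLift φ a b) +
      (h.hodge.ρ r (h.hodge.η r a * h.hodge.projHarm b) +
        h.hodge.ρ r (A.signOp (h.hodge.projHarm a) * h.hodge.η r b)) +
      h.hodge.ρ r (h.hodge.η r a * A.d (h.hodge.η r b)) := by
  have e : h.hodge.ρ r (h.hodge.η r a * b) = h.hodge.ρ r (h.hodge.η r a * h.hodge.projHarm b) +
      h.hodge.ρ r (h.hodge.η r a * A.d (h.hodge.η r b)) := by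
    conv_lhs => rw [model_decomposition hb]
    rw [mul_add, mul_add, map_add, map_add, ρ_η_mul_η hA hi (A.d_mem hj), add_zero]
  rw [kappa_apply, map_add, map_add, e]
  abel

/-- Up to the term `ρ(ηa dηb)` the homotopy is symmetric by its definition, and this term is symmetric
by integration by parts. -/
theorem kappa_comm (hA : A.IsHighlyConnected r) (hφ : h.IsNormalizedPrimitive φ) {i j : ℕ}
    {a b : A.carrier} (ha : a ∈ h.hodge.model r) (hb : b ∈ h.hodge.model r)
    (hi : a ∈ A.grading i) (hj : b ∈ A.grading j) :
    h.kappa φ r a b = (-1 : F) ^ (i * j) • h.kappa φ r b a := by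
  have h1 := hA.one_lt
  by_cases hi0 : i < r
  · rw [eq_zero_of_mem_model hA ha hi hi0]
    simp
  by_cases hj0 : j < r
  · rw [eq_zero_of_mem_model hA hb hj hj0]
    simp
  have key : ∀ {i j : ℕ} {a b : A.carrier}, a ∈ A.grading i → b ∈ A.grading (j + 1) →
      h.hodge.ρ r (A.signOp (h.hodge.projHarm a) * h.hodge.η r b) =
        (-1 : F) ^ (i * (j + 1)) • h.hodge.ρ r (h.hodge.η r b * h.hodge.projHarm a) := by
    intro i j a b hi hj
    have hp := h.hodge.projHarm_mem_grading hi
    rw [A.signOp_of_mem hp, smul_mul_assoc, A.graded_comm hp (h.hodge.η_mem_grading r hj),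
      smul_smul, map_smul, ← pow_add, mul_add, mul_one, add_comm]
  obtain ⟨i, rfl⟩ := Nat.exists_eq_succ_of_ne_zero (show i ≠ 0 by omega)
  obtain ⟨j, rfl⟩ := Nat.exists_eq_succ_of_ne_zero (show j ≠ 0 by omega)
  simp only [Nat.succ_eq_add_one] at *
  have e1 : h.harmLift φ a b = (-1 : F) ^ ((i + 1) * (j + 1)) • h.harmLift φ b a := by
    rw [harmLift_apply, harmLift_apply, hφ.symm (h.hodge.harmClass_mem hi)
      (h.hodge.harmClass_mem hj), map_smul]
  have e4 : h.hodge.ρ r (h.hodge.η r a * A.d (h.hodge.η r b)) =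
      (-1 : F) ^ ((i + 1) * (j + 1)) • h.hodge.ρ r (h.hodge.η r b * A.d (h.hodge.η r a)) := by
    have hη := h.hodge.η_mem_grading r hi
    have hη' := h.hodge.η_mem_grading r hj
    rw [A.graded_comm hη (A.d_mem hη'), map_smul, ρ_d_η_mul_η hA hj hi, A.signOp_of_mem hη',
      smul_mul_assoc, map_smul, smul_neg, smul_smul, ← pow_add, ← neg_smul]
    congr 1
    rw [show (i + 1) * (j + 1) = i * (j + 1) + j + 1 by ring, pow_succ]
    simp
  rw [kappa_eq hA hb hi hj, kappa_eq hA ha hj hi, e1, key hi hj, key hj hi, e4]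
  have e5 : (-1 : F) ^ ((i + 1) * (j + 1)) * (-1 : F) ^ ((j + 1) * (i + 1)) = 1 := by
    rw [mul_comm (j + 1), ← pow_add, ← two_mul, pow_mul]
    simp
  simp only [smul_add, map_smul, smul_smul, e5, one_smul]
  abel

/-- The homotopy has harmonic values, in degrees not less than `2r - 1`. -/
theorem kappa_mem_harm (hA : A.IsHighlyConnected r) (hφ : h.IsNormalizedPrimitive φ) {i j m : ℕ}
    {a b : A.carrier} (hi : a ∈ A.grading i) (hj : b ∈ A.grading j) (hir : r ≤ i) (hjr : r ≤ j)
    (hm : i + j = m + 1) : h.kappa φ r a b ∈ h.hodge.harm := by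
  have h1 := hA.one_lt
  rw [kappa_apply, map_add, map_add]
  refine add_mem (add_mem ?_ ?_) ?_
  · rw [h.hodge.ρ_of_mem_harm r (harmLift_mem_harm a b) (harmLift_mem_grading hφ hi hj hm)
      (by omega)]
    exact harmLift_mem_harm a b
  · by_cases h2 : 2 * r ≤ i ∧ i + 2 * r ≤ n + 1
    · obtain ⟨i, rfl⟩ := Nat.exists_eq_succ_of_ne_zero (show i ≠ 0 by omega)
      rw [h.hodge.ρ_eq_projHarm hA.le (A.mul_mem (h.hodge.η_mem_grading r hi) hj) (by omega)]
      exact h.hodge.projHarm_mem _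
    · rw [h.hodge.η_of_mem_ne r hi h2, zero_mul, map_zero]
      exact zero_mem _
  · by_cases h2 : 2 * r ≤ j ∧ j + 2 * r ≤ n + 1
    · obtain ⟨j, rfl⟩ := Nat.exists_eq_succ_of_ne_zero (show j ≠ 0 by omega)
      rw [h.hodge.ρ_eq_projHarm hA.le (A.mul_mem (A.signOp_mem (h.hodge.projHarm_mem_grading hi))
        (h.hodge.η_mem_grading r hj)) (by omega)]
      exact h.hodge.projHarm_mem _
    · rw [h.hodge.η_of_mem_ne r hj h2, mul_zero, map_zero]
      exact zero_mem _

/-- In these degrees only the integral matters, and this is where `∫ φ = 0` is used. -/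
theorem kappa_harm_left (hA : A.IsHighlyConnected r) (hφ : h.IsNormalizedPrimitive φ) {i j : ℕ}
    {w b : A.carrier} (hw : w ∈ h.hodge.harm) (hb : b ∈ h.hodge.model r) (hi : w ∈ A.grading i)
    (hj : b ∈ A.grading j) (hir : 3 * r ≤ i + 1) : h.kappa φ r w b = 0 := by
  have h1 := hA.one_lt
  have h2 := hA.le
  by_cases hjr : j < r
  · rw [eq_zero_of_mem_model hA hb hj hjr, map_zero]
  obtain ⟨i, rfl⟩ := Nat.exists_eq_succ_of_ne_zero (show i ≠ 0 by omega)
  have hm := harmLift_mem_grading (h := h) hφ hi hj (show i.succ + j = i + j + 1 by omega)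
  have e1 : h.hodge.ρ r (h.harmLift φ w b) = 0 := by
    refine h.hodge.ρ_eq_zero_of_int h1 hA.connected hm (by omega) ?_
    rw [harmLift_apply, int_of_represents (h.represents_ι _), hφ.int]
  rw [kappa_apply, map_add, map_add, e1, h.hodge.η_of_mem_harm r hw, h.hodge.projHarm_of_mem_harm hw,
    ρ_harm_mul_η hA (signOp_mem_harm hw hi) (A.signOp_mem hi) hj (by omega)]
  simp

theorem kappa_harm_right (hA : A.IsHighlyConnected r) (hφ : h.IsNormalizedPrimitive φ) {i j : ℕ}
    {w b : A.carrier} (hw : w ∈ h.hodge.harm) (hb : b ∈ h.hodge.model r) (hi : w ∈ A.grading i)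
    (hj : b ∈ A.grading j) (hir : 3 * r ≤ i + 1) : h.kappa φ r b w = 0 := by
  have h1 := hA.one_lt
  have hw' : w ∈ h.hodge.model r :=
    (h.hodge.mem_model r).2 (h.hodge.ρ_of_mem_harm r hw hi (by omega))
  rw [kappa_comm hA hφ hb hw' hj hi, kappa_harm_left hA hφ hw hb hi hj hir, smul_zero]

theorem signOp_mem_model {i : ℕ} {a : A.carrier} (ha : a ∈ h.hodge.model r)
    (hi : a ∈ A.grading i) : A.signOp a ∈ h.hodge.model r := by
  rw [A.signOp_of_mem hi]
  exact Submodule.smul_mem _ _ ha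

/-- For the difference of the two products, all terms of the cocycle condition vanish. -/
theorem mulDefect_kappa (hA : A.IsHighlyConnected r) (hφ : h.IsNormalizedPrimitive φ) {i j k : ℕ}
    {a b c : A.carrier} (ha : a ∈ h.hodge.model r) (hb : b ∈ h.hodge.model r)
    (hc : c ∈ h.hodge.model r) (hi : a ∈ A.grading i) (hj : b ∈ A.grading j)
    (hk : c ∈ A.grading k) :
    h.hodge.mulDefect r (h.kappa φ r a b) c + h.kappa φ r (h.hodge.mulDefect r a b) c =
      h.kappa φ r a (h.hodge.mulDefect r b c) +
        h.hodge.mulDefect r (A.signOp a) (h.kappa φ r b c) := by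
  have h1 := hA.one_lt
  by_cases hir : i < r
  · rw [eq_zero_of_mem_model hA ha hi hir]
    simp
  by_cases hjr : j < r
  · rw [eq_zero_of_mem_model hA hb hj hjr]
    simp
  by_cases hkr : k < r
  · rw [eq_zero_of_mem_model hA hc hk hkr]
    simp
  obtain ⟨m, hm⟩ := Nat.exists_eq_succ_of_ne_zero (show i + j ≠ 0 by omega)
  obtain ⟨m', hm'⟩ := Nat.exists_eq_succ_of_ne_zero (show j + k ≠ 0 by omega)
  have e1 : h.hodge.mulDefect r (h.kappa φ r a b) c = 0 :=
    mulDefect_harm_left hA (kappa_mem_harm hA hφ hi hj (by omega) (by omega) hm) hc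
      (kappa_mem_grading hφ hi hj hm (by omega) (by omega)) hk (by omega)
  have e2 : h.hodge.mulDefect r (A.signOp a) (h.kappa φ r b c) = 0 :=
    mulDefect_harm_right hA (kappa_mem_harm hA hφ hj hk (by omega) (by omega) hm')
      (signOp_mem_model ha hi) (kappa_mem_grading hφ hj hk hm' (by omega) (by omega))
      (A.signOp_mem hi) (by omega)
  have e3 : h.kappa φ r (h.hodge.mulDefect r a b) c = 0 := by
    rcases mulDefect_cases hA ha hb hi hj with h0 | ⟨h2, h3⟩
    · rw [h0, map_zero, LinearMap.zero_apply]
    · exact kappa_harm_left hA hφ h2 hc (mulDefect_mem_grading hi hj) hk (by omega)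
  have e4 : h.kappa φ r a (h.hodge.mulDefect r b c) = 0 := by
    rcases mulDefect_cases hA hb hc hj hk with h0 | ⟨h2, h3⟩
    · rw [h0, map_zero]
    · exact kappa_harm_right hA hφ h2 ha (mulDefect_mem_grading hj hk) hi (by omega)
  rw [e1, e2, e3, e4]

end AdaptedChoice

end PoincareDGCA

/-! ### The cocycle condition for the homotopy -/

namespace PoincareDGCA

variable {F : Type u} [Field F] {n : ℕ}

namespace AdaptedChoice

open HodgeDecomposition

variable {A : PoincareDGCA.{u, v} F n} {h : A.AdaptedChoice}
  {φ : A.Coh →ₗ[F] A.Coh →ₗ[F] A.Coh} {r : ℕ}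

/-- The part of the cocycle condition for the homotopy which is the equation `δφ = μ₃`. -/
theorem ρ_massey (hA : A.IsHighlyConnected r) (hφ : h.IsNormalizedPrimitive φ) {i j k : ℕ}
    {x y z : A.carrier} (hx : x ∈ h.hodge.harm) (hy : y ∈ h.hodge.harm) (hz : z ∈ h.hodge.harm)
    (hi : x ∈ A.grading i) (hj : y ∈ A.grading j) (hk : z ∈ A.grading k) (hir : r ≤ i)
    (hjr : r ≤ j) (hkr : r ≤ k) :
    h.hodge.ρ r (h.harmLift φ x y * z) + (h.hodge.ρ r (h.harmLift φ (x * y) z) +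
        h.hodge.ρ r (h.hodge.η r (x * y) * z)) =
      (h.hodge.ρ r (h.harmLift φ x (y * z)) +
        h.hodge.ρ r (A.signOp x * h.hodge.η r (y * z))) +
      h.hodge.ρ r (A.signOp x * h.harmLift φ y z) := by
  have h1 := hA.one_lt
  obtain ⟨m, hm⟩ := Nat.exists_eq_succ_of_ne_zero (show i + j + k ≠ 0 by omega)
  obtain ⟨p, hp⟩ := Nat.exists_eq_succ_of_ne_zero (show i + j ≠ 0 by omega)
  obtain ⟨q, hq⟩ := Nat.exists_eq_succ_of_ne_zero (show j + k ≠ 0 by omega)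
  have hxy := A.mul_mem hi hj
  have hyz := A.mul_mem hj hk
  have hs := A.signOp_mem hi
  have m1 : h.harmLift φ x y * z ∈ A.grading m := by
    rw [show m = p + k by omega]
    exact A.mul_mem (harmLift_mem_grading hφ hi hj hp) hk
  have m2 : h.harmLift φ (x * y) z ∈ A.grading m := harmLift_mem_grading hφ hxy hk hm
  have m3 : h.hodge.η r (x * y) * z ∈ A.grading m := by
    rw [show m = p + k by omega]
    rw [hp] at hxy
    exact A.mul_mem (h.hodge.η_mem_grading r hxy) hk
  have m4 : h.harmLift φ x (y * z) ∈ A.grading m :=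
    harmLift_mem_grading hφ hi hyz (by omega)
  have m5 : A.signOp x * h.hodge.η r (y * z) ∈ A.grading m := by
    rw [show m = i + q by omega]
    rw [hq] at hyz
    exact A.mul_mem hs (h.hodge.η_mem_grading r hyz)
  have m6 : A.signOp x * h.harmLift φ y z ∈ A.grading m := by
    rw [show m = i + q by omega]
    exact A.mul_mem hs (harmLift_mem_grading hφ hj hk hq)
  have hm' : 3 * r ≤ m + 1 := by omega
  rw [h.hodge.ρ_eq_projHarm hA.le m1 hm', h.hodge.ρ_eq_projHarm hA.le m2 hm',
    h.hodge.ρ_eq_projHarm hA.le m3 hm', h.hodge.ρ_eq_projHarm hA.le m4 hm',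
    h.hodge.ρ_eq_projHarm hA.le m5 hm', h.hodge.ρ_eq_projHarm hA.le m6 hm',
    projHarm_η_mul hA hz hk hxy hkr (by omega),
    projHarm_mul_η hA (signOp_mem_harm hx hi) hs hyz hir (by omega)]
  simp only [h.projHarm_eq, ← map_add]
  congr 1
  simp only [map_add]
  have rx := h.hodge.represents_of_d_eq_zero (h.hodge.d_of_mem_harm hx)
  have ry := h.hodge.represents_of_d_eq_zero (h.hodge.d_of_mem_harm hy)
  have rz := h.hodge.represents_of_d_eq_zero (h.hodge.d_of_mem_harm hz)
  set X := h.hodge.harmClass x with hX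
  set Y := h.hodge.harmClass y with hY
  set Z := h.hodge.harmClass z with hZ
  have c1 : h.hodge.harmClass (h.harmLift φ x y * z) = φ X Y * Z :=
    h.hodge.harmClass_eq ((h.represents_ι _).mul rz)
  have c2 : h.hodge.harmClass (h.harmLift φ (x * y) z) = φ (X * Y) Z := by
    rw [harmLift_apply, h.harmClass_ι, h.hodge.harmClass_eq (rx.mul ry)]
  have c4 : h.hodge.harmClass (h.harmLift φ x (y * z)) = φ X (Y * Z) := by
    rw [harmLift_apply, h.harmClass_ι, h.hodge.harmClass_eq (ry.mul rz)]
  have c6 : h.hodge.harmClass (A.signOp x * h.harmLift φ y z) =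
      A.cohomology.signOp X * φ Y Z :=
    h.hodge.harmClass_eq ((DGCA.represents_signOp rx).mul (h.represents_ι _))
  have c3 : h.mu₃ X Y Z = h.hodge.harmClass (h.hodge.dMinus (x * y) * z) -
      h.hodge.harmClass (A.signOp x * h.hodge.dMinus (y * z)) := by
    rw [h.mu₃_apply, map_sub, h.primitive_apply, h.primitive_apply, ← h.eq_ι_of_mem_harm hx rx,
      ← h.eq_ι_of_mem_harm hy ry, ← h.eq_ι_of_mem_harm hz rz]
  have c := hφ.delta X Y Z
  rw [c3, sub_eq_iff_eq_add] at c
  rw [c1, c2, c4, c6, c]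
  abel

/-- Both sides have degree at least `4r - 1`, so that it suffices to compare the integrals. -/
theorem ρ_projHarm_η_mul (hA : A.IsHighlyConnected r) {i j k : ℕ} {D : A.HodgeDecomposition}
    {a b c : A.carrier} (hb : b ∈ D.model r) (hi : a ∈ A.grading i)
    (hj : b ∈ A.grading j) (hk : c ∈ A.grading k) (hjr : r ≤ j) (hkr : r ≤ k) :
    D.ρ r (D.projHarm (D.η r a * b) * D.projHarm c) =
      D.ρ r (D.η r a * D.ρ r (D.projHarm b * D.projHarm c)) := by
  have h1 := hA.one_lt
  have h2 := hA.le
  by_cases hw : 2 * r ≤ i ∧ i + 2 * r ≤ n + 1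
  swap
  · rw [D.η_of_mem_ne r hi hw]
    simp
  obtain ⟨i, rfl⟩ := Nat.exists_eq_succ_of_ne_zero (show i ≠ 0 by omega)
  have hη := D.η_mem_grading r hi
  have hpb := D.projHarm_mem_grading hj
  have hpc := D.projHarm_mem_grading hk
  have hyz := A.mul_mem hpb hpc
  refine ρ_eq_of_int hA (k := i + j + k)
    (A.mul_mem (D.projHarm_mem_grading (A.mul_mem hη hj)) hpc) ?_ (by omega) fun hn => ?_
  · rw [add_assoc]
    exact A.mul_mem hη (D.ρ_mem_grading hyz)
  · rw [int_projHarm_mul (D.projHarm_mem c) hpc (A.mul_mem hη hj), projHarm_eq_self hb hj (by omega),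
      mul_assoc]
    rw [projHarm_eq_self hb hj (by omega)] at hyz
    -- In degree `n` the window condition on `η a` bounds the degree of `b`, which is then harmonic, and
    -- places the degree of the cocycle `b · pc` in the range in which `ρ` is the identity on cocycles.
    have hbd : A.d (b * D.projHarm c) = 0 := by
      rw [A.leibniz_signOp, D.d_of_mem_harm (D.projHarm_mem c),
        ← projHarm_eq_self hb hj (by omega), D.d_of_mem_harm (D.projHarm_mem b)]
      simp
    have e : D.ρ r (b * D.projHarm c) = b * D.projHarm c := by
      have hh := D.homotopy (b * D.projHarm c)
      rw [hbd, map_zero, add_zero] at hh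
      rw [ρ_apply, hbd, D.posHarm_of_mem hyz (by omega), D.η_of_mem r hyz (by omega) (by omega),
        map_zero, add_zero]
      exact hh.symm
    rw [e]

/-- The two sides have the same integral, and their degree is at least `4r - 1`. -/
theorem ρ_projHarm_mul_η (hA : A.IsHighlyConnected r) {i j k : ℕ} {D : A.HodgeDecomposition}
    {w b c : A.carrier} (hw : w ∈ D.harm) (hc : c ∈ D.model r) (hi : w ∈ A.grading i)
    (hj : b ∈ A.grading j) (hk : c ∈ A.grading k) (hir : r ≤ i) (hkr : r ≤ k) :
    D.ρ r (D.projHarm (w * D.η r b) * D.projHarm c) =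
      D.ρ r (w * D.projHarm (D.η r b * c)) := by
  have h1 := hA.one_lt
  have h2 := hA.le
  by_cases hwin : 2 * r ≤ j ∧ j + 2 * r ≤ n + 1
  swap
  · rw [D.η_of_mem_ne r hj hwin]
    simp
  obtain ⟨j, rfl⟩ := Nat.exists_eq_succ_of_ne_zero (show j ≠ 0 by omega)
  have hη := D.η_mem_grading r hj
  have hpc := D.projHarm_mem_grading hk
  refine ρ_eq_of_int hA (k := i + j + k)
    (A.mul_mem (D.projHarm_mem_grading (A.mul_mem hi hη)) hpc) ?_ (by omega) fun hn => ?_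
  · rw [add_assoc]
    exact A.mul_mem hi (D.projHarm_mem_grading (A.mul_mem hη hk))
  · rw [int_projHarm_mul (D.projHarm_mem c) hpc (A.mul_mem hi hη), int_mul_projHarm hw,
      projHarm_eq_self hc hk (by omega), mul_assoc]

/-- The contribution of the exact part of `c` is computed by integration by parts, as an identity of
integrals in degree `n`. -/
theorem ρ_η_mul_sub (hA : A.IsHighlyConnected r) {i j k : ℕ} {D : A.HodgeDecomposition}
    {x y c : A.carrier} (hx : x ∈ D.harm) (hy : y ∈ D.harm) (hc : c ∈ D.model r)
    (hi : x ∈ A.grading i) (hj : y ∈ A.grading j) (hk : c ∈ A.grading k) (hir : r ≤ i)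
    (hjr : r ≤ j) :
    D.ρ r (D.η r (x * y) * c) =
      D.ρ r (D.η r (x * y) * D.projHarm c) +
        D.ρ r (A.signOp x * D.projHarm (A.signOp y * D.η r c)) := by
  have h1 := hA.one_lt
  have h2 := hA.le
  have hxy := A.mul_mem hi hj
  conv_lhs => rw [model_decomposition hc]
  rw [mul_add, mul_add, map_add, map_add, ρ_η_mul_η hA hxy (A.d_mem hk), add_zero]
  congr 1
  by_cases hwin : 2 * r ≤ k ∧ k + 2 * r ≤ n + 1
  swap
  · rw [D.η_of_mem_ne r hk hwin]
    simp
  obtain ⟨k, rfl⟩ := Nat.exists_eq_succ_of_ne_zero (show k ≠ 0 by omega)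
  obtain ⟨p, hp⟩ := Nat.exists_eq_succ_of_ne_zero (show i + j ≠ 0 by omega)
  rw [hp] at hxy
  have hη := D.η_mem_grading r hk
  have hsx := A.signOp_mem hi
  have hsy := A.signOp_mem hj
  refine ρ_eq_of_int hA (k := i + j + k) ?_ ?_ (by omega) fun hn => ?_
  · rw [show i + j + k = p + (k + 1) by omega]
    exact A.mul_mem (D.η_mem_grading r hxy) (A.d_mem hη)
  · rw [add_assoc]
    exact A.mul_mem hsx (D.projHarm_mem_grading (A.mul_mem hsy hη))
  · have hd : A.d (x * y) = 0 := by
      rw [A.leibniz_signOp, D.d_of_mem_harm hx, D.d_of_mem_harm hy]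
      simp
    have e := D.homotopy (x * y)
    rw [hd, map_zero, add_zero, ← D.η_of_mem r hxy (by omega) (by omega)] at e
    have e2 : A.int (A.d (A.signOp (D.η r (x * y)) * D.η r c)) = 0 := int_d _
    rw [A.leibniz_signOp, A.signOp_signOp, A.d_signOp, neg_mul, map_add, map_neg] at e2
    have e3 : A.int (A.signOp (D.projHarm (x * y)) * D.η r c) = 0 :=
      D.int_mul_coex (Submodule.mem_sup_left
        (signOp_mem_harm (D.projHarm_mem _) (D.projHarm_mem_grading hxy))) (D.η_mem_coex r c)
    rw [int_mul_projHarm (signOp_mem_harm hx hi), ← mul_assoc, ← A.signOp_mul]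
    conv_rhs => rw [e]
    rw [map_add, add_mul, map_add, e3, zero_add]
    linear_combination e2

/-- The homotopy satisfies the Hochschild cocycle condition for the product of the harmonic
parts. -/
theorem harmMul_kappa (hA : A.IsHighlyConnected r) (hφ : h.IsNormalizedPrimitive φ) {i j k : ℕ}
    {a b c : A.carrier} (ha : a ∈ h.hodge.model r) (hb : b ∈ h.hodge.model r)
    (hc : c ∈ h.hodge.model r) (hi : a ∈ A.grading i) (hj : b ∈ A.grading j)
    (hk : c ∈ A.grading k) :
    h.hodge.harmMul r (h.kappa φ r a b) c + h.kappa φ r (h.hodge.harmMul r a b) c =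
      h.kappa φ r a (h.hodge.harmMul r b c) +
        h.hodge.harmMul r (A.signOp a) (h.kappa φ r b c) := by
  have h1 := hA.one_lt
  by_cases hir : i < r
  · rw [eq_zero_of_mem_model hA ha hi hir]
    simp
  by_cases hjr : j < r
  · rw [eq_zero_of_mem_model hA hb hj hjr]
    simp
  by_cases hkr : k < r
  · rw [eq_zero_of_mem_model hA hc hk hkr]
    simp
  have hpi := h.hodge.projHarm_mem_grading hi
  have hpj := h.hodge.projHarm_mem_grading hj
  have hpk := h.hodge.projHarm_mem_grading hk
  have hpa := h.hodge.projHarm_mem a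
  have hpb := h.hodge.projHarm_mem b
  have hpc := h.hodge.projHarm_mem c
  have hxy := A.mul_mem hpi hpj
  -- The harmonic part of the homotopy.
  have eκ : ∀ {i j : ℕ} {a b : A.carrier}, a ∈ A.grading i → b ∈ A.grading j → r ≤ i → r ≤ j →
      h.hodge.projHarm (h.kappa φ r a b) = h.harmLift φ a b + h.hodge.projHarm (h.hodge.η r a * b) +
        h.hodge.projHarm (A.signOp (h.hodge.projHarm a) * h.hodge.η r b) := by
    intro i j a b hi hj hir hjr
    obtain ⟨m, hm⟩ := Nat.exists_eq_succ_of_ne_zero (show i + j ≠ 0 by omega)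
    rw [kappa_apply, h.hodge.projHarm_ρ, h.hodge.posHarm_of_mem
      (kappa_arg_mem_grading hφ hi hj hm (by omega) (by omega)) (by omega), map_add, map_add,
      h.hodge.projHarm_of_mem_harm (harmLift_mem_harm a b)]
  have eL : ∀ {a b a' b' : A.carrier}, h.hodge.projHarm a = h.hodge.projHarm a' →
      h.hodge.projHarm b = h.hodge.projHarm b' → h.harmLift φ a b = h.harmLift φ a' b' := by
    intro a b a' b' h2 h3
    rw [harmLift_apply, harmLift_apply, harmClass_congr h2, harmClass_congr h3]
  have epp : ∀ a, h.hodge.projHarm (h.hodge.projHarm a) = h.hodge.projHarm a :=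
    fun a => h.hodge.projHarm_of_mem_harm (h.hodge.projHarm_mem a)
  have eab := projHarm_harmMul hA ha hb
  have ebc := projHarm_harmMul hA hb hc
  have t1 : h.hodge.harmMul r (h.kappa φ r a b) c =
      h.hodge.ρ r (h.harmLift φ (h.hodge.projHarm a) (h.hodge.projHarm b) * h.hodge.projHarm c) +
      h.hodge.ρ r (h.hodge.η r a *
        h.hodge.ρ r (h.hodge.projHarm b * h.hodge.projHarm c)) +
      h.hodge.ρ r (A.signOp (h.hodge.projHarm a) * h.hodge.projHarm (h.hodge.η r b * c)) := by
    rw [harmMul_apply, eκ hi hj (by omega) (by omega), add_mul, add_mul, map_add, map_add,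
      ρ_projHarm_η_mul hA hb hi hj hk (by omega) (by omega),
      ρ_projHarm_mul_η hA (signOp_mem_harm hpa hpi) hc (A.signOp_mem hpi) hj hk (by omega)
        (by omega), eL (epp a).symm (epp b).symm]
  have t2 : h.kappa φ r (h.hodge.harmMul r a b) c =
      h.hodge.ρ r (h.harmLift φ (h.hodge.projHarm a * h.hodge.projHarm b) (h.hodge.projHarm c)) +
      (h.hodge.ρ r (h.hodge.η r (h.hodge.projHarm a * h.hodge.projHarm b) * h.hodge.projHarm c) +
        h.hodge.ρ r (A.signOp (h.hodge.projHarm a) *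
          h.hodge.projHarm (A.signOp (h.hodge.projHarm b) * h.hodge.η r c))) := by
    have hs := h.hodge.projHarm_mem_grading hxy
    rw [kappa_apply, eab, map_add, map_add, eL eab (epp c).symm,
      ρ_harm_mul_η hA (signOp_mem_harm (h.hodge.projHarm_mem _) hs) (A.signOp_mem hs) hk (by omega),
      harmMul_apply, h.hodge.η_ρ, ρ_η_mul_sub hA hpa hpb hc hpi hpj hk (by omega) (by omega),
      add_zero]
  have t3 : h.kappa φ r a (h.hodge.harmMul r b c) =
      h.hodge.ρ r (h.harmLift φ (h.hodge.projHarm a) (h.hodge.projHarm b * h.hodge.projHarm c)) +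
      h.hodge.ρ r (h.hodge.η r a *
        h.hodge.ρ r (h.hodge.projHarm b * h.hodge.projHarm c)) +
      h.hodge.ρ r (A.signOp (h.hodge.projHarm a) *
        h.hodge.η r (h.hodge.projHarm b * h.hodge.projHarm c)) := by
    rw [kappa_apply, map_add, map_add, eL (epp a).symm ebc, harmMul_apply, h.hodge.η_ρ]
  have t4 : h.hodge.harmMul r (A.signOp a) (h.kappa φ r b c) =
      h.hodge.ρ r (A.signOp (h.hodge.projHarm a) *
        h.harmLift φ (h.hodge.projHarm b) (h.hodge.projHarm c)) +
      h.hodge.ρ r (A.signOp (h.hodge.projHarm a) * h.hodge.projHarm (h.hodge.η r b * c)) +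
      h.hodge.ρ r (A.signOp (h.hodge.projHarm a) *
        h.hodge.projHarm (A.signOp (h.hodge.projHarm b) * h.hodge.η r c)) := by
    rw [harmMul_apply, ← h.hodge.signOp_projHarm, eκ hj hk (by omega) (by omega), mul_add, mul_add,
      map_add, map_add, eL (epp b).symm (epp c).symm]
  -- The terms which contain `η a`, `η b` or `η c` cancel in pairs, and the others satisfy `ρ_massey`.
  have t := ρ_massey hA hφ hpa hpb hpc hpi hpj hpk (by omega) (by omega) (by omega)
  rw [t1, t2, t3, t4]
  rw [← add_assoc, ← sub_eq_zero] at t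
  rw [← sub_eq_zero, ← t]
  abel

end AdaptedChoice

end PoincareDGCA

/-! ### Formality -/

theorem BoundedComplex.hom_induction₃ {F : Type u} [Field F] {E : BoundedComplex.{u, v} F}
    {p : E.carrier → E.carrier → E.carrier → Prop}
    (hh : ∀ {i j k : ℕ} {a b c : E.carrier}, a ∈ E.gr i → b ∈ E.gr j → c ∈ E.gr k → p a b c)
    (h1 : ∀ a a' b c, p a b c → p a' b c → p (a + a') b c)
    (h2 : ∀ a b b' c, p a b c → p a b' c → p a (b + b') c)
    (h3 : ∀ a b c c', p a b c → p a b c' → p a b (c + c')) (a b c : E.carrier) : p a b c := by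
  have s1 : ∀ {i j : ℕ} {a b : E.carrier}, a ∈ E.gr i → b ∈ E.gr j → ∀ c, p a b c :=
    fun ha hb c => hom_induction (hh ha hb (zero_mem (E.gr 0))) (fun _ c hc => hh ha hb hc)
      (fun c c' => h3 _ _ c c') c
  have s2 : ∀ {i : ℕ} {a : E.carrier}, a ∈ E.gr i → ∀ b c, p a b c :=
    fun ha b c => hom_induction (s1 ha (zero_mem (E.gr 0)) c) (fun _ b hb => s1 ha hb c)
      (fun b b' => h2 _ b b' c) b
  exact hom_induction (s2 (zero_mem (E.gr 0)) b c) (fun _ a ha => s2 ha b c)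
    (fun a a' => h1 a a' b c) a

namespace PoincareDGCA

variable {F : Type u} [Field F] {n : ℕ}

namespace HodgeDecomposition

variable {A : PoincareDGCA.{u, v} F n} (D : A.HodgeDecomposition) (r : ℕ)

/-- A bilinear map with values in the model, restricted to the model. -/
noncomputable def modelMap (β : A.carrier →ₗ[F] A.carrier →ₗ[F] A.carrier)
    (hβ : ∀ a b, β a b ∈ D.model r) : D.model r →ₗ[F] D.model r →ₗ[F] D.model r :=
  LinearMap.mk₂ F (fun a b => ⟨β a b, hβ a b⟩)
    (fun _ _ _ => Subtype.ext (by simp)) (fun _ _ _ => Subtype.ext (by simp))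
    (fun _ _ _ => Subtype.ext (by simp)) (fun _ _ _ => Subtype.ext (by simp))

end HodgeDecomposition

namespace AdaptedChoice

open HodgeDecomposition

section Deformation

variable {A : PoincareDGCA.{u, v} F n} {h : A.AdaptedChoice}
  {φ : A.Coh →ₗ[F] A.Coh →ₗ[F] A.Coh} {r : ℕ}

theorem harmMul_assoc_model (hA : A.IsHighlyConnected r) (a b c : h.hodge.model r) :
    h.hodge.harmMul r (h.hodge.harmMul r a b) c = h.hodge.harmMul r a (h.hodge.harmMul r b c) :=
  BoundedComplex.hom_induction₃ (E := h.hodge.modelComplex r)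
    (p := fun a b c : h.hodge.model r => h.hodge.harmMul r (h.hodge.harmMul r a b) c =
      h.hodge.harmMul r a (h.hodge.harmMul r b c))
    (fun {i j k a b c} ha hb hc => harmMul_assoc hA a.2 b.2 c.2 (mem_subcomplex_gr.1 ha)
      (mem_subcomplex_gr.1 hb) (mem_subcomplex_gr.1 hc))
    (fun _ _ _ _ h1 h2 => by
      simp only [Submodule.coe_add, map_add, LinearMap.add_apply, h1, h2])
    (fun _ _ _ _ h1 h2 => by
      simp only [Submodule.coe_add, map_add, LinearMap.add_apply, h1, h2])
    (fun _ _ _ _ h1 h2 => by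
      simp only [Submodule.coe_add, map_add, h1, h2]) a b c

theorem mulDefect_mulDefect_model (hA : A.IsHighlyConnected r) (a b c : h.hodge.model r) :
    h.hodge.mulDefect r (h.hodge.mulDefect r a b) c =
      h.hodge.mulDefect r a (h.hodge.mulDefect r b c) :=
  BoundedComplex.hom_induction₃ (E := h.hodge.modelComplex r)
    (p := fun a b c : h.hodge.model r => h.hodge.mulDefect r (h.hodge.mulDefect r a b) c =
      h.hodge.mulDefect r a (h.hodge.mulDefect r b c))
    (fun {i j k a b c} ha hb hc => by
      have hi := mem_subcomplex_gr.1 ha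
      have hj := mem_subcomplex_gr.1 hb
      have hk := mem_subcomplex_gr.1 hc
      rw [mulDefect_mulDefect_left hA a.2 b.2 c.2 hi hj hk,
        mulDefect_mulDefect_right hA a.2 b.2 c.2 hi hj hk])
    (fun _ _ _ _ h1 h2 => by
      simp only [Submodule.coe_add, map_add, LinearMap.add_apply, h1, h2])
    (fun _ _ _ _ h1 h2 => by
      simp only [Submodule.coe_add, map_add, LinearMap.add_apply, h1, h2])
    (fun _ _ _ _ h1 h2 => by
      simp only [Submodule.coe_add, map_add, h1, h2]) a b c

theorem mul_assoc_model (hA : A.IsHighlyConnected r) (a b c : h.hodge.model r) :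
    h.hodge.ρ r (h.hodge.ρ r (a * b) * c) = h.hodge.ρ r (a * h.hodge.ρ r (b * c)) := by
  have ha := model_le_tame hA.one_lt a.2
  have hb := model_le_tame hA.one_lt b.2
  have hc := model_le_tame hA.one_lt c.2
  rw [ρ_ρ_mul hA.one_lt hA.le hA.connected (mul_mem_tame hA.one_lt hA.connected ha hb) hc,
    ρ_mul_ρ hA.one_lt hA.le hA.connected ha (mul_mem_tame hA.one_lt hA.connected hb hc), mul_assoc]

theorem mulDefect_harmMul_model (hA : A.IsHighlyConnected r) (a b c : h.hodge.model r) :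
    h.hodge.mulDefect r (h.hodge.harmMul r a b) c + h.hodge.harmMul r (h.hodge.mulDefect r a b) c =
      h.hodge.mulDefect r a (h.hodge.harmMul r b c) +
        h.hodge.harmMul r a (h.hodge.mulDefect r b c) := by
  have e : ∀ x y, h.hodge.ρ r (x * y) = h.hodge.harmMul r x y + h.hodge.mulDefect r x y := by
    intro x y
    change _ = h.hodge.harmMul r x y + (h.hodge.ρ r (x * y) - h.hodge.harmMul r x y)
    abel
  have h1 := mul_assoc_model hA a b c
  simp only [e, map_add, LinearMap.add_apply] at h1
  rw [harmMul_assoc_model hA, mulDefect_mulDefect_model hA] at h1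
  have aux : ∀ p q s t x y : A.carrier, p + q + (s + x) = p + t + (y + x) → s + q = y + t := by
    intro p q s t x y hh
    have h2 : p + x + (s + q) = p + x + (y + t) := by
      calc p + x + (s + q) = p + q + (s + x) := by abel
        _ = p + t + (y + x) := hh
        _ = p + x + (y + t) := by abel
    exact add_left_cancel h2
  exact aux _ _ _ _ _ _ h1

theorem add_eq_add_of {M : Type*} [AddCommGroup M] {x y z w x' y' z' w' : M}
    (h1 : x + y = z + w) (h2 : x' + y' = z' + w') : x + x' + (y + y') = z + z' + (w + w') := by
  rw [add_add_add_comm, h1, h2, add_add_add_comm]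

theorem cocycle_model (β : A.carrier →ₗ[F] A.carrier →ₗ[F] A.carrier)
    (hβ : ∀ {i j k : ℕ} {a b c : A.carrier}, a ∈ h.hodge.model r → b ∈ h.hodge.model r →
      c ∈ h.hodge.model r → a ∈ A.grading i → b ∈ A.grading j → c ∈ A.grading k →
      β (h.kappa φ r a b) c + h.kappa φ r (β a b) c =
        h.kappa φ r a (β b c) + β (A.signOp a) (h.kappa φ r b c)) (a b c : h.hodge.model r) :
    β (h.kappa φ r a b) c + h.kappa φ r (β a b) c =
      h.kappa φ r a (β b c) + β (A.signOp a) (h.kappa φ r b c) :=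
  BoundedComplex.hom_induction₃ (E := h.hodge.modelComplex r)
    (p := fun a b c : h.hodge.model r => β (h.kappa φ r a b) c + h.kappa φ r (β a b) c =
      h.kappa φ r a (β b c) + β (A.signOp a) (h.kappa φ r b c))
    (fun {i j k a b c} ha hb hc => hβ a.2 b.2 c.2 (mem_subcomplex_gr.1 ha)
      (mem_subcomplex_gr.1 hb) (mem_subcomplex_gr.1 hc))
    (fun _ _ _ _ h1 h2 => by
      simp only [Submodule.coe_add, map_add, LinearMap.add_apply]
      exact add_eq_add_of h1 h2)
    (fun _ _ _ _ h1 h2 => by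
      simp only [Submodule.coe_add, map_add, LinearMap.add_apply]
      exact add_eq_add_of h1 h2)
    (fun _ _ _ _ h1 h2 => by
      simp only [Submodule.coe_add, map_add]
      exact add_eq_add_of h1 h2) a b c

/-- The family of products on the model which interpolates between the product of the harmonic parts
and the product induced by the product of `A`. -/
noncomputable def deformation (hA : A.IsHighlyConnected r) (hφ : h.IsNormalizedPrimitive φ) :
    (h.hodge.modelComplex r).Deformation where
  μ := h.hodge.modelMap r (h.hodge.harmMul r) harmMul_mem_model
  m := h.hodge.modelMap r (h.hodge.mulDefect r) mulDefect_mem_model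
  κ := h.hodge.modelMap r (h.kappa φ r) kappa_mem_model
  μ_mem ha hb := mem_subcomplex_gr.2
    (harmMul_mem_grading (mem_subcomplex_gr.1 ha) (mem_subcomplex_gr.1 hb))
  m_mem ha hb := mem_subcomplex_gr.2
    (mulDefect_mem_grading (mem_subcomplex_gr.1 ha) (mem_subcomplex_gr.1 hb))
  κ_mem {i j a b} ha hb := by
    have hi := mem_subcomplex_gr.1 ha
    have hj := mem_subcomplex_gr.1 hb
    have h1 := hA.one_lt
    by_cases hi0 : i = 0
    · have h0 : a = 0 := Subtype.ext (eq_zero_of_mem_model hA a.2 hi (by omega))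
      rw [h0, map_zero, LinearMap.zero_apply]
      exact zero_mem _
    by_cases hj0 : j = 0
    · have h0 : b = 0 := Subtype.ext (eq_zero_of_mem_model hA b.2 hj (by omega))
      rw [h0, map_zero]
      exact zero_mem _
    obtain ⟨m, hm⟩ := Nat.exists_eq_succ_of_ne_zero (show i + j ≠ 0 by omega)
    rw [hm]
    exact BoundedComplex.mem_shiftGr_succ.2
      (mem_subcomplex_gr.2 (kappa_mem_grading hφ hi hj hm hi0 hj0))
  μ_assoc a b c := Subtype.ext (harmMul_assoc_model hA a b c)
  mixed_assoc a b c := Subtype.ext (mulDefect_harmMul_model hA a b c)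
  m_assoc a b c := Subtype.ext (mulDefect_mulDefect_model hA a b c)
  μ_comm ha hb := Subtype.ext
    (harmMul_comm (mem_subcomplex_gr.1 ha) (mem_subcomplex_gr.1 hb))
  m_comm ha hb := Subtype.ext
    (mulDefect_comm (mem_subcomplex_gr.1 ha) (mem_subcomplex_gr.1 hb))
  κ_comm {i j a b} ha hb := Subtype.ext
    (kappa_comm hA hφ a.2 b.2 (mem_subcomplex_gr.1 ha) (mem_subcomplex_gr.1 hb))
  μ_leibniz a b := Subtype.ext ((harmMul_leibniz (D := h.hodge) (r := r) a.1 b.1).trans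
    (congrArg (fun s => h.hodge.harmMul r (A.d a.1) b.1 + h.hodge.harmMul r s (A.d b.1))
      (coe_subcomplex_sign a).symm))
  m_leibniz a b := Subtype.ext ((mulDefect_leibniz (D := h.hodge) (r := r) a.1 b.1).trans
    (congrArg (fun s => h.hodge.mulDefect r (A.d a.1) b.1 + h.hodge.mulDefect r s (A.d b.1))
      (coe_subcomplex_sign a).symm))
  μ_κ a b c := Subtype.ext ((cocycle_model _ (harmMul_kappa hA hφ) a b c).trans
    (congrArg (fun s => h.kappa φ r a.1 (h.hodge.harmMul r b.1 c.1) +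
      h.hodge.harmMul r s (h.kappa φ r b.1 c.1)) (coe_subcomplex_sign a).symm))
  m_κ a b c := Subtype.ext ((cocycle_model _ (mulDefect_kappa hA hφ) a b c).trans
    (congrArg (fun s => h.kappa φ r a.1 (h.hodge.mulDefect r b.1 c.1) +
      h.hodge.mulDefect r s (h.kappa φ r b.1 c.1)) (coe_subcomplex_sign a).symm))
  d_κ a b := Subtype.ext ((congrArg (fun s => A.d (h.kappa φ r a.1 b.1) +
    h.kappa φ r (A.d a.1) b.1 + h.kappa φ r s (A.d b.1)) (coe_subcomplex_sign a)).trans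
      (d_kappa a.2 b.2))

end Deformation

section Formality

variable {A : PoincareDGCA.{u, u} F n}

/-- If the class of `μ₃` vanishes, then a highly connected Poincaré DGCA is formal. -/
theorem isFormal_of_mem [CharZero F] {r : ℕ} (h : A.AdaptedChoice) (hA : A.IsHighlyConnected r)
    (hμ : h.mu₃ ∈ A.cohomology.hochCoboundaries₃ (-1)) : A.IsFormal := by
  obtain ⟨φ, hφ⟩ := h.exists_isNormalizedPrimitive hμ
  have e1 := modelHom_isQuasiIso (D := h.hodge) hA.one_lt hA.le hA.connected
    ((deformation hA hφ).fibre 1) (fun a b => by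
      change h.hodge.harmMul r a b + (1 : F) • h.hodge.mulDefect r a b = _
      rw [one_smul, mulDefect_apply, harmMul_apply]
      abel)
  have e0 := cohomologyHom_isQuasiIso (D := h.hodge) hA.one_lt hA.connected
    ((deformation hA hφ).fibre 0) (fun a b => by
      change h.hodge.harmMul r a b + (0 : F) • h.hodge.mulDefect r a b = _
      rw [zero_smul, add_zero, harmMul_apply])
  have s1 : DGCA.Equivalent (tameProduct (D := h.hodge) hA.one_lt hA.connected).toDGCA A.toDGCA :=
    Relation.EqvGen.rel _ _ ⟨_, tameHom_isQuasiIso hA.one_lt hA.connected⟩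
  have s2 : DGCA.Equivalent (tameProduct (D := h.hodge) hA.one_lt hA.connected).toDGCA
      ((deformation hA hφ).fibre 1).toDGCA := Relation.EqvGen.rel _ _ ⟨_, e1⟩
  have s3 := (deformation hA hφ).equivalent_fibre 1 0
  have s4 : DGCA.Equivalent ((deformation hA hφ).fibre 0).toDGCA A.cohomology :=
    Relation.EqvGen.rel _ _ ⟨_, e0⟩
  exact ((s1.symm.trans _ _ _ s2).trans _ _ _ s3).trans _ _ _ s4

end Formality

end AdaptedChoice

end PoincareDGCA

theorem theorem4p6 {F : Type u} [Field F] [CharZero F] (r n : ℕ) (hr : 1 < r)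
    (hn : n ≤ 5 * r - 3) (A : PoincareDGCA.{u, u} F n) (hconn : A.IsConnected (r - 1))
    (hHodge : A.IsHodgeType) :
    Nonempty A.AdaptedChoice ∧
      ∃ c : A.cohomology.Hoch₃ (-1),
        (∀ h : A.AdaptedChoice, ∃ hz : h.mu₃ ∈ A.cohomology.hochCocycles₃ (-1),
          A.cohomology.hochClass₃ (-1) ⟨h.mu₃, hz⟩ = c) ∧
        (A.IsFormal ↔ c = 0) := by
  obtain ⟨h₀⟩ := PoincareDGCA.nonempty_adaptedChoice hconn hHodge
  have hA : A.IsHighlyConnected r := ⟨hr, by omega, hconn⟩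
  refine ⟨⟨h₀⟩, A.cohomology.hochClass₃ (-1) ⟨h₀.mu₃, h₀.mu₃_mem_hochCocycles₃⟩, fun h => ?_, ?_⟩
  · refine ⟨h.mu₃_mem_hochCocycles₃, ?_⟩
    exact (Submodule.Quotient.eq _).2 (h.mu₃_sub_mu₃_mem h₀)
  · have key : A.cohomology.hochClass₃ (-1) ⟨h₀.mu₃, h₀.mu₃_mem_hochCocycles₃⟩ = 0 ↔
        h₀.mu₃ ∈ A.cohomology.hochCoboundaries₃ (-1) := Submodule.Quotient.mk_eq_zero _
    rw [key]
    exact ⟨fun hf => h₀.mu₃_mem_of_isMasseyTrivial hf.isMasseyTrivial,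
      fun hμ => h₀.isFormal_of_mem hA hμ⟩
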